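/- **Calculus.** Fix two layers $i\in\{0,1\}$; $x$ ranges over local variables, $u$ over global variables, $g$ over context variables, $m$ over natural numbers. The syntax is - types $S,T ::= \mathtt{Nat}\mid S\to T\mid \square(\Delta\vdash T)\mid (g:\mathsf{Ctx})\Rightarrow T$; - local contexts $\Gamma,\Delta ::= \cdot\mid g\mid \Gamma,x:T$; global contexts $\Psi ::= \cdot\mid \Psi,u:(\Gamma\vdash T)\mid\Psi,g:\mathsf{Ctx}$; - local substitutions $\delta ::= \cdot^m\mid \cdot_g^m\mid \mathsf{wk}_g^m\mid \delta,t/x$; - terms $s,t ::= x\mid u^\delta\mid \mathsf{zero}\mid\mathsf{succ}\,t\mid \mathsf{box}\,t\mid \mathsf{letbox}_{T'}\,u\leftarrow s\ \mathsf{in}\ t\mid\lambda x.t\mid s\,t\mid \Lambda g.t\mid t\,\$\,\Gamma$, where $\mathsf{letbox}$ records its result type $T'$. $|\Gamma|$ is the number of local variables of $\Gamma$, and $\Gamma$ *ends with* $\cdot$ or with a context variable $g$. Weakenings by fresh variables are left implicit, except that a local weakening by $k$ variables also turns the exponent $m$ at the base of a local substitution into $m+k$. Put $\mathsf{wk}^m_{\cdot}=\cdot^m$,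 $\mathsf{wk}^m_{g}=\mathsf{wk}_g^m$, $\mathsf{wk}^m_{\Gamma,x:T}=(\mathsf{wk}^{m+1}_{\Gamma},x/x)$ and $\mathrm{id}_\Gamma=\mathsf{wk}^0_\Gamma$. *Local substitution* $t[\delta]$ replaces local variables and composes with the $\delta'$ of each $u^{\delta'}$; it does not enter $\mathsf{box}$ (so $(\mathsf{box}\,t)[\delta]=\mathsf{box}\,t$), nor does local weakening. If $\hat\delta$ and $\check\delta$ denote the exponent and the optional context variable at the base of $\delta$, then $\mathsf{wk}_g^m\circ\delta=\mathsf{wk}_g^{\hat\delta}$, $\cdot^m\circ\delta=\cdot_{\check\delta}^{\hat\delta}$, $\cdot_g^m\circ\delta=\cdot_g^{\hat\delta}$, $(\delta',t/x)\circ\delta=(\delta'\circ\delta),t[\delta]/x$. *Global substitution* $[s/u]$, $[\Delta/g]$ acts on types, contexts, terms (also under $\mathsf{box}$) and local substitutions by $u^\delta[\sigma]=\sigma(u)[\delta[\sigma]]$, $g[\sigma]=\sigma(g)$, $\mathsf{wk}_g^m[\sigma]=\mathsf{wk}^m_{\sigma(g)}$, $\cdot^m[\sigma]=\cdot^m$,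 and $\cdot_g^m[\sigma]=\cdot_{g'}^{|\sigma(g)|+m}$ or $\cdot^{|\sigma(g)|+m}$ according to whether $\sigma(g)$ ends with $g'$ or with $\cdot$; variables not mentioned in $[s/u]$, $[\Delta/g]$ are left unchanged. *Well-formedness.* $\vdash\cdot$; $\vdash\Psi,g:\mathsf{Ctx}$ if $\vdash\Psi$; $\vdash\Psi,u:(\Gamma\vdash T)$ if $\Psi\vdash_0\Gamma$ and $\Psi\vdash_0T$. $\Psi\vdash_i\cdot$ if $\vdash\Psi$; $\Psi\vdash_i g$ if $\vdash\Psi$ and $g:\mathsf{Ctx}\in\Psi$; $\Psi\vdash_i\Gamma,x:T$ if $\Psi\vdash_i\Gamma$ and $\Psi\vdash_iT$. $\Psi\vdash_i\mathtt{Nat}$ if $\vdash\Psi$; $\Psi\vdash_iS\to T$ if $\Psi\vdash_iS$ and $\Psi\vdash_iT$; $\Psi\vdash_1\square(\Delta\vdash T)$ if $\Psi\vdash_0\Delta$ and $\Psi\vdash_0T$; $\Psi\vdash_1(g:\mathsf{Ctx})\Rightarrow T$ if $\Psi,g:\mathsf{Ctx}\vdash_1T$. *Typing* $\Psi;\Gamma\vdash_it:T$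 and $\Psi;\Gamma\vdash_i\delta:\Delta$: - $x:T$ if $\Psi\vdash_i\Gamma$ and $x:T\in\Gamma$; $u^\delta:T$ if $\Psi;\Gamma\vdash_i\delta:\Delta$ and $u:(\Delta\vdash T)\in\Psi$; $\mathsf{zero}:\mathtt{Nat}$ if $\Psi\vdash_i\Gamma$; $\mathsf{succ}\,t:\mathtt{Nat}$ if $t:\mathtt{Nat}$; $\lambda x.t:S\to T$ if $\Psi;\Gamma,x:S\vdash_it:T$; $t\,s:T$ if $t:S\to T$ and $s:S$; - only at layer 1: $\mathsf{box}\,t:\square(\Delta\vdash T)$ if $\Psi\vdash_1\Gamma$ and $\Psi;\Delta\vdash_0t:T$; $\mathsf{letbox}_{T'}\,u\leftarrow s\ \mathsf{in}\ t:T'$ if $s:\square(\Delta\vdash T)$, $\Psi\vdash_0\Delta$, $\Psi\vdash_0T$, $\Psi\vdash_1T'$ and $\Psi,u:(\Delta\vdash T);\Gamma\vdash_1t:T'$; $\Lambda g.t:(g:\mathsf{Ctx})\Rightarrow T$ if $\Psi\vdash_1\Gamma$ and $\Psi,g:\mathsf{Ctx};\Gamma\vdash_1t:T$; $t\,\$\,\Delta:T[\Delta/g]$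 if $t:(g:\mathsf{Ctx})\Rightarrow T$ and $\Psi\vdash_0\Delta$; - $\cdot^m:\cdot$ if $\Psi\vdash_i\Gamma$, $\Gamma$ ends with $\cdot$ and $|\Gamma|=m$; $\cdot_g^m:\cdot$ and $\mathsf{wk}_g^m:g$ if $\Psi\vdash_i\Gamma$, $g:\mathsf{Ctx}\in\Psi$, $\Gamma$ ends with $g$ and $|\Gamma|=m$; $(\delta,t/x):(\Delta,x:T)$ if $\delta:\Delta$ and $t:T$. *Equivalence* $\Psi;\Gamma\vdash_it\approx t':T$ and $\Psi;\Gamma\vdash_i\delta\approx\delta':\Delta$: symmetry and transitivity for terms; the congruence rule of every typing rule above (with equal $T'$ for $\mathsf{letbox}$, equal $\Delta$ for $\$$, and layer-0 equivalence under $\mathsf{box}$); and, at layer 1 only and for well-typed terms, $(\lambda x.t)\,s\approx t[\mathrm{id}_\Gamma,s/x]$, $t\approx\lambda x.t\,x$ at function types, $\mathsf{letbox}_{T'}\,u\leftarrow\mathsf{box}\,s\ \mathsf{in}\ t\approx t[s/u]$, $(\Lambda g.t)\,\$\,\Delta\approx t[\Delta/g]$, and $t\approx\Lambda g.(t\,\$\,g)$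 at types $(g:\mathsf{Ctx})\Rightarrow T$. *Weak head reduction.* Weak head normal forms and neutral forms are $w ::= v\mid\mathsf{zero}\mid\mathsf{succ}\,t\mid\mathsf{box}\,t\mid\lambda x.t\mid\Lambda g.t$ and $v ::= x\mid u^\delta\mid v\,t\mid\mathsf{letbox}_{T'}\,u\leftarrow v\ \mathsf{in}\ t\mid v\,\$\,\Gamma$. One-step typed reduction $\Psi;\Gamma\vdash t\rightsquigarrow t':T$ of layer-1 terms is generated by the three $\beta$ rules and by reduction of the head in $t\,s$, $\mathsf{letbox}_{T'}\,u\leftarrow s\ \mathsf{in}\ t$ (the head being $s$) and $t\,\$\,\Delta$; $\rightsquigarrow^*$ is its reflexive transitive closure on well-typed layer-1 terms. *Convertibility checking* consists of four mutually inductive judgments, for terms ($\Leftrightarrow$), weak head normal forms ($\Leftrightarrow_{\mathsf{nf}}$), neutral forms ($\Leftrightarrow_{\mathsf{ne}}$) and local substitutions ($\Leftrightarrow$), all over $\Psi;\Gamma$ unless said otherwise: - $t\Leftrightarrow t':T$ if $t\rightsquigarrow^*w:T$, $t'\rightsquigarrow^*w':T$ and $w\Leftrightarrow_{\mathsf{nf}}w':T$;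 - $\mathsf{zero}\Leftrightarrow_{\mathsf{nf}}\mathsf{zero}:\mathtt{Nat}$ if $\Psi\vdash_1\Gamma$; $\mathsf{succ}\,t\Leftrightarrow_{\mathsf{nf}}\mathsf{succ}\,t':\mathtt{Nat}$ if $t\Leftrightarrow t':\mathtt{Nat}$; $\mathsf{box}\,t\Leftrightarrow_{\mathsf{nf}}\mathsf{box}\,t:\square(\Delta\vdash T)$ if $\Psi\vdash_1\Gamma$ and $\Psi;\Delta\vdash_0t:T$; $v\Leftrightarrow_{\mathsf{nf}}v':T$ if $v\Leftrightarrow_{\mathsf{ne}}v':T$ and $T$ is $\mathtt{Nat}$ or of the form $\square(\Delta\vdash T_0)$; $w\Leftrightarrow_{\mathsf{nf}}w':S\to T$ if $w\,x\Leftrightarrow w'\,x:T$ over $\Psi;\Gamma,x:S$; $w\Leftrightarrow_{\mathsf{nf}}w':(g:\mathsf{Ctx})\Rightarrow T$ if $w\,\$\,g\Leftrightarrow w'\,\$\,g:T$ over $\Psi,g:\mathsf{Ctx};\Gamma$; - $x\Leftrightarrow_{\mathsf{ne}}x:T$ if $\Psi\vdash_1\Gamma$ and $x:T\in\Gamma$;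 $u^\delta\Leftrightarrow_{\mathsf{ne}}u^{\delta'}:T$ if $\delta\Leftrightarrow\delta':\Delta$ and $u:(\Delta\vdash T)\in\Psi$; $v\,t\Leftrightarrow_{\mathsf{ne}}v'\,t':T$ if $v\Leftrightarrow_{\mathsf{ne}}v':S\to T$ and $t\Leftrightarrow t':S$; $\mathsf{letbox}_{T'}\,u\leftarrow v\ \mathsf{in}\ t\Leftrightarrow_{\mathsf{ne}}\mathsf{letbox}_{T'}\,u\leftarrow v'\ \mathsf{in}\ t':T'$ if $v\Leftrightarrow_{\mathsf{ne}}v':\square(\Delta\vdash T)$, $\Psi\vdash_1T'$ and $t\Leftrightarrow t':T'$ over $\Psi,u:(\Delta\vdash T);\Gamma$; $v\,\$\,\Delta\Leftrightarrow_{\mathsf{ne}}v'\,\$\,\Delta:T[\Delta/g]$ if $v\Leftrightarrow_{\mathsf{ne}}v':(g:\mathsf{Ctx})\Rightarrow T$ and $\Psi\vdash_0\Delta$; - $\delta\Leftrightarrow\delta':\Delta$ by the congruence rules of the layer-1 typing rules of local substitutions, with $t\Leftrightarrow t':T$ in the extension rule. **Theorem.** For all $\Psi$ and $\Gamma$: *(Completeness)*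 1. if $\Psi;\Gamma\vdash_1t\approx t':T$, then $\Psi;\Gamma\vdash t\Leftrightarrow t':T$; 2. if $\Psi;\Gamma\vdash_1\delta\approx\delta':\Delta$, then $\Psi;\Gamma\vdash\delta\Leftrightarrow\delta':\Delta$. *(Soundness)* 3. if $\Psi;\Gamma\vdash t\Leftrightarrow t':T$, then $\Psi;\Gamma\vdash_1t\approx t':T$; 4. if $\Psi;\Gamma\vdash w\Leftrightarrow_{\mathsf{nf}}w':T$, then $\Psi;\Gamma\vdash_1w\approx w':T$; 5. if $\Psi;\Gamma\vdash v\Leftrightarrow_{\mathsf{ne}}v':T$, then $\Psi;\Gamma\vdash_1v\approx v':T$; 6. if $\Psi;\Gamma\vdash\delta\Leftrightarrow\delta':\Delta$, then $\Psi;\Gamma\vdash_1\delta\approx\delta':\Delta$. -/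

import Mathlib

/-!
The 2-layered simply typed contextual modal type theory with context variables.

Variables are de Bruijn indices. Local variables and global variables are counted separately;
a global context is one list holding both term bindings `u : (Γ ⊢ T)` and context bindings
`g : Ctx`, its head being the most recent binding, so that `u` and `g` share one index space.
-/

namespace CtxVar

/-- The two layers: `zero` for static code, `one` for programs. -/
inductive Layer : Type
  | zero
  | one

mutual

/-- Types: `Nat`, functions, contextual types `□ (Δ ⊢ T)`, meta-functions `(g : Ctx) ⇒ T`
(the last one binds a context variable in `T`). -/
inductive Typ : Type
  | nat : Typ
  | arr : Typ → Typ → Typ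
  | box : LCtx → Typ → Typ
  | mfun : Typ → Typ

/-- Local contexts: empty, a context variable, or an extension. -/
inductive LCtx : Type
  | nil : LCtx
  | cvar : ℕ → LCtx
  | snoc : LCtx → Typ → LCtx

end

/-- The length `|Γ|`: the number of variables declared on top of the base of `Γ`. -/
def LCtx.len : LCtx → ℕ
  | .nil => 0
  | .cvar _ => 0
  | .snoc Γ _ => Γ.len + 1

/-- What `Γ` ends with: `none` for `·`, `some g` for the context variable `g`. -/
def LCtx.base : LCtx → Option ℕ
  | .nil => none
  | .cvar g => some g
  | .snoc Γ _ => Γ.base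

/-- Lookup of a local variable. Types do not depend on local variables. -/
def LCtx.get : LCtx → ℕ → Option Typ
  | .snoc _ T, 0 => some T
  | .snoc Γ _, n + 1 => Γ.get n
  | _, _ => none

/-! ### Weakenings -/

/-- Weakenings, used both as global ones and as local ones. -/
inductive Wk : Type
  | id : Wk
  | p : Wk → Wk
  | q : Wk → Wk

/-- Action of a weakening on a de Bruijn index. -/
def Wk.app : Wk → ℕ → ℕ
  | .id, n => n
  | .p γ, n => γ.app n + 1
  | .q _, 0 => 0
  | .q γ, n + 1 => γ.app n + 1

/-- The number of `p` constructors in a weakening. -/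
def Wk.numP : Wk → ℕ
  | .id => 0
  | .p γ => γ.numP + 1
  | .q γ => γ.numP

/-- The weakening `p^m(id)`. -/
def Wk.pn : ℕ → Wk
  | 0 => .id
  | m + 1 => .p (Wk.pn m)

mutual

/-- `T[γ]` for a global weakening `γ`. -/
def Typ.gwk : Typ → Wk → Typ
  | .nat, _ => .nat
  | .arr S T, γ => .arr (S.gwk γ) (T.gwk γ)
  | .box Δ T, γ => .box (Δ.gwk γ) (T.gwk γ)
  | .mfun T, γ => .mfun (T.gwk (.q γ))

/-- `Γ[γ]` for a global weakening `γ`. -/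
def LCtx.gwk : LCtx → Wk → LCtx
  | .nil, _ => .nil
  | .cvar g, γ => .cvar (γ.app g)
  | .snoc Γ T, γ => .snoc (Γ.gwk γ) (T.gwk γ)

end

/-! ### Global contexts -/

/-- Global bindings: `u : (Γ ⊢ T)` and `g : Ctx`. -/
inductive GBind : Type
  | tm : LCtx → Typ → GBind
  | ctx : GBind

def GBind.gwk : GBind → Wk → GBind
  | .tm Γ T, γ => .tm (Γ.gwk γ) (T.gwk γ)
  | .ctx, _ => .ctx

/-- Global contexts, most recent binding first. -/
abbrev GCtx : Type := List GBind

/-- Lookup in a global context; the binding found is weakened to the whole context. -/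
def GCtx.get : GCtx → ℕ → Option GBind
  | [], _ => none
  | B :: _, 0 => some (B.gwk (.p .id))
  | _ :: Ψ, k + 1 => (GCtx.get Ψ k).map fun B => B.gwk (.p .id)

mutual

/-- `⊢ Ψ` -/
inductive GWf : GCtx → Prop
  | nil : GWf []
  | ctx {Ψ : GCtx} : GWf Ψ → GWf (.ctx :: Ψ)
  | tm {Ψ : GCtx} {Γ : LCtx} {T : Typ} :
      LWf Ψ .zero Γ → TWf Ψ .zero T → GWf (.tm Γ T :: Ψ)

/-- `Ψ ⊢ᵢ Γ` -/
inductive LWf : GCtx → Layer → LCtx → Prop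
  | nil {Ψ : GCtx} {i : Layer} : GWf Ψ → LWf Ψ i .nil
  | cvar {Ψ : GCtx} {i : Layer} {g : ℕ} :
      GWf Ψ → GCtx.get Ψ g = some .ctx → LWf Ψ i (.cvar g)
  | snoc {Ψ : GCtx} {i : Layer} {Γ : LCtx} {T : Typ} :
      LWf Ψ i Γ → TWf Ψ i T → LWf Ψ i (.snoc Γ T)

/-- `Ψ ⊢ᵢ T` -/
inductive TWf : GCtx → Layer → Typ → Prop
  | nat {Ψ : GCtx} {i : Layer} : GWf Ψ → TWf Ψ i .nat
  | arr {Ψ : GCtx} {i : Layer} {S T : Typ} : TWf Ψ i S → TWf Ψ i T → TWf Ψ i (.arr S T)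
  | box {Ψ : GCtx} {Δ : LCtx} {T : Typ} :
      LWf Ψ .zero Δ → TWf Ψ .zero T → TWf Ψ .one (.box Δ T)
  | mfun {Ψ : GCtx} {T : Typ} : TWf (.ctx :: Ψ) .one T → TWf Ψ .one (.mfun T)

end

/-! ### Terms and local substitutions -/

mutual

/-- Terms. `letbox T' s t` is `letbox u ← s in t`, recording its result type `T'`;
`t` binds the global variable `u`. -/
inductive Tm : Type
  | var : ℕ → Tm
  | gvar : ℕ → LSub → Tm
  | zero : Tm
  | succ : Tm → Tm
  | box : Tm → Tm
  | letbox : Typ → Tm → Tm → Tm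
  | lam : Tm → Tm
  | app : Tm → Tm → Tm
  | mlam : Tm → Tm
  | mapp : Tm → LCtx → Tm

/-- Local substitutions: `emp none m` is `·^m`, `emp (some g) m` is `·_g^m`,
`wk g m` is `wk_g^m`, and `snoc δ t` is `δ, t/x`. -/
inductive LSub : Type
  | emp : Option ℕ → ℕ → LSub
  | wk : ℕ → ℕ → LSub
  | snoc : LSub → Tm → LSub

end

/-- `δ̂`: the number of weakenings stored at the base of `δ`. -/
def LSub.hat : LSub → ℕ
  | .emp _ m => m
  | .wk _ m => m
  | .snoc δ _ => δ.hat

/-- `δ̌`: the context variable stored at the base of `δ`, if there is one. -/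
def LSub.check : LSub → Option ℕ
  | .emp g _ => g
  | .wk g _ => some g
  | .snoc δ _ => δ.check

/-- Lookup of a local variable; the value past the end is irrelevant. -/
def LSub.get : LSub → ℕ → Tm
  | .snoc _ t, 0 => t
  | .snoc δ _, n + 1 => δ.get n
  | _, _ => .zero

mutual

/-- `t[γ]` for a global weakening `γ`. -/
def Tm.gwk : Tm → Wk → Tm
  | .var x, _ => .var x
  | .gvar u δ, γ => .gvar (γ.app u) (δ.gwk γ)
  | .zero, _ => .zero
  | .succ t, γ => .succ (t.gwk γ)
  | .box t, γ => .box (t.gwk γ)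
  | .letbox T s t, γ => .letbox (T.gwk γ) (s.gwk γ) (t.gwk (.q γ))
  | .lam t, γ => .lam (t.gwk γ)
  | .app t s, γ => .app (t.gwk γ) (s.gwk γ)
  | .mlam t, γ => .mlam (t.gwk (.q γ))
  | .mapp t Γ, γ => .mapp (t.gwk γ) (Γ.gwk γ)

/-- `δ[γ]` for a global weakening `γ`. -/
def LSub.gwk : LSub → Wk → LSub
  | .emp g m, γ => .emp (g.map γ.app) m
  | .wk g m, γ => .wk (γ.app g) m
  | .snoc δ t, γ => .snoc (δ.gwk γ) (t.gwk γ)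

end

mutual

/-- `t[id; τ]` for a local weakening `τ`. -/
def Tm.lwk : Tm → Wk → Tm
  | .var x, τ => .var (τ.app x)
  | .gvar u δ, τ => .gvar u (δ.lwk τ)
  | .zero, _ => .zero
  | .succ t, τ => .succ (t.lwk τ)
  | .box t, _ => .box t
  | .letbox T s t, τ => .letbox T (s.lwk τ) (t.lwk τ)
  | .lam t, τ => .lam (t.lwk (.q τ))
  | .app t s, τ => .app (t.lwk τ) (s.lwk τ)
  | .mlam t, τ => .mlam (t.lwk τ)
  | .mapp t Γ, τ => .mapp (t.lwk τ) Γ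

/-- `δ[id; τ]` for a local weakening `τ`. -/
def LSub.lwk : LSub → Wk → LSub
  | .emp g m, τ => .emp g (m + τ.numP)
  | .wk g m, τ => .wk g (m + τ.numP)
  | .snoc δ t, τ => .snoc (δ.lwk τ) (t.lwk τ)

end

/-- `q(δ) = δ[id; p(id)], x/x` -/
def LSub.q (δ : LSub) : LSub := .snoc (δ.lwk (.p .id)) (.var 0)

mutual

/-- `t[δ]` for a local substitution `δ`. -/
def Tm.lsub : Tm → LSub → Tm
  | .var x, δ => δ.get x
  | .gvar u δ', δ => .gvar u (δ'.comp δ)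
  | .zero, _ => .zero
  | .succ t, δ => .succ (t.lsub δ)
  | .box t, _ => .box t
  | .letbox T s t, δ => .letbox T (s.lsub δ) (t.lsub (δ.gwk (.p .id)))
  | .lam t, δ => .lam (t.lsub δ.q)
  | .app t s, δ => .app (t.lsub δ) (s.lsub δ)
  | .mlam t, δ => .mlam (t.lsub (δ.gwk (.p .id)))
  | .mapp t Γ, δ => .mapp (t.lsub δ) Γ

/-- Composition `δ' ∘ δ` of local substitutions. -/
def LSub.comp : LSub → LSub → LSub
  | .emp none _, δ => .emp δ.check δ.hat
  | .emp (some g) _, δ => .emp (some g) δ.hat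
  | .wk g _, δ => .wk g δ.hat
  | .snoc δ' t, δ => .snoc (δ'.comp δ) (t.lsub δ)

end

/-- The local weakening substitution `wk^m_Γ`. -/
def LCtx.wkSub : LCtx → ℕ → LSub
  | .nil, m => .emp none m
  | .cvar g, m => .wk g m
  | .snoc Γ _, m => .snoc (Γ.wkSub (m + 1)) (.var m)

/-- The local identity substitution `id_Γ = wk^0_Γ`. -/
def LCtx.idSub (Γ : LCtx) : LSub := Γ.wkSub 0

/-! ### Global substitutions -/

/-- Entries of a global substitution: a term `t/u`, a local context `Γ/g`, or the renaming of
a global variable to the global variable `k`. An entry `var k` stands for `u_k^id / u`, if the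
variable replaced is a term variable, and for `g_k / g`, if it is a context variable. -/
inductive GEnt : Type
  | var : ℕ → GEnt
  | tm : Tm → GEnt
  | ctx : LCtx → GEnt

def GEnt.gwk : GEnt → Wk → GEnt
  | .var k, γ => .var (γ.app k)
  | .tm t, γ => .tm (t.gwk γ)
  | .ctx Γ, γ => .ctx (Γ.gwk γ)

/-- Global substitutions, as functions from the indices of global variables to entries. -/
abbrev GSub : Type := ℕ → GEnt

/-- The identity `id_Ψ`. -/
def GSub.id : GSub := fun k => .var k

/-- `σ, e`, where `e` replaces the most recent variable. -/
def GSub.snoc (σ : GSub) (e : GEnt) : GSub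
  | 0 => e
  | k + 1 => σ k

/-- `q(σ)`, that is `σ[p(id)], u^id/u` or `σ[p(id)], g/g`. -/
def GSub.q (σ : GSub) : GSub := GSub.snoc (fun k => (σ k).gwk (.p .id)) (.var 0)

/-- Lookup of a context variable; the value at a term entry is irrelevant. -/
def GSub.ctxAt (σ : GSub) (g : ℕ) : LCtx :=
  match σ g with
  | .var k => .cvar k
  | .ctx Γ => Γ
  | .tm _ => .nil

/-- `σ(u)[δ]`, where `u_k^id[δ] = u_k^δ`; the value at a context entry is irrelevant. -/
def GSub.tmAt (σ : GSub) (u : ℕ) (δ : LSub) : Tm :=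
  match σ u with
  | .var k => .gvar k δ
  | .tm t => t.lsub δ
  | .ctx _ => .zero

mutual

/-- `T[σ]` for a global substitution `σ`. -/
def Typ.gsub : Typ → GSub → Typ
  | .nat, _ => .nat
  | .arr S T, σ => .arr (S.gsub σ) (T.gsub σ)
  | .box Δ T, σ => .box (Δ.gsub σ) (T.gsub σ)
  | .mfun T, σ => .mfun (T.gsub σ.q)

/-- `Γ[σ]` for a global substitution `σ`. -/
def LCtx.gsub : LCtx → GSub → LCtx
  | .nil, _ => .nil
  | .cvar g, σ => σ.ctxAt g
  | .snoc Γ T, σ => .snoc (Γ.gsub σ) (T.gsub σ)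

end

mutual

/-- `t[σ]` for a global substitution `σ`. -/
def Tm.gsub : Tm → GSub → Tm
  | .var x, _ => .var x
  | .gvar u δ, σ => σ.tmAt u (δ.gsub σ)
  | .zero, _ => .zero
  | .succ t, σ => .succ (t.gsub σ)
  | .box t, σ => .box (t.gsub σ)
  | .letbox T s t, σ => .letbox (T.gsub σ) (s.gsub σ) (t.gsub σ.q)
  | .lam t, σ => .lam (t.gsub σ)
  | .app t s, σ => .app (t.gsub σ) (s.gsub σ)
  | .mlam t, σ => .mlam (t.gsub σ.q)
  | .mapp t Γ, σ => .mapp (t.gsub σ) (Γ.gsub σ)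

/-- `δ[σ]` for a global substitution `σ`. -/
def LSub.gsub : LSub → GSub → LSub
  | .emp none m, _ => .emp none m
  | .emp (some g) m, σ => .emp (σ.ctxAt g).base ((σ.ctxAt g).len + m)
  | .wk g m, σ => (σ.ctxAt g).idSub.lwk (Wk.pn m)
  | .snoc δ t, σ => .snoc (δ.gsub σ) (t.gsub σ)

end

/-- `T[id_Ψ, Δ/g]` -/
def Typ.inst (T : Typ) (Δ : LCtx) : Typ := T.gsub (GSub.id.snoc (.ctx Δ))

/-- `t[id_Ψ, Δ/g]` -/
def Tm.instCtx (t : Tm) (Δ : LCtx) : Tm := t.gsub (GSub.id.snoc (.ctx Δ))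

/-- `t[id_Ψ, s/u]` -/
def Tm.instTm (t s : Tm) : Tm := t.gsub (GSub.id.snoc (.tm s))

/-- `t[id_Γ, s/x]` -/
def Tm.instVar (t : Tm) (Γ : LCtx) (s : Tm) : Tm := t.lsub (.snoc Γ.idSub s)

/-! ### Typing -/

mutual

/-- `Ψ; Γ ⊢ᵢ t : T` -/
inductive HasTy : GCtx → LCtx → Layer → Tm → Typ → Prop
  | var {Ψ : GCtx} {Γ : LCtx} {i : Layer} {x : ℕ} {T : Typ} :
      LWf Ψ i Γ → Γ.get x = some T → HasTy Ψ Γ i (.var x) T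
  | gvar {Ψ : GCtx} {Γ Δ : LCtx} {i : Layer} {u : ℕ} {δ : LSub} {T : Typ} :
      SubTy Ψ Γ i δ Δ → GCtx.get Ψ u = some (.tm Δ T) → HasTy Ψ Γ i (.gvar u δ) T
  | zero {Ψ : GCtx} {Γ : LCtx} {i : Layer} : LWf Ψ i Γ → HasTy Ψ Γ i .zero .nat
  | succ {Ψ : GCtx} {Γ : LCtx} {i : Layer} {t : Tm} :
      HasTy Ψ Γ i t .nat → HasTy Ψ Γ i (.succ t) .nat
  | lam {Ψ : GCtx} {Γ : LCtx} {i : Layer} {t : Tm} {S T : Typ} :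
      HasTy Ψ (.snoc Γ S) i t T → HasTy Ψ Γ i (.lam t) (.arr S T)
  | app {Ψ : GCtx} {Γ : LCtx} {i : Layer} {t s : Tm} {S T : Typ} :
      HasTy Ψ Γ i t (.arr S T) → HasTy Ψ Γ i s S → HasTy Ψ Γ i (.app t s) T
  | box {Ψ : GCtx} {Γ Δ : LCtx} {t : Tm} {T : Typ} :
      LWf Ψ .one Γ → HasTy Ψ Δ .zero t T → HasTy Ψ Γ .one (.box t) (.box Δ T)
  | letbox {Ψ : GCtx} {Γ Δ : LCtx} {s t : Tm} {T T' : Typ} :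
      HasTy Ψ Γ .one s (.box Δ T) → LWf Ψ .zero Δ → TWf Ψ .zero T → TWf Ψ .one T' →
      HasTy (.tm Δ T :: Ψ) (Γ.gwk (.p .id)) .one t (T'.gwk (.p .id)) →
      HasTy Ψ Γ .one (.letbox T' s t) T'
  | mlam {Ψ : GCtx} {Γ : LCtx} {t : Tm} {T : Typ} :
      LWf Ψ .one Γ → HasTy (.ctx :: Ψ) (Γ.gwk (.p .id)) .one t T →
      HasTy Ψ Γ .one (.mlam t) (.mfun T)
  | mapp {Ψ : GCtx} {Γ Δ : LCtx} {t : Tm} {T : Typ} :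
      HasTy Ψ Γ .one t (.mfun T) → LWf Ψ .zero Δ → HasTy Ψ Γ .one (.mapp t Δ) (T.inst Δ)

/-- `Ψ; Γ ⊢ᵢ δ : Δ` -/
inductive SubTy : GCtx → LCtx → Layer → LSub → LCtx → Prop
  | emp {Ψ : GCtx} {Γ : LCtx} {i : Layer} {m : ℕ} :
      LWf Ψ i Γ → Γ.base = none → Γ.len = m → SubTy Ψ Γ i (.emp none m) .nil
  | empCtx {Ψ : GCtx} {Γ : LCtx} {i : Layer} {g m : ℕ} :
      LWf Ψ i Γ → GCtx.get Ψ g = some .ctx → Γ.base = some g → Γ.len = m →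
      SubTy Ψ Γ i (.emp (some g) m) .nil
  | wk {Ψ : GCtx} {Γ : LCtx} {i : Layer} {g m : ℕ} :
      LWf Ψ i Γ → GCtx.get Ψ g = some .ctx → Γ.base = some g → Γ.len = m →
      SubTy Ψ Γ i (.wk g m) (.cvar g)
  | snoc {Ψ : GCtx} {Γ Δ : LCtx} {i : Layer} {δ : LSub} {t : Tm} {T : Typ} :
      SubTy Ψ Γ i δ Δ → HasTy Ψ Γ i t T → SubTy Ψ Γ i (.snoc δ t) (.snoc Δ T)

end

/-! ### Syntactic equivalence -/

mutual

/-- `Ψ; Γ ⊢ᵢ t ≈ t' : T`. The `β` and `η` rules are available at layer `1` only. -/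
inductive TmEq : GCtx → LCtx → Layer → Tm → Tm → Typ → Prop
  | symm {Ψ : GCtx} {Γ : LCtx} {i : Layer} {t t' : Tm} {T : Typ} :
      TmEq Ψ Γ i t t' T → TmEq Ψ Γ i t' t T
  | trans {Ψ : GCtx} {Γ : LCtx} {i : Layer} {t t' t'' : Tm} {T : Typ} :
      TmEq Ψ Γ i t t' T → TmEq Ψ Γ i t' t'' T → TmEq Ψ Γ i t t'' T
  | var {Ψ : GCtx} {Γ : LCtx} {i : Layer} {x : ℕ} {T : Typ} :
      LWf Ψ i Γ → Γ.get x = some T → TmEq Ψ Γ i (.var x) (.var x) T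
  | gvar {Ψ : GCtx} {Γ Δ : LCtx} {i : Layer} {u : ℕ} {δ δ' : LSub} {T : Typ} :
      SubEq Ψ Γ i δ δ' Δ → GCtx.get Ψ u = some (.tm Δ T) →
      TmEq Ψ Γ i (.gvar u δ) (.gvar u δ') T
  | zero {Ψ : GCtx} {Γ : LCtx} {i : Layer} : LWf Ψ i Γ → TmEq Ψ Γ i .zero .zero .nat
  | succ {Ψ : GCtx} {Γ : LCtx} {i : Layer} {t t' : Tm} :
      TmEq Ψ Γ i t t' .nat → TmEq Ψ Γ i (.succ t) (.succ t') .nat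
  | lam {Ψ : GCtx} {Γ : LCtx} {i : Layer} {t t' : Tm} {S T : Typ} :
      TmEq Ψ (.snoc Γ S) i t t' T → TmEq Ψ Γ i (.lam t) (.lam t') (.arr S T)
  | app {Ψ : GCtx} {Γ : LCtx} {i : Layer} {t t' s s' : Tm} {S T : Typ} :
      TmEq Ψ Γ i t t' (.arr S T) → TmEq Ψ Γ i s s' S → TmEq Ψ Γ i (.app t s) (.app t' s') T
  | box {Ψ : GCtx} {Γ Δ : LCtx} {t t' : Tm} {T : Typ} :
      LWf Ψ .one Γ → TmEq Ψ Δ .zero t t' T → TmEq Ψ Γ .one (.box t) (.box t') (.box Δ T)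
  | letbox {Ψ : GCtx} {Γ Δ : LCtx} {s s' t t' : Tm} {T T' : Typ} :
      TmEq Ψ Γ .one s s' (.box Δ T) → LWf Ψ .zero Δ → TWf Ψ .zero T → TWf Ψ .one T' →
      TmEq (.tm Δ T :: Ψ) (Γ.gwk (.p .id)) .one t t' (T'.gwk (.p .id)) →
      TmEq Ψ Γ .one (.letbox T' s t) (.letbox T' s' t') T'
  | mlam {Ψ : GCtx} {Γ : LCtx} {t t' : Tm} {T : Typ} :
      LWf Ψ .one Γ → TmEq (.ctx :: Ψ) (Γ.gwk (.p .id)) .one t t' T →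
      TmEq Ψ Γ .one (.mlam t) (.mlam t') (.mfun T)
  | mapp {Ψ : GCtx} {Γ Δ : LCtx} {t t' : Tm} {T : Typ} :
      TmEq Ψ Γ .one t t' (.mfun T) → LWf Ψ .zero Δ →
      TmEq Ψ Γ .one (.mapp t Δ) (.mapp t' Δ) (T.inst Δ)
  | lamBeta {Ψ : GCtx} {Γ : LCtx} {t s : Tm} {S T : Typ} :
      HasTy Ψ (.snoc Γ S) .one t T → HasTy Ψ Γ .one s S →
      TmEq Ψ Γ .one (.app (.lam t) s) (t.instVar Γ s) T
  | lamEta {Ψ : GCtx} {Γ : LCtx} {t : Tm} {S T : Typ} :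
      HasTy Ψ Γ .one t (.arr S T) →
      TmEq Ψ Γ .one t (.lam (.app (t.lwk (.p .id)) (.var 0))) (.arr S T)
  | letboxBeta {Ψ : GCtx} {Γ Δ : LCtx} {s t : Tm} {T T' : Typ} :
      HasTy Ψ Δ .zero s T → LWf Ψ .one Γ → TWf Ψ .one T' →
      HasTy (.tm Δ T :: Ψ) (Γ.gwk (.p .id)) .one t (T'.gwk (.p .id)) →
      TmEq Ψ Γ .one (.letbox T' (.box s) t) (t.instTm s) T'
  | mlamBeta {Ψ : GCtx} {Γ Δ : LCtx} {t : Tm} {T : Typ} :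
      LWf Ψ .one Γ → HasTy (.ctx :: Ψ) (Γ.gwk (.p .id)) .one t T → LWf Ψ .zero Δ →
      TmEq Ψ Γ .one (.mapp (.mlam t) Δ) (t.instCtx Δ) (T.inst Δ)
  | mlamEta {Ψ : GCtx} {Γ : LCtx} {t : Tm} {T : Typ} :
      HasTy Ψ Γ .one t (.mfun T) →
      TmEq Ψ Γ .one t (.mlam (.mapp (t.gwk (.p .id)) (.cvar 0))) (.mfun T)

/-- `Ψ; Γ ⊢ᵢ δ ≈ δ' : Δ` -/
inductive SubEq : GCtx → LCtx → Layer → LSub → LSub → LCtx → Prop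
  | emp {Ψ : GCtx} {Γ : LCtx} {i : Layer} {m : ℕ} :
      LWf Ψ i Γ → Γ.base = none → Γ.len = m → SubEq Ψ Γ i (.emp none m) (.emp none m) .nil
  | empCtx {Ψ : GCtx} {Γ : LCtx} {i : Layer} {g m : ℕ} :
      LWf Ψ i Γ → GCtx.get Ψ g = some .ctx → Γ.base = some g → Γ.len = m →
      SubEq Ψ Γ i (.emp (some g) m) (.emp (some g) m) .nil
  | wk {Ψ : GCtx} {Γ : LCtx} {i : Layer} {g m : ℕ} :
      LWf Ψ i Γ → GCtx.get Ψ g = some .ctx → Γ.base = some g → Γ.len = m →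
      SubEq Ψ Γ i (.wk g m) (.wk g m) (.cvar g)
  | snoc {Ψ : GCtx} {Γ Δ : LCtx} {i : Layer} {δ δ' : LSub} {t t' : Tm} {T : Typ} :
      SubEq Ψ Γ i δ δ' Δ → TmEq Ψ Γ i t t' T →
      SubEq Ψ Γ i (.snoc δ t) (.snoc δ' t') (.snoc Δ T)

end

/-! ### Weak head reduction -/

/-- Neutral forms. -/
inductive IsNe : Tm → Prop
  | var {x : ℕ} : IsNe (.var x)
  | gvar {u : ℕ} {δ : LSub} : IsNe (.gvar u δ)
  | app {v t : Tm} : IsNe v → IsNe (.app v t)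
  | letbox {T : Typ} {v t : Tm} : IsNe v → IsNe (.letbox T v t)
  | mapp {v : Tm} {Γ : LCtx} : IsNe v → IsNe (.mapp v Γ)

/-- Weak head normal forms. -/
inductive IsNf : Tm → Prop
  | ne {v : Tm} : IsNe v → IsNf v
  | zero : IsNf .zero
  | succ {t : Tm} : IsNf (.succ t)
  | box {t : Tm} : IsNf (.box t)
  | lam {t : Tm} : IsNf (.lam t)
  | mlam {t : Tm} : IsNf (.mlam t)

/-- One-step weak head reduction `Ψ; Γ ⊢ t ⇝ t' : T` (at layer `1`). -/
inductive Red : GCtx → LCtx → Tm → Tm → Typ → Prop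
  | app {Ψ : GCtx} {Γ : LCtx} {t t' s : Tm} {S T : Typ} :
      Red Ψ Γ t t' (.arr S T) → HasTy Ψ Γ .one s S → Red Ψ Γ (.app t s) (.app t' s) T
  | letbox {Ψ : GCtx} {Γ Δ : LCtx} {s s' t : Tm} {T T' : Typ} :
      Red Ψ Γ s s' (.box Δ T) → TWf Ψ .one T' →
      HasTy (.tm Δ T :: Ψ) (Γ.gwk (.p .id)) .one t (T'.gwk (.p .id)) →
      Red Ψ Γ (.letbox T' s t) (.letbox T' s' t) T'
  | mapp {Ψ : GCtx} {Γ Δ : LCtx} {t t' : Tm} {T : Typ} :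
      Red Ψ Γ t t' (.mfun T) → LWf Ψ .zero Δ → Red Ψ Γ (.mapp t Δ) (.mapp t' Δ) (T.inst Δ)
  | lamBeta {Ψ : GCtx} {Γ : LCtx} {t s : Tm} {S T : Typ} :
      HasTy Ψ (.snoc Γ S) .one t T → HasTy Ψ Γ .one s S →
      Red Ψ Γ (.app (.lam t) s) (t.instVar Γ s) T
  | mlamBeta {Ψ : GCtx} {Γ Δ : LCtx} {t : Tm} {T : Typ} :
      LWf Ψ .one Γ → HasTy (.ctx :: Ψ) (Γ.gwk (.p .id)) .one t T → LWf Ψ .zero Δ →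
      Red Ψ Γ (.mapp (.mlam t) Δ) (t.instCtx Δ) (T.inst Δ)
  | letboxBeta {Ψ : GCtx} {Γ Δ : LCtx} {s t : Tm} {T T' : Typ} :
      HasTy Ψ Δ .zero s T → LWf Ψ .one Γ → TWf Ψ .one T' →
      HasTy (.tm Δ T :: Ψ) (Γ.gwk (.p .id)) .one t (T'.gwk (.p .id)) →
      Red Ψ Γ (.letbox T' (.box s) t) (t.instTm s) T'

/-- Reflexive transitive closure `Ψ; Γ ⊢ t ⇝* t' : T` on well-typed terms. -/
inductive Reds : GCtx → LCtx → Tm → Tm → Typ → Prop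
  | refl {Ψ : GCtx} {Γ : LCtx} {t : Tm} {T : Typ} : HasTy Ψ Γ .one t T → Reds Ψ Γ t t T
  | step {Ψ : GCtx} {Γ : LCtx} {t t' t'' : Tm} {T : Typ} :
      Red Ψ Γ t t' T → Reds Ψ Γ t' t'' T → Reds Ψ Γ t t'' T

/-! ### Convertibility checking -/

mutual

/-- Algorithmic convertibility of terms. -/
inductive Conv : GCtx → LCtx → Tm → Tm → Typ → Prop
  | red {Ψ : GCtx} {Γ : LCtx} {t t' w w' : Tm} {T : Typ} :
      Reds Ψ Γ t w T → Reds Ψ Γ t' w' T → ConvNf Ψ Γ w w' T → Conv Ψ Γ t t' T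

/-- Algorithmic convertibility of weak head normal forms, directed by the type. -/
inductive ConvNf : GCtx → LCtx → Tm → Tm → Typ → Prop
  | zero {Ψ : GCtx} {Γ : LCtx} : LWf Ψ .one Γ → ConvNf Ψ Γ .zero .zero .nat
  | succ {Ψ : GCtx} {Γ : LCtx} {t t' : Tm} :
      Conv Ψ Γ t t' .nat → ConvNf Ψ Γ (.succ t) (.succ t') .nat
  | natNe {Ψ : GCtx} {Γ : LCtx} {v v' : Tm} : ConvNe Ψ Γ v v' .nat → ConvNf Ψ Γ v v' .nat
  | arr {Ψ : GCtx} {Γ : LCtx} {w w' : Tm} {S T : Typ} :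
      IsNf w → IsNf w' →
      Conv Ψ (.snoc Γ S) (.app (w.lwk (.p .id)) (.var 0)) (.app (w'.lwk (.p .id)) (.var 0)) T →
      ConvNf Ψ Γ w w' (.arr S T)
  | box {Ψ : GCtx} {Γ Δ : LCtx} {t : Tm} {T : Typ} :
      LWf Ψ .one Γ → HasTy Ψ Δ .zero t T → ConvNf Ψ Γ (.box t) (.box t) (.box Δ T)
  | boxNe {Ψ : GCtx} {Γ Δ : LCtx} {v v' : Tm} {T : Typ} :
      ConvNe Ψ Γ v v' (.box Δ T) → ConvNf Ψ Γ v v' (.box Δ T)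
  | mfun {Ψ : GCtx} {Γ : LCtx} {w w' : Tm} {T : Typ} :
      IsNf w → IsNf w' →
      Conv (.ctx :: Ψ) (Γ.gwk (.p .id)) (.mapp (w.gwk (.p .id)) (.cvar 0))
        (.mapp (w'.gwk (.p .id)) (.cvar 0)) T →
      ConvNf Ψ Γ w w' (.mfun T)

/-- Algorithmic convertibility of neutral forms, structural. -/
inductive ConvNe : GCtx → LCtx → Tm → Tm → Typ → Prop
  | var {Ψ : GCtx} {Γ : LCtx} {x : ℕ} {T : Typ} :
      LWf Ψ .one Γ → Γ.get x = some T → ConvNe Ψ Γ (.var x) (.var x) T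
  | gvar {Ψ : GCtx} {Γ Δ : LCtx} {u : ℕ} {δ δ' : LSub} {T : Typ} :
      ConvSub Ψ Γ δ δ' Δ → GCtx.get Ψ u = some (.tm Δ T) →
      ConvNe Ψ Γ (.gvar u δ) (.gvar u δ') T
  | app {Ψ : GCtx} {Γ : LCtx} {v v' t t' : Tm} {S T : Typ} :
      ConvNe Ψ Γ v v' (.arr S T) → Conv Ψ Γ t t' S → ConvNe Ψ Γ (.app v t) (.app v' t') T
  | letbox {Ψ : GCtx} {Γ Δ : LCtx} {v v' t t' : Tm} {T T' : Typ} :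
      ConvNe Ψ Γ v v' (.box Δ T) → TWf Ψ .one T' →
      Conv (.tm Δ T :: Ψ) (Γ.gwk (.p .id)) t t' (T'.gwk (.p .id)) →
      ConvNe Ψ Γ (.letbox T' v t) (.letbox T' v' t') T'
  | mapp {Ψ : GCtx} {Γ Δ : LCtx} {v v' : Tm} {T : Typ} :
      ConvNe Ψ Γ v v' (.mfun T) → LWf Ψ .zero Δ →
      ConvNe Ψ Γ (.mapp v Δ) (.mapp v' Δ) (T.inst Δ)

/-- Algorithmic convertibility of local substitutions, componentwise. -/
inductive ConvSub : GCtx → LCtx → LSub → LSub → LCtx → Prop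
  | emp {Ψ : GCtx} {Γ : LCtx} {m : ℕ} :
      LWf Ψ .one Γ → Γ.base = none → Γ.len = m → ConvSub Ψ Γ (.emp none m) (.emp none m) .nil
  | empCtx {Ψ : GCtx} {Γ : LCtx} {g m : ℕ} :
      LWf Ψ .one Γ → GCtx.get Ψ g = some .ctx → Γ.base = some g → Γ.len = m →
      ConvSub Ψ Γ (.emp (some g) m) (.emp (some g) m) .nil
  | wk {Ψ : GCtx} {Γ : LCtx} {g m : ℕ} :
      LWf Ψ .one Γ → GCtx.get Ψ g = some .ctx → Γ.base = some g → Γ.len = m →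
      ConvSub Ψ Γ (.wk g m) (.wk g m) (.cvar g)
  | snoc {Ψ : GCtx} {Γ Δ : LCtx} {δ δ' : LSub} {t t' : Tm} {T : Typ} :
      ConvSub Ψ Γ δ δ' Δ → Conv Ψ Γ t t' T → ConvSub Ψ Γ (.snoc δ t) (.snoc δ' t') (.snoc Δ T)

end

end CtxVar

namespace CtxVar

set_option linter.unusedVariables false

attribute [simp] Wk.app Wk.numP Wk.pn Typ.gwk LCtx.gwk Tm.gwk LSub.gwk Tm.lwk LSub.lwk
  Tm.lsub LSub.comp LSub.hat LSub.check LSub.get LCtx.wkSub Typ.gsub LCtx.gsub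
  Tm.gsub LCtx.len LCtx.base LCtx.get

@[simp] theorem GBind.gwk_tm (Γ : LCtx) (T : Typ) (γ : Wk) :
    (GBind.tm Γ T).gwk γ = .tm (Γ.gwk γ) (T.gwk γ) := rfl
@[simp] theorem GBind.gwk_ctx (γ : Wk) : GBind.ctx.gwk γ = .ctx := rfl

@[simp] theorem GEnt.gwk_var (k : ℕ) (γ : Wk) : (GEnt.var k).gwk γ = .var (γ.app k) := rfl
@[simp] theorem GEnt.gwk_tm (t : Tm) (γ : Wk) : (GEnt.tm t).gwk γ = .tm (t.gwk γ) := rfl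
@[simp] theorem GEnt.gwk_ctx (Γ : LCtx) (γ : Wk) : (GEnt.ctx Γ).gwk γ = .ctx (Γ.gwk γ) := rfl

/-! ### Weakenings -/

/-- Composition of weakenings: first `γ`, then `γ'`. -/
def Wk.comp : Wk → Wk → Wk
  | γ, .id => γ
  | γ, .p γ' => .p (Wk.comp γ γ')
  | .id, .q γ' => .q γ'
  | .p γ, .q γ' => .p (Wk.comp γ γ')
  | .q γ, .q γ' => .q (Wk.comp γ γ')

attribute [simp] Wk.comp

theorem Wk.id_comp (γ : Wk) : Wk.id.comp γ = γ := by
  induction γ <;> simp [*]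

attribute [simp] Wk.id_comp

theorem Wk.app_comp (γ γ' : Wk) (n : ℕ) : (γ.comp γ').app n = γ'.app (γ.app n) := by
  induction γ' generalizing γ n with
  | id => simp
  | p γ' ih => simp [ih]
  | q γ' ih =>
    cases γ with
    | id => simp
    | p γ => simp [ih]
    | q γ => cases n <;> simp [ih]

theorem Wk.numP_comp (γ γ' : Wk) : (γ.comp γ').numP = γ.numP + γ'.numP := by
  induction γ' generalizing γ with
  | id => simp
  | p γ' ih => simp [ih, Nat.add_assoc]
  | q γ' ih =>
    cases γ with
    | id => simp
    | p γ => simp [ih]; omega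
    | q γ => simp [ih]

theorem Wk.app_pn (m n : ℕ) : (Wk.pn m).app n = n + m := by
  induction m <;> simp [*]; omega

theorem Wk.numP_pn (m : ℕ) : (Wk.pn m).numP = m := by
  induction m <;> simp [*]

attribute [simp] Wk.app_comp Wk.numP_comp Wk.app_pn Wk.numP_pn

theorem Wk.q_app_eq_self {γ : Wk} (h : ∀ k, γ.app k = k) : ∀ k, (Wk.q γ).app k = k
  | 0 => rfl
  | k + 1 => by simp [h]

mutual

theorem Typ.gwk_of_app_eq : ∀ (T : Typ) {γ : Wk}, (∀ k, γ.app k = k) → T.gwk γ = T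
  | .nat, _, _ => rfl
  | .arr S T, _, h => by simp [S.gwk_of_app_eq h, T.gwk_of_app_eq h]
  | .box Δ T, _, h => by simp [Δ.gwk_of_app_eq h, T.gwk_of_app_eq h]
  | .mfun T, _, h => by simp [T.gwk_of_app_eq (Wk.q_app_eq_self h)]

theorem LCtx.gwk_of_app_eq : ∀ (Γ : LCtx) {γ : Wk}, (∀ k, γ.app k = k) → Γ.gwk γ = Γ
  | .nil, _, _ => rfl
  | .cvar g, _, h => by simp [h]
  | .snoc Γ T, _, h => by simp [Γ.gwk_of_app_eq h, T.gwk_of_app_eq h]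

end

mutual

theorem Tm.gwk_of_app_eq : ∀ (t : Tm) {γ : Wk}, (∀ k, γ.app k = k) → t.gwk γ = t
  | .var x, _, _ => rfl
  | .gvar u δ, _, h => by simp [h, δ.gwk_of_app_eq h]
  | .zero, _, _ => rfl
  | .succ t, _, h => by simp [t.gwk_of_app_eq h]
  | .box t, _, h => by simp [t.gwk_of_app_eq h]
  | .letbox T s t, _, h => by
    simp [T.gwk_of_app_eq h, s.gwk_of_app_eq h, t.gwk_of_app_eq (Wk.q_app_eq_self h)]
  | .lam t, _, h => by simp [t.gwk_of_app_eq h]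
  | .app t s, _, h => by simp [t.gwk_of_app_eq h, s.gwk_of_app_eq h]
  | .mlam t, _, h => by simp [t.gwk_of_app_eq (Wk.q_app_eq_self h)]
  | .mapp t Γ, _, h => by simp [t.gwk_of_app_eq h, Γ.gwk_of_app_eq h]

theorem LSub.gwk_of_app_eq : ∀ (δ : LSub) {γ : Wk}, (∀ k, γ.app k = k) → δ.gwk γ = δ
  | .emp g m, _, h => by cases g <;> simp [h]
  | .wk g m, _, h => by simp [h]
  | .snoc δ t, _, h => by simp [δ.gwk_of_app_eq h, t.gwk_of_app_eq h]

end

mutual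

theorem Tm.lwk_of_app_eq :
    ∀ (t : Tm) {τ : Wk}, (∀ k, τ.app k = k) → τ.numP = 0 → t.lwk τ = t
  | .var x, _, h, _ => by simp [h]
  | .gvar u δ, _, h, h' => by simp [δ.lwk_of_app_eq h h']
  | .zero, _, _, _ => rfl
  | .succ t, _, h, h' => by simp [t.lwk_of_app_eq h h']
  | .box t, _, h, h' => rfl
  | .letbox T s t, _, h, h' => by simp [s.lwk_of_app_eq h h', t.lwk_of_app_eq h h']
  | .lam t, _, h, h' => by simp [t.lwk_of_app_eq (Wk.q_app_eq_self h) h']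
  | .app t s, _, h, h' => by simp [t.lwk_of_app_eq h h', s.lwk_of_app_eq h h']
  | .mlam t, _, h, h' => by simp [t.lwk_of_app_eq h h']
  | .mapp t Γ, _, h, h' => by simp [t.lwk_of_app_eq h h']

theorem LSub.lwk_of_app_eq :
    ∀ (δ : LSub) {τ : Wk}, (∀ k, τ.app k = k) → τ.numP = 0 → δ.lwk τ = δ
  | .emp g m, _, _, h' => by simp [h']
  | .wk g m, _, _, h' => by simp [h']
  | .snoc δ t, _, h, h' => by simp [δ.lwk_of_app_eq h h', t.lwk_of_app_eq h h']

end

@[simp] theorem Typ.gwk_id (T : Typ) : T.gwk .id = T := T.gwk_of_app_eq fun _ => rfl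
@[simp] theorem LCtx.gwk_id (Γ : LCtx) : Γ.gwk .id = Γ := Γ.gwk_of_app_eq fun _ => rfl
@[simp] theorem Tm.gwk_id (t : Tm) : t.gwk .id = t := t.gwk_of_app_eq fun _ => rfl
@[simp] theorem LSub.gwk_id (δ : LSub) : δ.gwk .id = δ := δ.gwk_of_app_eq fun _ => rfl
@[simp] theorem Tm.lwk_id (t : Tm) : t.lwk .id = t := t.lwk_of_app_eq (fun _ => rfl) rfl
@[simp] theorem LSub.lwk_id (δ : LSub) : δ.lwk .id = δ := δ.lwk_of_app_eq (fun _ => rfl) rfl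

mutual

theorem Typ.gwk_gwk : ∀ (T : Typ) (γ γ' : Wk), (T.gwk γ).gwk γ' = T.gwk (γ.comp γ')
  | .nat, _, _ => rfl
  | .arr S T, _, _ => by simp [S.gwk_gwk, T.gwk_gwk]
  | .box Δ T, _, _ => by simp [Δ.gwk_gwk, T.gwk_gwk]
  | .mfun T, _, _ => by simp [T.gwk_gwk]

theorem LCtx.gwk_gwk : ∀ (Γ : LCtx) (γ γ' : Wk), (Γ.gwk γ).gwk γ' = Γ.gwk (γ.comp γ')
  | .nil, _, _ => rfl
  | .cvar g, _, _ => by simp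
  | .snoc Γ T, _, _ => by simp [Γ.gwk_gwk, T.gwk_gwk]

end

mutual

theorem Tm.gwk_gwk : ∀ (t : Tm) (γ γ' : Wk), (t.gwk γ).gwk γ' = t.gwk (γ.comp γ')
  | .var x, _, _ => rfl
  | .gvar u δ, _, _ => by simp [δ.gwk_gwk]
  | .zero, _, _ => rfl
  | .succ t, _, _ => by simp [t.gwk_gwk]
  | .box t, _, _ => by simp [t.gwk_gwk]
  | .letbox T s t, _, _ => by simp [T.gwk_gwk, s.gwk_gwk, t.gwk_gwk]
  | .lam t, _, _ => by simp [t.gwk_gwk]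
  | .app t s, _, _ => by simp [t.gwk_gwk, s.gwk_gwk]
  | .mlam t, _, _ => by simp [t.gwk_gwk]
  | .mapp t Γ, _, _ => by simp [t.gwk_gwk, Γ.gwk_gwk]

theorem LSub.gwk_gwk : ∀ (δ : LSub) (γ γ' : Wk), (δ.gwk γ).gwk γ' = δ.gwk (γ.comp γ')
  | .emp g m, _, _ => by cases g <;> simp
  | .wk g m, _, _ => by simp
  | .snoc δ t, _, _ => by simp [δ.gwk_gwk, t.gwk_gwk]

end

mutual

theorem Tm.lwk_lwk : ∀ (t : Tm) (τ τ' : Wk), (t.lwk τ).lwk τ' = t.lwk (τ.comp τ')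
  | .var x, _, _ => by simp
  | .gvar u δ, _, _ => by simp [δ.lwk_lwk]
  | .zero, _, _ => rfl
  | .succ t, _, _ => by simp [t.lwk_lwk]
  | .box t, _, _ => rfl
  | .letbox T s t, _, _ => by simp [s.lwk_lwk, t.lwk_lwk]
  | .lam t, _, _ => by simp [t.lwk_lwk]
  | .app t s, _, _ => by simp [t.lwk_lwk, s.lwk_lwk]
  | .mlam t, _, _ => by simp [t.lwk_lwk]
  | .mapp t Γ, _, _ => by simp [t.lwk_lwk]

theorem LSub.lwk_lwk : ∀ (δ : LSub) (τ τ' : Wk), (δ.lwk τ).lwk τ' = δ.lwk (τ.comp τ')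
  | .emp g m, _, _ => by simp [Nat.add_assoc]
  | .wk g m, _, _ => by simp [Nat.add_assoc]
  | .snoc δ t, _, _ => by simp [δ.lwk_lwk, t.lwk_lwk]

end

mutual

theorem Tm.lwk_gwk : ∀ (t : Tm) (τ γ : Wk), (t.lwk τ).gwk γ = (t.gwk γ).lwk τ
  | .var x, _, _ => rfl
  | .gvar u δ, _, _ => by simp [δ.lwk_gwk]
  | .zero, _, _ => rfl
  | .succ t, _, _ => by simp [t.lwk_gwk]
  | .box t, _, _ => rfl
  | .letbox T s t, _, _ => by simp [s.lwk_gwk, t.lwk_gwk]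
  | .lam t, _, _ => by simp [t.lwk_gwk]
  | .app t s, _, _ => by simp [t.lwk_gwk, s.lwk_gwk]
  | .mlam t, _, _ => by simp [t.lwk_gwk]
  | .mapp t Γ, _, _ => by simp [t.lwk_gwk]

theorem LSub.lwk_gwk : ∀ (δ : LSub) (τ γ : Wk), (δ.lwk τ).gwk γ = (δ.gwk γ).lwk τ
  | .emp g m, _, _ => by simp
  | .wk g m, _, _ => by simp
  | .snoc δ t, _, _ => by simp [δ.lwk_gwk, t.lwk_gwk]

end

theorem GBind.gwk_gwk (B : GBind) (γ γ' : Wk) : (B.gwk γ).gwk γ' = B.gwk (γ.comp γ') := by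
  cases B <;> simp [Typ.gwk_gwk, LCtx.gwk_gwk]

theorem GEnt.gwk_gwk (e : GEnt) (γ γ' : Wk) : (e.gwk γ).gwk γ' = e.gwk (γ.comp γ') := by
  cases e <;> simp [LCtx.gwk_gwk, Tm.gwk_gwk]

@[simp] theorem GBind.gwk_id (B : GBind) : B.gwk .id = B := by
  cases B <;> simp

/-! ### Structure of contexts and local substitutions under weakening -/

@[simp] theorem LCtx.len_gwk : ∀ (Γ : LCtx) (γ : Wk), (Γ.gwk γ).len = Γ.len
  | .nil, _ => rfl
  | .cvar _, _ => rfl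
  | .snoc Γ T, γ => by simp [Γ.len_gwk]

@[simp] theorem LCtx.base_gwk : ∀ (Γ : LCtx) (γ : Wk), (Γ.gwk γ).base = Γ.base.map γ.app
  | .nil, _ => rfl
  | .cvar _, _ => rfl
  | .snoc Γ T, γ => by simp [Γ.base_gwk]

@[simp] theorem LCtx.get_gwk :
    ∀ (Γ : LCtx) (γ : Wk) (x : ℕ), (Γ.gwk γ).get x = (Γ.get x).map fun T => T.gwk γ
  | .nil, _, _ => by simp
  | .cvar _, _, _ => by simp
  | .snoc Γ T, γ, 0 => by simp
  | .snoc Γ T, γ, x + 1 => by simp [Γ.get_gwk]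

theorem LCtx.get_eq_none : ∀ (Γ : LCtx) {x : ℕ}, Γ.len ≤ x → Γ.get x = none
  | .nil, _, _ => by simp
  | .cvar _, _, _ => by simp
  | .snoc Γ T, 0, h => by simp at h
  | .snoc Γ T, x + 1, h => by simpa using Γ.get_eq_none (by simpa using h)

theorem LCtx.lt_len_of_get {Γ : LCtx} {x : ℕ} {T : Typ} (h : Γ.get x = some T) : x < Γ.len := by
  by_contra hx
  simp [Γ.get_eq_none (not_lt.1 hx)] at h

theorem LCtx.exists_get : ∀ (Γ : LCtx) {x : ℕ}, x < Γ.len → ∃ T, Γ.get x = some T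
  | .nil, _, h => by simp at h
  | .cvar _, _, h => by simp at h
  | .snoc Γ T, 0, _ => ⟨T, by simp⟩
  | .snoc Γ T, x + 1, h => by simpa using Γ.exists_get (by simpa using h)

@[simp] theorem LCtx.wkSub_gwk :
    ∀ (Γ : LCtx) (m : ℕ) (γ : Wk), (Γ.wkSub m).gwk γ = (Γ.gwk γ).wkSub m
  | .nil, _, _ => rfl
  | .cvar _, _, _ => rfl
  | .snoc Γ T, m, γ => by simp [Γ.wkSub_gwk]

@[simp] theorem LCtx.wkSub_hat : ∀ (Γ : LCtx) (m : ℕ), (Γ.wkSub m).hat = Γ.len + m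
  | .nil, _ => by simp
  | .cvar _, _ => by simp
  | .snoc Γ T, m => by simp [Γ.wkSub_hat]; omega

@[simp] theorem LCtx.wkSub_check : ∀ (Γ : LCtx) (m : ℕ), (Γ.wkSub m).check = Γ.base
  | .nil, _ => by simp
  | .cvar _, _ => by simp
  | .snoc Γ T, m => by simp [Γ.wkSub_check]

theorem LCtx.wkSub_get_of_lt :
    ∀ (Γ : LCtx) (m : ℕ) {x : ℕ}, x < Γ.len → (Γ.wkSub m).get x = .var (m + x)
  | .nil, _, _, h => by simp at h
  | .cvar _, _, _, h => by simp at h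
  | .snoc Γ T, m, 0, _ => by simp
  | .snoc Γ T, m, x + 1, h => by
    simp [Γ.wkSub_get_of_lt (m + 1) (x := x) (by simpa using h)]; omega

theorem LCtx.wkSub_get_of_le :
    ∀ (Γ : LCtx) (m : ℕ) {x : ℕ}, Γ.len ≤ x → (Γ.wkSub m).get x = .zero
  | .nil, _, _, h => by simp
  | .cvar _, _, _, h => by simp
  | .snoc Γ T, m, 0, h => by simp at h
  | .snoc Γ T, m, x + 1, h => by
    simpa using Γ.wkSub_get_of_le (m + 1) (x := x) (by simpa using h)

theorem LCtx.wkSub_lwk_pn :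
    ∀ (Γ : LCtx) (m k : ℕ), (Γ.wkSub m).lwk (.pn k) = Γ.wkSub (m + k)
  | .nil, _, _ => by simp
  | .cvar _, _, _ => by simp
  | .snoc Γ T, m, k => by simp [Γ.wkSub_lwk_pn]; congr 1; omega

theorem LCtx.idSub_lwk_pn (Γ : LCtx) (k : ℕ) : Γ.idSub.lwk (.pn k) = Γ.wkSub k := by
  simp [LCtx.idSub, LCtx.wkSub_lwk_pn]

theorem LCtx.idSub_q (Γ : LCtx) (T : Typ) : Γ.idSub.q = (LCtx.snoc Γ T).idSub := by
  have := Γ.idSub_lwk_pn 1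
  simp only [Wk.pn] at this
  simpa [LSub.q, LCtx.idSub] using this

@[simp] theorem LCtx.idSub_gwk (Γ : LCtx) (γ : Wk) : Γ.idSub.gwk γ = (Γ.gwk γ).idSub := by
  simp [LCtx.idSub]

@[simp] theorem LSub.hat_lwk : ∀ (δ : LSub) (τ : Wk), (δ.lwk τ).hat = δ.hat + τ.numP
  | .emp _ _, _ => rfl
  | .wk _ _, _ => rfl
  | .snoc δ t, τ => by simp [δ.hat_lwk]

@[simp] theorem LSub.check_lwk : ∀ (δ : LSub) (τ : Wk), (δ.lwk τ).check = δ.check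
  | .emp _ _, _ => rfl
  | .wk _ _, _ => rfl
  | .snoc δ t, τ => by simp [δ.check_lwk]

@[simp] theorem LSub.get_lwk :
    ∀ (δ : LSub) (τ : Wk) (x : ℕ), (δ.lwk τ).get x = (δ.get x).lwk τ
  | .emp _ _, _, _ => by simp
  | .wk _ _, _, _ => by simp
  | .snoc δ t, τ, 0 => by simp
  | .snoc δ t, τ, x + 1 => by simp [δ.get_lwk]

@[simp] theorem LSub.hat_gwk : ∀ (δ : LSub) (γ : Wk), (δ.gwk γ).hat = δ.hat
  | .emp _ _, _ => rfl
  | .wk _ _, _ => rfl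
  | .snoc δ t, τ => by simp [δ.hat_gwk]

@[simp] theorem LSub.check_gwk : ∀ (δ : LSub) (γ : Wk), (δ.gwk γ).check = δ.check.map γ.app
  | .emp _ _, _ => rfl
  | .wk _ _, _ => rfl
  | .snoc δ t, τ => by simp [δ.check_gwk]

@[simp] theorem LSub.get_gwk :
    ∀ (δ : LSub) (γ : Wk) (x : ℕ), (δ.gwk γ).get x = (δ.get x).gwk γ
  | .emp _ _, _, _ => by simp
  | .wk _ _, _, _ => by simp
  | .snoc δ t, τ, 0 => by simp
  | .snoc δ t, τ, x + 1 => by simp [δ.get_gwk]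

@[simp] theorem LSub.hat_comp : ∀ δ δ' : LSub, (δ.comp δ').hat = δ'.hat
  | .emp none _, _ => by simp
  | .emp (some _) _, _ => by simp
  | .wk _ _, _ => rfl
  | .snoc δ t, δ' => by simp [δ.hat_comp]

theorem LSub.check_comp : ∀ δ δ' : LSub, (δ.comp δ').check = δ.check.or δ'.check
  | .emp none _, _ => by simp
  | .emp (some _) _, _ => by simp
  | .wk _ _, _ => by simp
  | .snoc δ t, δ' => by simp [δ.check_comp]

theorem LSub.get_comp : ∀ (δ δ' : LSub) (x : ℕ), (δ.comp δ').get x = (δ.get x).lsub δ'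
  | .emp none _, _, _ => by simp
  | .emp (some _) _, _, _ => by simp
  | .wk _ _, _, _ => by simp
  | .snoc δ t, δ', 0 => by simp
  | .snoc δ t, δ', x + 1 => by simp [δ.get_comp]

theorem LSub.q_lwk (δ : LSub) (τ : Wk) : δ.q.lwk (.q τ) = (δ.lwk τ).q := by
  simp [LSub.q, LSub.lwk_lwk]

theorem LSub.q_gwk (δ : LSub) (γ : Wk) : δ.q.gwk γ = (δ.gwk γ).q := by
  simp [LSub.q, LSub.lwk_gwk]

/-! ### Local substitution and weakening -/

mutual

theorem Tm.lsub_gwk :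
    ∀ (t : Tm) (δ : LSub) (γ : Wk), (t.lsub δ).gwk γ = (t.gwk γ).lsub (δ.gwk γ)
  | .var x, _, _ => by simp
  | .gvar u δ', _, _ => by simp [δ'.comp_gwk]
  | .zero, _, _ => rfl
  | .succ t, _, _ => by simp [t.lsub_gwk]
  | .box t, _, _ => rfl
  | .letbox T s t, _, _ => by simp [s.lsub_gwk, t.lsub_gwk, LSub.gwk_gwk]
  | .lam t, _, _ => by simp [t.lsub_gwk, LSub.q_gwk]
  | .app t s, _, _ => by simp [t.lsub_gwk, s.lsub_gwk]
  | .mlam t, _, _ => by simp [t.lsub_gwk, LSub.gwk_gwk]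
  | .mapp t Γ, _, _ => by simp [t.lsub_gwk]

theorem LSub.comp_gwk :
    ∀ (δ' δ : LSub) (γ : Wk), (δ'.comp δ).gwk γ = (δ'.gwk γ).comp (δ.gwk γ)
  | .emp none m, _, _ => by simp
  | .emp (some g) m, _, _ => by simp
  | .wk g m, _, _ => by simp
  | .snoc δ' t, _, _ => by simp [δ'.comp_gwk, t.lsub_gwk]

end

mutual

theorem Tm.lsub_lwk :
    ∀ (t : Tm) (δ : LSub) (τ : Wk), (t.lsub δ).lwk τ = t.lsub (δ.lwk τ)
  | .var x, _, _ => by simp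
  | .gvar u δ', _, _ => by simp [δ'.comp_lwk]
  | .zero, _, _ => rfl
  | .succ t, _, _ => by simp [t.lsub_lwk]
  | .box t, _, _ => rfl
  | .letbox T s t, _, _ => by simp [s.lsub_lwk, t.lsub_lwk, LSub.lwk_gwk]
  | .lam t, _, _ => by simp [t.lsub_lwk, LSub.q_lwk]
  | .app t s, _, _ => by simp [t.lsub_lwk, s.lsub_lwk]
  | .mlam t, _, _ => by simp [t.lsub_lwk, LSub.lwk_gwk]
  | .mapp t Γ, _, _ => by simp [t.lsub_lwk]

theorem LSub.comp_lwk :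
    ∀ (δ' δ : LSub) (τ : Wk), (δ'.comp δ).lwk τ = δ'.comp (δ.lwk τ)
  | .emp none m, _, _ => by simp
  | .emp (some g) m, _, _ => by simp
  | .wk g m, _, _ => by simp
  | .snoc δ' t, _, _ => by simp [δ'.comp_lwk, t.lsub_lwk]

end

/-- `δ'` is the local substitution `τ` followed by `δ`, up to what local substitution observes. -/
structure LSub.IsPrecomp (τ : Wk) (δ δ' : LSub) : Prop where
  get : ∀ x, δ'.get x = δ.get (τ.app x)
  hat : δ'.hat = δ.hat
  check : δ'.check = δ.check

theorem LSub.IsPrecomp.gwk {τ : Wk} {δ δ' : LSub} (h : LSub.IsPrecomp τ δ δ') (γ : Wk) :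
    LSub.IsPrecomp τ (δ.gwk γ) (δ'.gwk γ) :=
  ⟨fun x => by simp [h.get], by simp [h.hat], by simp [h.check]⟩

theorem LSub.IsPrecomp.q {τ : Wk} {δ δ' : LSub} (h : LSub.IsPrecomp τ δ δ') :
    LSub.IsPrecomp (.q τ) δ.q δ'.q :=
  ⟨fun x => by cases x <;> simp [LSub.q, h.get], by simp [LSub.q, h.hat],
    by simp [LSub.q, h.check]⟩

mutual

theorem Tm.lwk_lsub : ∀ (t : Tm) {τ : Wk} {δ δ' : LSub}, LSub.IsPrecomp τ δ δ' →
    (t.lwk τ).lsub δ = t.lsub δ'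
  | .var x, _, _, _, h => by simp [h.get]
  | .gvar u δ', _, _, _, h => by simp [δ'.lwk_comp h]
  | .zero, _, _, _, h => rfl
  | .succ t, _, _, _, h => by simp [t.lwk_lsub h]
  | .box t, _, _, _, h => rfl
  | .letbox T s t, _, _, _, h => by simp [s.lwk_lsub h, t.lwk_lsub (h.gwk _)]
  | .lam t, _, _, _, h => by simp [t.lwk_lsub h.q]
  | .app t s, _, _, _, h => by simp [t.lwk_lsub h, s.lwk_lsub h]
  | .mlam t, _, _, _, h => by simp [t.lwk_lsub (h.gwk _)]
  | .mapp t Γ, _, _, _, h => by simp [t.lwk_lsub h]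

theorem LSub.lwk_comp : ∀ (δ₀ : LSub) {τ : Wk} {δ δ' : LSub}, LSub.IsPrecomp τ δ δ' →
    (δ₀.lwk τ).comp δ = δ₀.comp δ'
  | .emp none m, _, _, _, h => by simp [h.hat, h.check]
  | .emp (some g) m, _, _, _, h => by simp [h.hat]
  | .wk g m, _, _, _, h => by simp [h.hat]
  | .snoc δ' t, _, _, _, h => by simp [δ'.lwk_comp h, t.lwk_lsub h]

end

theorem LSub.isPrecomp_p (δ : LSub) (t : Tm) : LSub.IsPrecomp (.p .id) (.snoc δ t) δ :=
  ⟨fun x => by simp, by simp, by simp⟩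

theorem LSub.q_comp_snoc (δ δ' : LSub) (t : Tm) :
    δ.q.comp (.snoc δ' t) = .snoc (δ.comp δ') t := by
  simp [LSub.q, δ.lwk_comp (LSub.isPrecomp_p δ' t)]

theorem LSub.q_comp_q (δ δ' : LSub) : δ.q.comp δ'.q = (δ.comp δ').q := by
  conv_lhs => rw [LSub.q.eq_def δ', LSub.q_comp_snoc]
  rw [LSub.q, LSub.comp_lwk]

mutual

theorem Tm.lsub_lsub :
    ∀ (t : Tm) (δ δ' : LSub), (t.lsub δ).lsub δ' = t.lsub (δ.comp δ')
  | .var x, _, _ => by simp [LSub.get_comp]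
  | .gvar u δ₀, _, _ => by simp [δ₀.comp_comp]
  | .zero, _, _ => rfl
  | .succ t, _, _ => by simp [t.lsub_lsub]
  | .box t, _, _ => rfl
  | .letbox T s t, _, _ => by simp [s.lsub_lsub, t.lsub_lsub, LSub.comp_gwk]
  | .lam t, _, _ => by simp [t.lsub_lsub, LSub.q_comp_q]
  | .app t s, _, _ => by simp [t.lsub_lsub, s.lsub_lsub]
  | .mlam t, _, _ => by simp [t.lsub_lsub, LSub.comp_gwk]
  | .mapp t Γ, _, _ => by simp [t.lsub_lsub]

theorem LSub.comp_comp :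
    ∀ (δ₀ δ δ' : LSub), (δ₀.comp δ).comp δ' = δ₀.comp (δ.comp δ')
  | .emp none m, δ, δ' => by
    rw [LSub.comp, LSub.comp, LSub.check_comp, LSub.hat_comp]
    cases δ.check <;> simp
  | .emp (some g) m, _, _ => by simp
  | .wk g m, _, _ => by simp
  | .snoc δ' t, _, _ => by simp [δ'.comp_comp, t.lsub_lsub]

end

/-! ### Global substitution -/

@[simp] theorem GSub.snoc_zero (σ : GSub) (e : GEnt) : σ.snoc e 0 = e := rfl
@[simp] theorem GSub.snoc_succ (σ : GSub) (e : GEnt) (k : ℕ) : σ.snoc e (k + 1) = σ k := rfl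
@[simp] theorem GSub.q_zero (σ : GSub) : σ.q 0 = .var 0 := rfl
@[simp] theorem GSub.q_succ (σ : GSub) (k : ℕ) : σ.q (k + 1) = (σ k).gwk (.p .id) := rfl

@[simp] theorem LSub.gsub_emp_none (m : ℕ) (σ : GSub) :
    (LSub.emp none m).gsub σ = .emp none m := by
  rw [LSub.gsub]

@[simp] theorem LSub.gsub_emp_some (g m : ℕ) (σ : GSub) :
    (LSub.emp (some g) m).gsub σ = .emp (σ.ctxAt g).base ((σ.ctxAt g).len + m) := by
  rw [LSub.gsub]

@[simp] theorem LSub.gsub_snoc (δ : LSub) (t : Tm) (σ : GSub) :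
    (LSub.snoc δ t).gsub σ = .snoc (δ.gsub σ) (t.gsub σ) := by
  rw [LSub.gsub]

@[simp] theorem LSub.gsub_wk (g m : ℕ) (σ : GSub) :
    (LSub.wk g m).gsub σ = (σ.ctxAt g).wkSub m := by
  rw [LSub.gsub, LCtx.idSub_lwk_pn]

/-- The global substitution `σ[γ]`. -/
def GSub.gwk (σ : GSub) (γ : Wk) : GSub := fun k => (σ k).gwk γ

/-- The global substitution `γ` followed by `σ`. -/
def GSub.pre (γ : Wk) (σ : GSub) : GSub := fun k => σ (γ.app k)

theorem GSub.q_gwk (σ : GSub) (γ : Wk) : σ.q.gwk (.q γ) = (σ.gwk γ).q := by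
  funext k
  cases k <;> simp [GSub.gwk, GEnt.gwk_gwk]

theorem GSub.pre_q (γ : Wk) (σ : GSub) : GSub.pre (.q γ) σ.q = (GSub.pre γ σ).q := by
  funext k
  cases k <;> simp [GSub.pre]

@[simp] theorem GSub.pre_id (σ : GSub) : GSub.pre .id σ = σ := rfl

@[simp] theorem GSub.pre_p_snoc (γ : Wk) (σ : GSub) (e : GEnt) :
    GSub.pre (.p γ) (σ.snoc e) = GSub.pre γ σ := rfl

@[simp] theorem GSub.pre_p_q (σ : GSub) : GSub.pre (.p .id) σ.q = σ.gwk (.p .id) := rfl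

theorem GSub.ctxAt_pre (γ : Wk) (σ : GSub) (g : ℕ) :
    (GSub.pre γ σ).ctxAt g = σ.ctxAt (γ.app g) := rfl

theorem GSub.tmAt_pre (γ : Wk) (σ : GSub) (u : ℕ) (δ : LSub) :
    (GSub.pre γ σ).tmAt u δ = σ.tmAt (γ.app u) δ := rfl

theorem GSub.ctxAt_gwk (γ : Wk) (σ : GSub) (g : ℕ) :
    (σ.gwk γ).ctxAt g = (σ.ctxAt g).gwk γ := by
  simp only [GSub.ctxAt, GSub.gwk]
  cases σ g <;> rfl

theorem GSub.tmAt_gwk (γ : Wk) (σ : GSub) (u : ℕ) (δ : LSub) :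
    (σ.gwk γ).tmAt u (δ.gwk γ) = (σ.tmAt u δ).gwk γ := by
  simp only [GSub.tmAt, GSub.gwk]
  cases σ u <;> simp [Tm.lsub_gwk]

theorem GSub.tmAt_lwk (τ : Wk) (σ : GSub) (u : ℕ) (δ : LSub) :
    σ.tmAt u (δ.lwk τ) = (σ.tmAt u δ).lwk τ := by
  simp only [GSub.tmAt]
  cases σ u <;> simp [Tm.lsub_lwk]

theorem GSub.tmAt_comp (σ : GSub) (u : ℕ) (δ δ' : LSub) :
    σ.tmAt u (δ.comp δ') = (σ.tmAt u δ).lsub δ' := by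
  simp only [GSub.tmAt]
  cases σ u <;> simp [Tm.lsub_lsub]

mutual

theorem Typ.gwk_gsub : ∀ (T : Typ) (γ : Wk) (σ : GSub), (T.gwk γ).gsub σ = T.gsub (.pre γ σ)
  | .nat, _, _ => rfl
  | .arr S T, _, _ => by simp [S.gwk_gsub, T.gwk_gsub]
  | .box Δ T, _, _ => by simp [Δ.gwk_gsub, T.gwk_gsub]
  | .mfun T, _, _ => by simp [T.gwk_gsub, GSub.pre_q]

theorem LCtx.gwk_gsub :
    ∀ (Γ : LCtx) (γ : Wk) (σ : GSub), (Γ.gwk γ).gsub σ = Γ.gsub (.pre γ σ)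
  | .nil, _, _ => rfl
  | .cvar g, _, _ => by simp [GSub.ctxAt_pre]
  | .snoc Γ T, _, _ => by simp [Γ.gwk_gsub, T.gwk_gsub]

end

mutual

theorem Typ.gsub_gwk : ∀ (T : Typ) (σ : GSub) (γ : Wk), (T.gsub σ).gwk γ = T.gsub (σ.gwk γ)
  | .nat, _, _ => rfl
  | .arr S T, _, _ => by simp [S.gsub_gwk, T.gsub_gwk]
  | .box Δ T, _, _ => by simp [Δ.gsub_gwk, T.gsub_gwk]
  | .mfun T, _, _ => by simp [T.gsub_gwk, GSub.q_gwk]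

theorem LCtx.gsub_gwk :
    ∀ (Γ : LCtx) (σ : GSub) (γ : Wk), (Γ.gsub σ).gwk γ = Γ.gsub (σ.gwk γ)
  | .nil, _, _ => rfl
  | .cvar g, _, _ => by simp [GSub.ctxAt_gwk]
  | .snoc Γ T, _, _ => by simp [Γ.gsub_gwk, T.gsub_gwk]

end

mutual

theorem Tm.gwk_gsub : ∀ (t : Tm) (γ : Wk) (σ : GSub), (t.gwk γ).gsub σ = t.gsub (.pre γ σ)
  | .var x, _, _ => rfl
  | .gvar u δ, _, _ => by simp [δ.gwk_gsub, GSub.tmAt_pre]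
  | .zero, _, _ => rfl
  | .succ t, _, _ => by simp [t.gwk_gsub]
  | .box t, _, _ => by simp [t.gwk_gsub]
  | .letbox T s t, _, _ => by simp [T.gwk_gsub, s.gwk_gsub, t.gwk_gsub, GSub.pre_q]
  | .lam t, _, _ => by simp [t.gwk_gsub]
  | .app t s, _, _ => by simp [t.gwk_gsub, s.gwk_gsub]
  | .mlam t, _, _ => by simp [t.gwk_gsub, GSub.pre_q]
  | .mapp t Γ, _, _ => by simp [t.gwk_gsub, Γ.gwk_gsub]

theorem LSub.gwk_gsub : ∀ (δ : LSub) (γ : Wk) (σ : GSub), (δ.gwk γ).gsub σ = δ.gsub (.pre γ σ)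
  | .emp none m, _, _ => by simp
  | .emp (some g) m, _, _ => by simp [GSub.ctxAt_pre]
  | .wk g m, _, _ => by simp [GSub.ctxAt_pre]
  | .snoc δ t, _, _ => by simp [δ.gwk_gsub, t.gwk_gsub]

end

mutual

theorem Tm.gsub_gwk : ∀ (t : Tm) (σ : GSub) (γ : Wk), (t.gsub σ).gwk γ = t.gsub (σ.gwk γ)
  | .var x, _, _ => rfl
  | .gvar u δ, _, _ => by simp [← δ.gsub_gwk, GSub.tmAt_gwk]
  | .zero, _, _ => rfl
  | .succ t, _, _ => by simp [t.gsub_gwk]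
  | .box t, _, _ => by simp [t.gsub_gwk]
  | .letbox T s t, _, _ => by simp [T.gsub_gwk, s.gsub_gwk, t.gsub_gwk, GSub.q_gwk]
  | .lam t, _, _ => by simp [t.gsub_gwk]
  | .app t s, _, _ => by simp [t.gsub_gwk, s.gsub_gwk]
  | .mlam t, _, _ => by simp [t.gsub_gwk, GSub.q_gwk]
  | .mapp t Γ, _, _ => by simp [t.gsub_gwk, Γ.gsub_gwk]

theorem LSub.gsub_gwk : ∀ (δ : LSub) (σ : GSub) (γ : Wk), (δ.gsub σ).gwk γ = δ.gsub (σ.gwk γ)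
  | .emp none m, _, _ => by simp
  | .emp (some g) m, _, _ => by simp [GSub.ctxAt_gwk]
  | .wk g m, _, _ => by simp [GSub.ctxAt_gwk]
  | .snoc δ t, _, _ => by simp [δ.gsub_gwk, t.gsub_gwk]

end

@[simp] theorem GSub.q_id : GSub.id.q = GSub.id := by
  funext k
  cases k <;> simp [GSub.id]

@[simp] theorem GSub.ctxAt_id (g : ℕ) : GSub.id.ctxAt g = .cvar g := rfl

@[simp] theorem GSub.tmAt_id (u : ℕ) (δ : LSub) : GSub.id.tmAt u δ = .gvar u δ := rfl

mutual

theorem Typ.gsub_id : ∀ T : Typ, T.gsub .id = T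
  | .nat => rfl
  | .arr S T => by simp [S.gsub_id, T.gsub_id]
  | .box Δ T => by simp [Δ.gsub_id, T.gsub_id]
  | .mfun T => by simp [T.gsub_id]

theorem LCtx.gsub_id : ∀ Γ : LCtx, Γ.gsub .id = Γ
  | .nil => rfl
  | .cvar g => by simp
  | .snoc Γ T => by simp [Γ.gsub_id, T.gsub_id]

end

mutual

theorem Tm.gsub_id : ∀ t : Tm, t.gsub .id = t
  | .var x => rfl
  | .gvar u δ => by simp [δ.gsub_id]
  | .zero => rfl
  | .succ t => by simp [t.gsub_id]
  | .box t => by simp [t.gsub_id]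
  | .letbox T s t => by simp [T.gsub_id, s.gsub_id, t.gsub_id]
  | .lam t => by simp [t.gsub_id]
  | .app t s => by simp [t.gsub_id, s.gsub_id]
  | .mlam t => by simp [t.gsub_id]
  | .mapp t Γ => by simp [t.gsub_id, Γ.gsub_id]

theorem LSub.gsub_id : ∀ δ : LSub, δ.gsub .id = δ
  | .emp none m => by simp
  | .emp (some g) m => by simp
  | .wk g m => by simp
  | .snoc δ t => by simp [δ.gsub_id, t.gsub_id]

end

attribute [simp] Typ.gsub_id LCtx.gsub_id Tm.gsub_id LSub.gsub_id

/-- The global substitution renaming along a weakening. -/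
def GSub.ren (γ : Wk) : GSub := .pre γ .id

theorem Typ.gsub_ren (T : Typ) (γ : Wk) : T.gsub (.ren γ) = T.gwk γ := by
  rw [GSub.ren, ← Typ.gwk_gsub, Typ.gsub_id]

theorem LCtx.gsub_ren (Γ : LCtx) (γ : Wk) : Γ.gsub (.ren γ) = Γ.gwk γ := by
  rw [GSub.ren, ← LCtx.gwk_gsub, LCtx.gsub_id]

/-- Global substitution on entries. -/
def GEnt.gsub : GEnt → GSub → GEnt
  | .var k, σ => σ k
  | .tm t, σ => .tm (t.gsub σ)
  | .ctx Γ, σ => .ctx (Γ.gsub σ)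

@[simp] theorem GEnt.gsub_var (k : ℕ) (σ : GSub) : (GEnt.var k).gsub σ = σ k := rfl
@[simp] theorem GEnt.gsub_tm (t : Tm) (σ : GSub) : (GEnt.tm t).gsub σ = .tm (t.gsub σ) := rfl
@[simp] theorem GEnt.gsub_ctx (Γ : LCtx) (σ : GSub) :
    (GEnt.ctx Γ).gsub σ = .ctx (Γ.gsub σ) := rfl

/-- Composition of global substitutions: first `σ`, then `ρ`. -/
def GSub.comp (σ ρ : GSub) : GSub := fun k => (σ k).gsub ρ

theorem GEnt.gwk_gsub (e : GEnt) (γ : Wk) (σ : GSub) :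
    (e.gwk γ).gsub σ = e.gsub (.pre γ σ) := by
  cases e
  · rfl
  · simp [Tm.gwk_gsub]
  · simp [LCtx.gwk_gsub]

theorem GEnt.gsub_gwk (e : GEnt) (γ : Wk) (σ : GSub) :
    (e.gsub σ).gwk γ = e.gsub (σ.gwk γ) := by
  cases e
  · rfl
  · simp [Tm.gsub_gwk]
  · simp [LCtx.gsub_gwk]

@[simp] theorem GEnt.gsub_id (e : GEnt) : e.gsub .id = e := by
  cases e <;> simp [GSub.id]

theorem GSub.q_comp_q (σ ρ : GSub) : σ.q.comp ρ.q = (σ.comp ρ).q := by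
  funext k
  cases k <;> simp [GSub.comp, GEnt.gwk_gsub, GEnt.gsub_gwk]

theorem GSub.snoc_comp (σ ρ : GSub) (e : GEnt) :
    (σ.snoc e).comp ρ = (σ.comp ρ).snoc (e.gsub ρ) := by
  funext k
  cases k <;> rfl

theorem GSub.q_comp_snoc (σ ρ : GSub) (e : GEnt) :
    σ.q.comp (ρ.snoc e) = (σ.comp ρ).snoc e := by
  funext k
  cases k <;> simp [GSub.comp, GEnt.gwk_gsub]

@[simp] theorem GSub.id_comp (σ : GSub) : GSub.id.comp σ = σ := rfl

@[simp] theorem GSub.comp_id (σ : GSub) : σ.comp .id = σ := by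
  funext k
  simp [GSub.comp]

theorem GSub.ctxAt_comp (σ ρ : GSub) (g : ℕ) :
    (σ.comp ρ).ctxAt g = (σ.ctxAt g).gsub ρ := by
  simp only [GSub.ctxAt, GSub.comp]
  cases σ g <;> simp [GSub.ctxAt]

mutual

theorem Typ.gsub_gsub : ∀ (T : Typ) (σ ρ : GSub), (T.gsub σ).gsub ρ = T.gsub (σ.comp ρ)
  | .nat, _, _ => rfl
  | .arr S T, _, _ => by simp [S.gsub_gsub, T.gsub_gsub]
  | .box Δ T, _, _ => by simp [Δ.gsub_gsub, T.gsub_gsub]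
  | .mfun T, _, _ => by simp [T.gsub_gsub, GSub.q_comp_q]

theorem LCtx.gsub_gsub : ∀ (Γ : LCtx) (σ ρ : GSub), (Γ.gsub σ).gsub ρ = Γ.gsub (σ.comp ρ)
  | .nil, _, _ => rfl
  | .cvar g, _, _ => by simp [GSub.ctxAt_comp]
  | .snoc Γ T, _, _ => by simp [Γ.gsub_gsub, T.gsub_gsub]

end

theorem Typ.inst_gsub (T : Typ) (Δ : LCtx) (σ : GSub) :
    (T.inst Δ).gsub σ = (T.gsub σ.q).inst (Δ.gsub σ) := by
  simp [Typ.inst, Typ.gsub_gsub, GSub.snoc_comp, GSub.q_comp_snoc]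

theorem Typ.inst_gwk (T : Typ) (Δ : LCtx) (γ : Wk) :
    (T.inst Δ).gwk γ = (T.gwk (.q γ)).inst (Δ.gwk γ) := by
  simp only [Typ.inst, Typ.gsub_gwk, Typ.gwk_gsub]
  congr 1
  funext k
  cases k <;> simp [GSub.gwk, GSub.pre, GSub.id]

theorem GSub.ctxAt_q_congr {σ ρ : GSub} (h : ∀ g, σ.ctxAt g = ρ.ctxAt g) :
    ∀ g, σ.q.ctxAt g = ρ.q.ctxAt g
  | 0 => rfl
  | g + 1 => by
    have := congrArg (fun Γ => LCtx.gwk Γ (.p .id)) (h g)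
    simp only [← GSub.ctxAt_gwk] at this
    exact this

mutual

theorem Typ.gsub_congr : ∀ (T : Typ) {σ ρ : GSub}, (∀ g, σ.ctxAt g = ρ.ctxAt g) →
    T.gsub σ = T.gsub ρ
  | .nat, _, _, _ => rfl
  | .arr S T, _, _, h => by simp [S.gsub_congr h, T.gsub_congr h]
  | .box Δ T, _, _, h => by simp [Δ.gsub_congr h, T.gsub_congr h]
  | .mfun T, _, _, h => by simp [T.gsub_congr (GSub.ctxAt_q_congr h)]

theorem LCtx.gsub_congr : ∀ (Γ : LCtx) {σ ρ : GSub}, (∀ g, σ.ctxAt g = ρ.ctxAt g) →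
    Γ.gsub σ = Γ.gsub ρ
  | .nil, _, _, _ => rfl
  | .cvar g, _, _, h => by simp [h]
  | .snoc Γ T, _, _, h => by simp [Γ.gsub_congr h, T.gsub_congr h]

end

theorem Typ.inst_cvar (T : Typ) (g : ℕ) : T.inst (.cvar g) = T.gsub (GSub.id.snoc (.var g)) :=
  T.gsub_congr fun k => by cases k <;> rfl

theorem GSub.pre_q_p_snoc_var : GSub.pre (.q (.p .id)) (GSub.id.snoc (.var 0)) = GSub.id := by
  funext k
  cases k <;> rfl

theorem Typ.gwk_q_inst_var (T : Typ) : (T.gwk (.q (.p .id))).inst (.cvar 0) = T := by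
  rw [Typ.inst_cvar, Typ.gwk_gsub, GSub.pre_q_p_snoc_var, Typ.gsub_id]

theorem Typ.gsub_gwk_p (T : Typ) (σ : GSub) :
    (T.gwk (.p .id)).gsub σ.q = (T.gsub σ).gwk (.p .id) := by
  simp [Typ.gwk_gsub, Typ.gsub_gwk]

theorem LCtx.gsub_gwk_p (Γ : LCtx) (σ : GSub) :
    (Γ.gwk (.p .id)).gsub σ.q = (Γ.gsub σ).gwk (.p .id) := by
  simp [LCtx.gwk_gsub, LCtx.gsub_gwk]

theorem LSub.gsub_gwk_p (δ : LSub) (σ : GSub) :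
    (δ.gwk (.p .id)).gsub σ.q = (δ.gsub σ).gwk (.p .id) := by
  simp [LSub.gwk_gsub, LSub.gsub_gwk]

@[simp] theorem Typ.gwk_p_gsub_snoc (T : Typ) (σ : GSub) (e : GEnt) :
    (T.gwk (.p .id)).gsub (σ.snoc e) = T.gsub σ := by
  simp [Typ.gwk_gsub]

@[simp] theorem LCtx.gwk_p_gsub_snoc (Γ : LCtx) (σ : GSub) (e : GEnt) :
    (Γ.gwk (.p .id)).gsub (σ.snoc e) = Γ.gsub σ := by
  simp [LCtx.gwk_gsub]

@[simp] theorem Tm.gwk_p_gsub_snoc (t : Tm) (σ : GSub) (e : GEnt) :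
    (t.gwk (.p .id)).gsub (σ.snoc e) = t.gsub σ := by
  simp [Tm.gwk_gsub]

@[simp] theorem LSub.gwk_p_gsub_snoc (δ : LSub) (σ : GSub) (e : GEnt) :
    (δ.gwk (.p .id)).gsub (σ.snoc e) = δ.gsub σ := by
  simp [LSub.gwk_gsub]

/-! ### Contexts under global substitution -/

/-- The number of local variables a global substitution puts below the base `b`. -/
def GSub.baseLen (σ : GSub) (b : Option ℕ) : ℕ := b.elim 0 fun g => (σ.ctxAt g).len

theorem LCtx.len_gsub : ∀ (Γ : LCtx) (σ : GSub), (Γ.gsub σ).len = Γ.len + σ.baseLen Γ.base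
  | .nil, _ => by simp [GSub.baseLen]
  | .cvar _, _ => by simp [GSub.baseLen]
  | .snoc Γ T, σ => by simp [Γ.len_gsub]; omega

theorem LCtx.base_gsub :
    ∀ (Γ : LCtx) (σ : GSub), (Γ.gsub σ).base = Γ.base.bind fun g => (σ.ctxAt g).base
  | .nil, _ => by simp
  | .cvar _, _ => by simp
  | .snoc Γ T, σ => by simp [Γ.base_gsub]

theorem LCtx.get_gsub : ∀ {Γ : LCtx} (σ : GSub) {x : ℕ} {T : Typ}, Γ.get x = some T →
    (Γ.gsub σ).get x = some (T.gsub σ)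
  | .nil, _, _, _, h => by simp at h
  | .cvar _, _, _, _, h => by simp at h
  | .snoc Γ T, σ, 0, _, h => by simp at h; simp [h]
  | .snoc Γ T, σ, x + 1, _, h => by simp at h; simp [LCtx.get_gsub σ h]

theorem LCtx.get_gsub_add :
    ∀ {Γ : LCtx} (σ : GSub) {g : ℕ} (x : ℕ), Γ.base = some g →
      (Γ.gsub σ).get (x + Γ.len) = (σ.ctxAt g).get x
  | .nil, _, _, _, h => by simp at h
  | .cvar _, _, _, _, h => by simp at h; simp [h]
  | .snoc Γ T, σ, g, x, h => by
    simpa [← Nat.add_assoc] using LCtx.get_gsub_add σ x (Γ := Γ) (by simpa using h)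

theorem LSub.hat_gsub : ∀ (δ : LSub) (σ : GSub), (δ.gsub σ).hat = δ.hat + σ.baseLen δ.check
  | .emp none m, _ => by simp [GSub.baseLen]
  | .emp (some g) m, _ => by simp [GSub.baseLen]; omega
  | .wk g m, _ => by simp [GSub.baseLen]; omega
  | .snoc δ t, σ => by simp [δ.hat_gsub]

theorem LSub.check_gsub :
    ∀ (δ : LSub) (σ : GSub), (δ.gsub σ).check = δ.check.bind fun g => (σ.ctxAt g).base
  | .emp none m, _ => by simp
  | .emp (some g) m, _ => by simp
  | .wk g m, _ => by simp
  | .snoc δ t, σ => by simp [δ.check_gsub]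

/-! ### Scoping -/

mutual

/-- `t` is well scoped over a local context with `n` variables and base `b`. -/
def Tm.Sc : Tm → ℕ → Option ℕ → Prop
  | .var x, n, _ => x < n
  | .gvar _ δ, n, b => δ.Sc n b
  | .zero, _, _ => True
  | .succ t, n, b => t.Sc n b
  | .box _, _, _ => True
  | .letbox _ s t, n, b => s.Sc n b ∧ t.Sc n (b.map (· + 1))
  | .lam t, n, b => t.Sc (n + 1) b
  | .app t s, n, b => t.Sc n b ∧ s.Sc n b
  | .mlam t, n, b => t.Sc n (b.map (· + 1))
  | .mapp t _, n, b => t.Sc n b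

/-- `δ` is well scoped over a local context with `n` variables and base `b`. -/
def LSub.Sc : LSub → ℕ → Option ℕ → Prop
  | .emp g m, n, b => m = n ∧ b = g
  | .wk g m, n, b => m = n ∧ b = some g
  | .snoc δ t, n, b => δ.Sc n b ∧ t.Sc n b

end

/-- `δ` replaces the variables of a local context with `n` variables and base `b`. -/
def LSub.Dom : LSub → ℕ → Option ℕ → Prop
  | .emp _ _, n, b => n = 0 ∧ b = none
  | .wk g _, n, b => n = 0 ∧ b = some g
  | .snoc _ _, 0, _ => False
  | .snoc δ _, n + 1, b => δ.Dom n b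

attribute [simp] Tm.Sc LSub.Sc LSub.Dom

mutual

theorem Tm.Sc.gwk : ∀ {t : Tm} {n : ℕ} {b : Option ℕ} (γ : Wk), t.Sc n b →
    (t.gwk γ).Sc n (b.map γ.app)
  | .var x, n, b, γ, h => h
  | .gvar u δ, n, b, γ, h => LSub.Sc.gwk (δ := δ) γ h
  | .zero, n, b, γ, h => trivial
  | .succ t, n, b, γ, h => Tm.Sc.gwk (t := t) γ h
  | .box t, n, b, γ, h => trivial
  | .letbox T s t, n, b, γ, h => by
    have := Tm.Sc.gwk (t := t) (.q γ) h.2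
    exact ⟨Tm.Sc.gwk γ h.1, by simpa [Option.map_map, Function.comp_def] using this⟩
  | .lam t, n, b, γ, h => Tm.Sc.gwk (t := t) γ h
  | .app t s, n, b, γ, h => ⟨Tm.Sc.gwk γ h.1, Tm.Sc.gwk γ h.2⟩
  | .mlam t, n, b, γ, h => by
    have := Tm.Sc.gwk (t := t) (.q γ) h
    simpa [Option.map_map, Function.comp_def] using this
  | .mapp t Γ, n, b, γ, h => Tm.Sc.gwk (t := t) γ h

theorem LSub.Sc.gwk : ∀ {δ : LSub} {n : ℕ} {b : Option ℕ} (γ : Wk), δ.Sc n b →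
    (δ.gwk γ).Sc n (b.map γ.app)
  | .emp g m, n, b, γ, h => by simp at h; simp [h]
  | .wk g m, n, b, γ, h => by simp at h; simp [h]
  | .snoc δ t, n, b, γ, h => ⟨LSub.Sc.gwk γ h.1, Tm.Sc.gwk γ h.2⟩

end

theorem LSub.Dom.gwk : ∀ {δ : LSub} {n : ℕ} {b : Option ℕ} (γ : Wk), δ.Dom n b →
    (δ.gwk γ).Dom n (b.map γ.app)
  | .emp g m, n, b, γ, h => by simp at h; simp [h]
  | .wk g m, n, b, γ, h => by simp at h; simp [h]
  | .snoc δ t, n + 1, b, γ, h => LSub.Dom.gwk (δ := δ) γ h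

theorem LSub.Dom.lwk : ∀ {δ : LSub} {n : ℕ} {b : Option ℕ} (τ : Wk), δ.Dom n b →
    (δ.lwk τ).Dom n b
  | .emp g m, n, b, τ, h => h
  | .wk g m, n, b, τ, h => h
  | .snoc δ t, n + 1, b, τ, h => LSub.Dom.lwk (δ := δ) τ h

theorem LSub.Dom.q {δ : LSub} {n : ℕ} {b : Option ℕ} (h : δ.Dom n b) : δ.q.Dom (n + 1) b :=
  LSub.Dom.lwk _ h

mutual

theorem Tm.Sc.lwk : ∀ {t : Tm} {n n' : ℕ} {b : Option ℕ} {τ : Wk}, t.Sc n b →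
    (∀ x < n, τ.app x < n') → n' = n + τ.numP → (t.lwk τ).Sc n' b
  | .var x, n, _, b, τ, h, h', _ => h' x h
  | .gvar u δ, n, _, b, τ, h, h', e => LSub.Sc.lwk (δ := δ) h h' e
  | .zero, n, _, b, τ, h, h', e => trivial
  | .succ t, n, _, b, τ, h, h', e => Tm.Sc.lwk (t := t) h h' e
  | .box t, n, _, b, τ, h, h', e => trivial
  | .letbox T s t, n, _, b, τ, h, h', e => ⟨Tm.Sc.lwk h.1 h' e, Tm.Sc.lwk h.2 h' e⟩
  | .lam t, n, n', b, τ, h, h', e => by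
    refine Tm.Sc.lwk (t := t) (n' := n' + 1) h (fun x hx => ?_) (by simp; omega)
    cases x with
    | zero => simp
    | succ x => simpa using h' x (by omega)
  | .app t s, n, _, b, τ, h, h', e => ⟨Tm.Sc.lwk h.1 h' e, Tm.Sc.lwk h.2 h' e⟩
  | .mlam t, n, _, b, τ, h, h', e => Tm.Sc.lwk (t := t) h h' e
  | .mapp t Γ, n, _, b, τ, h, h', e => Tm.Sc.lwk (t := t) h h' e

theorem LSub.Sc.lwk : ∀ {δ : LSub} {n n' : ℕ} {b : Option ℕ} {τ : Wk}, δ.Sc n b →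
    (∀ x < n, τ.app x < n') → n' = n + τ.numP → (δ.lwk τ).Sc n' b
  | .emp g m, n, _, b, τ, h, h', e => by simp at h; simp [h, e]
  | .wk g m, n, _, b, τ, h, h', e => by simp at h; simp [h, e]
  | .snoc δ t, n, _, b, τ, h, h', e => ⟨LSub.Sc.lwk h.1 h' e, Tm.Sc.lwk h.2 h' e⟩

end

theorem LSub.Sc.q {δ : LSub} {n : ℕ} {b : Option ℕ} (h : δ.Sc n b) : δ.q.Sc (n + 1) b :=
  ⟨LSub.Sc.lwk h (fun x hx => by simpa using hx) rfl, by simp⟩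

mutual

theorem Tm.lsub_idSub : ∀ {t : Tm} {Γ : LCtx}, t.Sc Γ.len Γ.base → t.lsub Γ.idSub = t
  | .var x, Γ, h => by simpa [LCtx.idSub] using Γ.wkSub_get_of_lt 0 h
  | .gvar u δ, Γ, h => by simp [LSub.comp_idSub (δ := δ) h]
  | .zero, Γ, h => rfl
  | .succ t, Γ, h => by simp [Tm.lsub_idSub (t := t) h]
  | .box t, Γ, h => rfl
  | .letbox T s t, Γ, h => by
    simp [Tm.lsub_idSub (t := s) h.1,
      Tm.lsub_idSub (t := t) (Γ := Γ.gwk (.p .id)) (by simpa using h.2)]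
  | .lam t, Γ, h => by
    simp [Γ.idSub_q .nat, Tm.lsub_idSub (t := t) (Γ := Γ.snoc .nat) h]
  | .app t s, Γ, h => by simp [Tm.lsub_idSub h.1, Tm.lsub_idSub h.2]
  | .mlam t, Γ, h => by
    simp [Tm.lsub_idSub (t := t) (Γ := Γ.gwk (.p .id)) (by simpa using h)]
  | .mapp t Δ, Γ, h => by simp [Tm.lsub_idSub (t := t) h]

theorem LSub.comp_idSub : ∀ {δ : LSub} {Γ : LCtx}, δ.Sc Γ.len Γ.base → δ.comp Γ.idSub = δ
  | .emp none m, Γ, h => by simp at h; simp [LCtx.idSub, h]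
  | .emp (some g) m, Γ, h => by simp at h; simp [LCtx.idSub, h]
  | .wk g m, Γ, h => by simp at h; simp [LCtx.idSub, h]
  | .snoc δ t, Γ, h => by simp [LSub.comp_idSub h.1, Tm.lsub_idSub h.2]

end

theorem LCtx.wkSub_lwk : ∀ (Γ : LCtx) (m k : ℕ) (τ : Wk), (∀ x ≥ m, τ.app x = x + τ.numP) →
    k = m + τ.numP → (Γ.wkSub m).lwk τ = Γ.wkSub k
  | .nil, _, _, _, _, e => by simp [e]
  | .cvar _, _, _, _, _, e => by simp [e]
  | .snoc Γ T, m, k, τ, h, e => by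
    simp [Γ.wkSub_lwk (m + 1) (k + 1) τ (fun x hx => h x (by omega)) (by omega), h, e]

mutual

theorem Tm.lwk_gsub : ∀ {t : Tm} {n : ℕ} {b : Option ℕ} {τ : Wk} (σ : GSub), t.Sc n b →
    (∀ x ≥ n, τ.app x = x + τ.numP) → (t.lwk τ).gsub σ = (t.gsub σ).lwk τ
  | .var x, n, b, τ, σ, h, h' => rfl
  | .gvar u δ, n, b, τ, σ, h, h' => by
    simp [LSub.lwk_gsub (δ := δ) σ h h', GSub.tmAt_lwk]
  | .zero, n, b, τ, σ, h, h' => rfl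
  | .succ t, n, b, τ, σ, h, h' => by simp [Tm.lwk_gsub (t := t) σ h h']
  | .box t, n, b, τ, σ, h, h' => rfl
  | .letbox T s t, n, b, τ, σ, h, h' => by
    simp [Tm.lwk_gsub (t := s) σ h.1 h', Tm.lwk_gsub (t := t) σ.q h.2 h']
  | .lam t, n, b, τ, σ, h, h' => by
    have : ∀ x ≥ n + 1, (Wk.q τ).app x = x + (Wk.q τ).numP := by
      rintro (_ | x) hx
      · omega
      · simp [h' x (by omega)]; omega
    simp [Tm.lwk_gsub (t := t) σ h this]
  | .app t s, n, b, τ, σ, h, h' => by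
    simp [Tm.lwk_gsub (t := t) σ h.1 h', Tm.lwk_gsub (t := s) σ h.2 h']
  | .mlam t, n, b, τ, σ, h, h' => by simp [Tm.lwk_gsub (t := t) σ.q h h']
  | .mapp t Γ, n, b, τ, σ, h, h' => by simp [Tm.lwk_gsub (t := t) σ h h']

theorem LSub.lwk_gsub : ∀ {δ : LSub} {n : ℕ} {b : Option ℕ} {τ : Wk} (σ : GSub), δ.Sc n b →
    (∀ x ≥ n, τ.app x = x + τ.numP) → (δ.lwk τ).gsub σ = (δ.gsub σ).lwk τ
  | .emp none m, n, b, τ, σ, h, h' => by simp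
  | .emp (some g) m, n, b, τ, σ, h, h' => by simp [Nat.add_assoc]
  | .wk g m, n, b, τ, σ, h, h' => by
    simp at h
    rw [LSub.lwk, LSub.gsub_wk, LSub.gsub_wk, LCtx.wkSub_lwk]
    · rwa [h.1]
    · rfl
  | .snoc δ t, n, b, τ, σ, h, h' => by
    simp [LSub.lwk_gsub (δ := δ) σ h.1 h', Tm.lwk_gsub (t := t) σ h.2 h']

end

theorem LSub.q_gsub {δ : LSub} {n : ℕ} {b : Option ℕ} (h : δ.Sc n b) (σ : GSub) :
    δ.q.gsub σ = (δ.gsub σ).q := by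
  simp [LSub.q, LSub.lwk_gsub (τ := .p .id) σ h (by simp)]

theorem LSub.Dom.get_gsub : ∀ {δ : LSub} {n : ℕ} {b : Option ℕ} (σ : GSub), δ.Dom n b →
    ∀ x < n, (δ.gsub σ).get x = (δ.get x).gsub σ
  | .emp g m, n, b, σ, h, x, hx => by simp at h; omega
  | .wk g m, n, b, σ, h, x, hx => by simp at h; omega
  | .snoc δ t, n + 1, b, σ, h, 0, hx => by simp
  | .snoc δ t, n + 1, b, σ, h, x + 1, hx => by
    simpa using LSub.Dom.get_gsub (δ := δ) σ h x (by omega)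

theorem LSub.Dom.get_gsub_add : ∀ {δ : LSub} {n g : ℕ} (σ : GSub), δ.Dom n (some g) →
    ∀ x, (δ.gsub σ).get (x + n) = ((σ.ctxAt g).wkSub δ.hat).get x
  | .emp g m, n, b, σ, h, x => by simp at h
  | .wk g m, n, b, σ, h, x => by simp at h; simp [h]
  | .snoc δ t, n + 1, b, σ, h, x => by
    simpa [← Nat.add_assoc] using LSub.Dom.get_gsub_add (δ := δ) σ h x

theorem LSub.Dom.check_eq : ∀ {δ : LSub} {n g : ℕ}, δ.Dom n (some g) → δ.check = some g
  | .emp g m, n, b, h => by simp at h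
  | .wk g m, n, b, h => by simp at h; simp [h]
  | .snoc δ t, n + 1, b, h => by simpa using LSub.Dom.check_eq (δ := δ) h

theorem LCtx.wkSub_comp : ∀ (Γ : LCtx) {m k : ℕ} {δ : LSub},
    (∀ x < Γ.len, δ.get (x + m) = .var (k + x)) → δ.hat = Γ.len + k → δ.check = Γ.base →
    (Γ.wkSub m).comp δ = Γ.wkSub k
  | .nil, m, k, δ, h, h', e => by simp at h' e; simp [h', e]
  | .cvar g, m, k, δ, h, h', e => by simp at h'; simp [h']
  | .snoc Γ T, m, k, δ, h, h', e => by
    have h0 := h 0 (by simp)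
    simp at h0
    simp only [LCtx.wkSub, LSub.comp, Tm.lsub, h0]
    rw [Γ.wkSub_comp (m := m + 1) (k := k + 1) _ (by simp at h'; omega) (by simpa using e)]
    intro x hx
    have := h (x + 1) (by simpa using hx)
    rw [show x + (m + 1) = x + 1 + m by omega, this]
    congr 1; omega

mutual

theorem Tm.lsub_gsub : ∀ {t : Tm} {n n' : ℕ} {b b' : Option ℕ} {δ : LSub} (σ : GSub),
    t.Sc n b → δ.Dom n b → δ.Sc n' b' → (t.lsub δ).gsub σ = (t.gsub σ).lsub (δ.gsub σ)
  | .var x, n, _, b, _, δ, σ, h, hd, hs => by simp [hd.get_gsub σ x h]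
  | .gvar u δ', n, _, b, _, δ, σ, h, hd, hs => by
    simp [LSub.comp_gsub (δ := δ') σ h hd hs, GSub.tmAt_comp]
  | .zero, n, _, b, _, δ, σ, h, hd, hs => rfl
  | .succ t, n, _, b, _, δ, σ, h, hd, hs => by simp [Tm.lsub_gsub (t := t) σ h hd hs]
  | .box t, n, _, b, _, δ, σ, h, hd, hs => rfl
  | .letbox T s t, n, _, b, _, δ, σ, h, hd, hs => by
    simp [Tm.lsub_gsub (t := s) σ h.1 hd hs, Tm.lsub_gsub (t := t) σ.q h.2 (hd.gwk (.p .id)) (hs.gwk _),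
      LSub.gsub_gwk_p]
  | .lam t, n, _, b, _, δ, σ, h, hd, hs => by
    simp [Tm.lsub_gsub (t := t) σ h hd.q hs.q, LSub.q_gsub hs]
  | .app t s, n, _, b, _, δ, σ, h, hd, hs => by
    simp [Tm.lsub_gsub (t := t) σ h.1 hd hs, Tm.lsub_gsub (t := s) σ h.2 hd hs]
  | .mlam t, n, _, b, _, δ, σ, h, hd, hs => by
    simp [Tm.lsub_gsub (t := t) σ.q h (hd.gwk (.p .id)) (hs.gwk _), LSub.gsub_gwk_p]
  | .mapp t Γ, n, _, b, _, δ, σ, h, hd, hs => by simp [Tm.lsub_gsub (t := t) σ h hd hs]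

theorem LSub.comp_gsub : ∀ {δ : LSub} {n n' : ℕ} {b b' : Option ℕ} {δ' : LSub} (σ : GSub),
    δ.Sc n b → δ'.Dom n b → δ'.Sc n' b' → (δ.comp δ').gsub σ = (δ.gsub σ).comp (δ'.gsub σ)
  | .emp none m, n, _, b, _, δ', σ, h, hd, hs => by
    simp only [LSub.comp, LSub.gsub, LSub.check_gsub, LSub.hat_gsub]
    cases δ'.check <;> simp [GSub.baseLen, Nat.add_comm]
  | .emp (some g) m, n, _, b, _, δ', σ, h, hd, hs => by
    simp at h
    obtain ⟨rfl, rfl⟩ := h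
    simp only [LSub.comp, LSub.gsub]
    cases hb : (σ.ctxAt g).base <;>
      simp [LSub.check_gsub, LSub.hat_gsub, hd.check_eq, hb, GSub.baseLen, Nat.add_comm]
  | .wk g m, n, _, b, _, δ', σ, h, hd, hs => by
    simp at h
    obtain ⟨rfl, rfl⟩ := h
    rw [LSub.comp, LSub.gsub_wk, LSub.gsub_wk]
    refine ((σ.ctxAt g).wkSub_comp (fun x hx => ?_) ?_ ?_).symm
    · rw [hd.get_gsub_add, LCtx.wkSub_get_of_lt _ _ hx]
    · simp [LSub.hat_gsub, hd.check_eq, GSub.baseLen, Nat.add_comm]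
    · simp [LSub.check_gsub, hd.check_eq]
  | .snoc δ t, n, _, b, _, δ', σ, h, hd, hs => by
    simp [LSub.comp_gsub (δ := δ) σ h.1 hd hs, Tm.lsub_gsub (t := t) σ h.2 hd hs]

end

/-! ### Well-formedness -/

theorem LWf.gwf {Ψ : GCtx} {i : Layer} {Γ : LCtx} : LWf Ψ i Γ → GWf Ψ
  | .nil h => h
  | .cvar h _ => h
  | .snoc h _ => h.gwf

theorem GWf.tail {Ψ : GCtx} {B : GBind} (h : GWf (B :: Ψ)) : GWf Ψ := by
  cases h with
  | ctx h => exact h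
  | tm h _ => exact h.gwf

theorem TWf.lift {Ψ : GCtx} {T : Typ} (i : Layer) : TWf Ψ .zero T → TWf Ψ i T
  | .nat h => .nat h
  | .arr h h' => .arr (h.lift i) (h'.lift i)

theorem LWf.lift {Ψ : GCtx} {Γ : LCtx} (i : Layer) : LWf Ψ .zero Γ → LWf Ψ i Γ
  | .nil h => .nil h
  | .cvar h h' => .cvar h h'
  | .snoc h h' => .snoc (h.lift i) (h'.lift i)

theorem LWf.get_base {Ψ : GCtx} {i : Layer} {Γ : LCtx} {g : ℕ} :
    LWf Ψ i Γ → Γ.base = some g → GCtx.get Ψ g = some .ctx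
  | .nil h, hg => by simp at hg
  | .cvar h h', hg => by simp at hg; rwa [← hg]
  | .snoc h _, hg => h.get_base (by simpa using hg)

theorem LWf.get {Ψ : GCtx} {i : Layer} {Γ : LCtx} {x : ℕ} {T : Typ} (h : LWf Ψ i Γ)
    (hx : Γ.get x = some T) : TWf Ψ i T := by
  induction x generalizing Γ with
  | zero => cases h <;> simp at hx; subst hx; assumption
  | succ x ih =>
    cases h with
    | nil h => simp at hx
    | cvar h h' => simp at hx
    | snoc h _ => exact ih h (by simpa using hx)

/-- `Ψ' ⊢ γ : Ψ` for a global weakening `γ`. -/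
structure GWkTy (Ψ' : GCtx) (γ : Wk) (Ψ : GCtx) : Prop where
  wf : GWf Ψ'
  get : ∀ {k : ℕ} {B : GBind}, GCtx.get Ψ k = some B → GCtx.get Ψ' (γ.app k) = some (B.gwk γ)

theorem GWkTy.id {Ψ : GCtx} (h : GWf Ψ) : GWkTy Ψ .id Ψ := ⟨h, fun h => by simpa using h⟩

theorem GWkTy.p {Ψ : GCtx} {B : GBind} (h : GWf (B :: Ψ)) : GWkTy (B :: Ψ) (.p .id) Ψ :=
  ⟨h, fun h => by simp [GCtx.get, h]⟩

theorem GWkTy.comp {Ψ Ψ' Ψ'' : GCtx} {γ γ' : Wk} (h : GWkTy Ψ' γ Ψ) (h' : GWkTy Ψ'' γ' Ψ') :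
    GWkTy Ψ'' (γ.comp γ') Ψ :=
  ⟨h'.wf, fun hk => by simpa [GBind.gwk_gwk] using h'.get (h.get hk)⟩

theorem GWkTy.q {Ψ Ψ' : GCtx} {γ : Wk} {B : GBind} (h : GWkTy Ψ' γ Ψ)
    (hB : GWf (B.gwk γ :: Ψ')) : GWkTy (B.gwk γ :: Ψ') (.q γ) (B :: Ψ) := by
  refine ⟨hB, fun {k C} hk => ?_⟩
  cases k with
  | zero =>
    simp only [GCtx.get, Option.some.injEq] at hk
    subst hk
    simp [GCtx.get, GBind.gwk_gwk]
  | succ k =>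
    simp only [GCtx.get, Option.map_eq_some_iff] at hk
    obtain ⟨D, hD, rfl⟩ := hk
    simp [GCtx.get, h.get hD, GBind.gwk_gwk]

theorem GWkTy.qCtx {Ψ Ψ' : GCtx} {γ : Wk} (h : GWkTy Ψ' γ Ψ) :
    GWkTy (.ctx :: Ψ') (.q γ) (.ctx :: Ψ) :=
  h.q (B := .ctx) (.ctx h.wf)

theorem TWf.gwk {Ψ : GCtx} {i : Layer} {T : Typ} (h : TWf Ψ i T) {Ψ' : GCtx} {γ : Wk}
    (hγ : GWkTy Ψ' γ Ψ) : TWf Ψ' i (T.gwk γ) := by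
  refine TWf.rec (motive_1 := fun _ _ => True)
    (motive_2 := fun Ψ i Γ _ => ∀ {Ψ' γ}, GWkTy Ψ' γ Ψ → LWf Ψ' i (Γ.gwk γ))
    (motive_3 := fun Ψ i T _ => ∀ {Ψ' γ}, GWkTy Ψ' γ Ψ → TWf Ψ' i (T.gwk γ))
    ?_ ?_ ?_ ?_ ?_ ?_ ?_ ?_ ?_ ?_ h hγ
  · trivial
  · intros; trivial
  · intros; trivial
  · intro _ _ _ _ _ _ hγ; exact .nil hγ.wf
  · intro _ _ _ _ hg _ _ _ hγ; exact .cvar hγ.wf (hγ.get hg)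
  · intro _ _ _ _ _ _ ih ih' _ _ hγ; exact .snoc (ih hγ) (ih' hγ)
  · intro _ _ _ _ _ _ hγ; exact .nat hγ.wf
  · intro _ _ _ _ _ _ ih ih' _ _ hγ; exact .arr (ih hγ) (ih' hγ)
  · intro _ _ _ _ _ ih ih' _ _ hγ; exact .box (ih hγ) (ih' hγ)
  · intro _ _ _ ih _ _ hγ; exact .mfun (ih hγ.qCtx)

theorem LWf.gwk {Ψ Ψ' : GCtx} {i : Layer} {Γ : LCtx} {γ : Wk} :
    LWf Ψ i Γ → GWkTy Ψ' γ Ψ → LWf Ψ' i (Γ.gwk γ)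
  | .nil h, hγ => .nil hγ.wf
  | .cvar h hg, hγ => .cvar hγ.wf (hγ.get hg)
  | .snoc h h', hγ => .snoc (h.gwk hγ) (h'.gwk hγ)

theorem GWkTy.qTm {Ψ Ψ' : GCtx} {γ : Wk} {Δ : LCtx} {T : Typ} (h : GWkTy Ψ' γ Ψ)
    (hΔ : LWf Ψ .zero Δ) (hT : TWf Ψ .zero T) :
    GWkTy (.tm (Δ.gwk γ) (T.gwk γ) :: Ψ') (.q γ) (.tm Δ T :: Ψ) :=
  h.q (B := .tm Δ T) (.tm (hΔ.gwk h) (hT.gwk h))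

theorem GWf.get_tm {Ψ : GCtx} (h : GWf Ψ) {u : ℕ} {Δ : LCtx} {T : Typ}
    (hu : GCtx.get Ψ u = some (.tm Δ T)) : LWf Ψ .zero Δ ∧ TWf Ψ .zero T := by
  induction Ψ generalizing u Δ T with
  | nil => simp [GCtx.get] at hu
  | cons B Ψ ih =>
    have hp := GWkTy.p h
    cases u with
    | zero =>
      simp only [GCtx.get, Option.some.injEq] at hu
      cases h with
      | ctx h => simp at hu
      | tm h h' =>
        simp at hu
        obtain ⟨rfl, rfl⟩ := hu
        exact ⟨h.gwk hp, h'.gwk hp⟩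
    | succ u =>
      simp only [GCtx.get, Option.map_eq_some_iff] at hu
      obtain ⟨D, hD, hu⟩ := hu
      cases D with
      | ctx => simp at hu
      | tm Δ' T' =>
        simp at hu
        obtain ⟨rfl, rfl⟩ := hu
        obtain ⟨h₁, h₂⟩ := ih h.tail hD
        exact ⟨h₁.gwk hp, h₂.gwk hp⟩

/-- `Γ' ⊢ τ : Γ` for a local weakening `τ`. -/
structure LWkTy (Γ' : LCtx) (τ : Wk) (Γ : LCtx) : Prop where
  get : ∀ x, Γ'.get (τ.app x) = Γ.get x
  len : Γ'.len = Γ.len + τ.numP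
  base : Γ'.base = Γ.base
  tail : ∀ x ≥ Γ.len, τ.app x = x + τ.numP

theorem LWkTy.id (Γ : LCtx) : LWkTy Γ .id Γ := ⟨by simp, by simp, rfl, by simp⟩

theorem LWkTy.p {Γ Γ' : LCtx} {τ : Wk} (h : LWkTy Γ' τ Γ) (T : Typ) :
    LWkTy (Γ'.snoc T) (.p τ) Γ :=
  ⟨by simp [h.get], by simp [h.len]; omega, by simp [h.base],
    fun x hx => by simp [h.tail x hx]; omega⟩

theorem LWkTy.q {Γ Γ' : LCtx} {τ : Wk} (h : LWkTy Γ' τ Γ) (T : Typ) :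
    LWkTy (Γ'.snoc T) (.q τ) (Γ.snoc T) := by
  refine ⟨fun x => ?_, by simp [h.len]; omega, by simp [h.base], fun x hx => ?_⟩
  · cases x <;> simp [h.get]
  · cases x with
    | zero => simp at hx
    | succ x => simp [h.tail x (by simpa using hx)]; omega

theorem LWkTy.comp {Γ Γ' Γ'' : LCtx} {τ τ' : Wk} (h : LWkTy Γ' τ Γ) (h' : LWkTy Γ'' τ' Γ') :
    LWkTy Γ'' (τ.comp τ') Γ :=
  ⟨by simp [h.get, h'.get], by simp [h.len, h'.len]; omega, by rw [h'.base, h.base],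
    fun x hx => by
      simp only [Wk.app_comp, Wk.numP_comp]
      rw [h.tail x hx, h'.tail _ (by have := h.len; omega)]; omega⟩

theorem LWkTy.gwk {Γ Γ' : LCtx} {τ : Wk} (h : LWkTy Γ' τ Γ) (γ : Wk) :
    LWkTy (Γ'.gwk γ) τ (Γ.gwk γ) :=
  ⟨by simp [h.get], by simp [h.len], by simp [h.base], fun x hx => h.tail x (by simpa using hx)⟩

theorem LWkTy.gwk_comp {Γ Γ' : LCtx} {τ γ : Wk} (h : LWkTy Γ' τ (Γ.gwk γ)) (γ' : Wk) :
    LWkTy (Γ'.gwk γ') τ (Γ.gwk (γ.comp γ')) := by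
  rw [← LCtx.gwk_gwk]
  exact h.gwk γ'

theorem LWkTy.gwk_p {Γ Γ' : LCtx} {τ γ : Wk} (h : LWkTy Γ' τ (Γ.gwk γ)) :
    LWkTy (Γ'.gwk (.p .id)) τ ((Γ.gwk (.p .id)).gwk (.q γ)) := by
  have := h.gwk (.p .id)
  rw [LCtx.gwk_gwk] at this ⊢
  simpa using this

theorem Typ.gwk_p_gwk_q (T : Typ) (γ : Wk) :
    (T.gwk (.p .id)).gwk (.q γ) = (T.gwk γ).gwk (.p .id) := by
  simp [Typ.gwk_gwk]

/-! ### Weakening of typing -/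

mutual

theorem HasTy.lwf {Ψ : GCtx} {Γ : LCtx} {i : Layer} {t : Tm} {T : Typ} :
    HasTy Ψ Γ i t T → LWf Ψ i Γ
  | .var h _ => h
  | .gvar h _ => h.lwf
  | .zero h => h
  | .succ h => h.lwf
  | .lam h => by cases h.lwf; assumption
  | .app h _ => h.lwf
  | .box h _ => h
  | .letbox h _ _ _ _ => h.lwf
  | .mlam h _ => h
  | .mapp h _ => h.lwf

theorem SubTy.lwf {Ψ : GCtx} {Γ Δ : LCtx} {i : Layer} {δ : LSub} :
    SubTy Ψ Γ i δ Δ → LWf Ψ i Γ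
  | .emp h _ _ => h
  | .empCtx h _ _ _ => h
  | .wk h _ _ _ => h
  | .snoc h _ => h.lwf

end

theorem HasTy.twf_dom {Ψ : GCtx} {Γ : LCtx} {i : Layer} {t : Tm} {S T : Typ}
    (h : HasTy Ψ (Γ.snoc S) i t T) : TWf Ψ i S := by
  cases h.lwf; assumption

mutual

theorem HasTy.sc {Ψ : GCtx} {Γ : LCtx} {i : Layer} {t : Tm} {T : Typ} :
    HasTy Ψ Γ i t T → t.Sc Γ.len Γ.base
  | .var _ h => LCtx.lt_len_of_get h
  | .gvar h _ => h.sc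
  | .zero h => trivial
  | .succ h => h.sc
  | .lam h => h.sc
  | .app h h' => ⟨h.sc, h'.sc⟩
  | .box h _ => trivial
  | .letbox h _ _ _ h' => ⟨h.sc, by simpa using h'.sc⟩
  | .mlam _ h => by simpa using h.sc
  | .mapp h _ => h.sc

theorem SubTy.sc {Ψ : GCtx} {Γ Δ : LCtx} {i : Layer} {δ : LSub} :
    SubTy Ψ Γ i δ Δ → δ.Sc Γ.len Γ.base
  | .emp _ h h' => ⟨h'.symm, h⟩
  | .empCtx _ _ h h' => ⟨h'.symm, h⟩
  | .wk _ _ h h' => ⟨h'.symm, h⟩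
  | .snoc h h' => ⟨h.sc, h'.sc⟩

end

theorem SubTy.dom {Ψ : GCtx} {Γ Δ : LCtx} {i : Layer} {δ : LSub} :
    SubTy Ψ Γ i δ Δ → δ.Dom Δ.len Δ.base
  | .emp _ _ _ => by simp
  | .empCtx _ _ _ _ => by simp
  | .wk _ _ _ _ => by simp
  | .snoc h _ => h.dom

theorem SubTy.hat {Ψ : GCtx} {Γ Δ : LCtx} {i : Layer} {δ : LSub} :
    SubTy Ψ Γ i δ Δ → δ.hat = Γ.len
  | .emp _ _ _ => by simp [*]
  | .empCtx _ _ _ _ => by simp [*]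
  | .wk _ _ _ _ => by simp [*]
  | .snoc h _ => h.hat

theorem SubTy.check {Ψ : GCtx} {Γ Δ : LCtx} {i : Layer} {δ : LSub} :
    SubTy Ψ Γ i δ Δ → δ.check = Γ.base
  | .emp _ _ _ => by simp [*]
  | .empCtx _ _ _ _ => by simp [*]
  | .wk _ _ _ _ => by simp [*]
  | .snoc h _ => h.check

theorem SubTy.base {Ψ : GCtx} {Γ Δ : LCtx} {i : Layer} {δ : LSub} {g : ℕ}
    (h : SubTy Ψ Γ i δ Δ) (hg : Δ.base = some g) : Γ.base = some g := by
  rw [← h.check, LSub.Dom.check_eq (hg ▸ h.dom)]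

theorem SubTy.get {Ψ : GCtx} {Γ Δ : LCtx} {i : Layer} {δ : LSub} {x : ℕ} {T : Typ}
    (h : SubTy Ψ Γ i δ Δ) (hx : Δ.get x = some T) : HasTy Ψ Γ i (δ.get x) T := by
  induction x generalizing δ Δ with
  | zero => cases h <;> simp at hx; subst hx; simpa
  | succ x ih =>
    cases h with
    | snoc h _ => exact ih h (by simpa using hx)
    | _ => simp at hx

mutual

theorem HasTy.weaken {Ψ : GCtx} {Γ : LCtx} {i : Layer} {t : Tm} {T : Typ} :
    HasTy Ψ Γ i t T → ∀ {Ψ' : GCtx} {Γ' : LCtx} {γ τ : Wk}, GWkTy Ψ' γ Ψ →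
      LWkTy Γ' τ (Γ.gwk γ) → LWf Ψ' i Γ' → HasTy Ψ' Γ' i ((t.gwk γ).lwk τ) (T.gwk γ)
  | .var _ h, _, _, _, _, hγ, hτ, hΓ => .var hΓ (by simp [hτ.get, h])
  | .gvar h hu, _, _, _, _, hγ, hτ, hΓ => .gvar (h.weaken hγ hτ hΓ) (hγ.get hu)
  | .zero h, _, _, _, _, hγ, hτ, hΓ => .zero hΓ
  | .succ h, _, _, _, _, hγ, hτ, hΓ => .succ (h.weaken hγ hτ hΓ)
  | .lam h, _, _, _, _, hγ, hτ, hΓ =>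
    .lam (h.weaken hγ (hτ.q _) (.snoc hΓ (h.twf_dom.gwk hγ)))
  | .app h h', _, _, _, _, hγ, hτ, hΓ => .app (h.weaken hγ hτ hΓ) (h'.weaken hγ hτ hΓ)
  | .box _ h, _, _, _, _, hγ, hτ, hΓ =>
    .box hΓ (by simpa using h.weaken hγ (LWkTy.id _) (h.lwf.gwk hγ))
  | .letbox h hΔ hT hT' h', _, _, γ, _, hγ, hτ, hΓ => by
    have := h'.weaken (hγ.qTm hΔ hT) hτ.gwk_p (hΓ.gwk (.p (.tm (hΔ.gwk hγ) (hT.gwk hγ))))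
    rw [Typ.gwk_p_gwk_q] at this
    exact .letbox (h.weaken hγ hτ hΓ) (hΔ.gwk hγ) (hT.gwk hγ) (hT'.gwk hγ) this
  | .mlam _ h, _, _, _, _, hγ, hτ, hΓ =>
    .mlam hΓ (h.weaken hγ.qCtx hτ.gwk_p (hΓ.gwk (.p (.ctx hγ.wf))))
  | .mapp h hΔ, _, _, _, _, hγ, hτ, hΓ => by
    rw [Typ.inst_gwk]
    exact .mapp (h.weaken hγ hτ hΓ) (hΔ.gwk hγ)

theorem SubTy.weaken {Ψ : GCtx} {Γ Δ : LCtx} {i : Layer} {δ : LSub} :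
    SubTy Ψ Γ i δ Δ → ∀ {Ψ' : GCtx} {Γ' : LCtx} {γ τ : Wk}, GWkTy Ψ' γ Ψ →
      LWkTy Γ' τ (Γ.gwk γ) → LWf Ψ' i Γ' → SubTy Ψ' Γ' i ((δ.gwk γ).lwk τ) (Δ.gwk γ)
  | .emp _ h h', _, _, _, _, hγ, hτ, hΓ =>
    .emp hΓ (by simp [hτ.base, h]) (by simp [hτ.len, h'])
  | .empCtx _ hg h h', _, _, _, _, hγ, hτ, hΓ =>
    .empCtx hΓ (hγ.get hg) (by simp [hτ.base, h]) (by simp [hτ.len, h'])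
  | .wk _ hg h h', _, _, _, _, hγ, hτ, hΓ =>
    .wk hΓ (hγ.get hg) (by simp [hτ.base, h]) (by simp [hτ.len, h'])
  | .snoc h h', _, _, _, _, hγ, hτ, hΓ => .snoc (h.weaken hγ hτ hΓ) (h'.weaken hγ hτ hΓ)

end

theorem HasTy.gwk {Ψ Ψ' : GCtx} {Γ : LCtx} {i : Layer} {t : Tm} {T : Typ} {γ : Wk}
    (h : HasTy Ψ Γ i t T) (hγ : GWkTy Ψ' γ Ψ) : HasTy Ψ' (Γ.gwk γ) i (t.gwk γ) (T.gwk γ) := by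
  simpa using h.weaken hγ (LWkTy.id _) (h.lwf.gwk hγ)

theorem HasTy.lwk {Ψ : GCtx} {Γ Γ' : LCtx} {i : Layer} {t : Tm} {T : Typ} {τ : Wk}
    (h : HasTy Ψ Γ i t T) (hτ : LWkTy Γ' τ Γ) (hΓ : LWf Ψ i Γ') :
    HasTy Ψ Γ' i (t.lwk τ) T := by
  simpa using h.weaken (GWkTy.id hΓ.gwf) (by simpa using hτ) hΓ

theorem SubTy.gwk {Ψ Ψ' : GCtx} {Γ Δ : LCtx} {i : Layer} {δ : LSub} {γ : Wk}
    (h : SubTy Ψ Γ i δ Δ) (hγ : GWkTy Ψ' γ Ψ) :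
    SubTy Ψ' (Γ.gwk γ) i (δ.gwk γ) (Δ.gwk γ) := by
  simpa using h.weaken hγ (LWkTy.id _) (h.lwf.gwk hγ)

theorem SubTy.lwk {Ψ : GCtx} {Γ Γ' Δ : LCtx} {i : Layer} {δ : LSub} {τ : Wk}
    (h : SubTy Ψ Γ i δ Δ) (hτ : LWkTy Γ' τ Γ) (hΓ : LWf Ψ i Γ') :
    SubTy Ψ Γ' i (δ.lwk τ) Δ := by
  simpa using h.weaken (GWkTy.id hΓ.gwf) (by simpa using hτ) hΓ

theorem SubTy.q {Ψ : GCtx} {Γ Δ : LCtx} {i : Layer} {δ : LSub} {S : Typ}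
    (h : SubTy Ψ Γ i δ Δ) (hS : TWf Ψ i S) : SubTy Ψ (Γ.snoc S) i δ.q (Δ.snoc S) :=
  have hΓ : LWf Ψ i (Γ.snoc S) := .snoc h.lwf hS
  .snoc (h.lwk ((LWkTy.id _).p S) hΓ) (.var hΓ (by simp))

theorem SubTy.idSub {Ψ : GCtx} {Γ : LCtx} {i : Layer} : LWf Ψ i Γ → SubTy Ψ Γ i Γ.idSub Γ
  | .nil h => .emp (.nil h) rfl rfl
  | .cvar h h' => .wk (.cvar h h') h' rfl rfl
  | .snoc h h' => by rw [← LCtx.idSub_q]; exact (SubTy.idSub h).q h'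

mutual

theorem HasTy.lift {Ψ : GCtx} {Γ : LCtx} {t : Tm} {T : Typ} (i : Layer) :
    HasTy Ψ Γ .zero t T → HasTy Ψ Γ i t T
  | .var h h' => .var (h.lift i) h'
  | .gvar h h' => .gvar (h.lift i) h'
  | .zero h => .zero (h.lift i)
  | .succ h => .succ (h.lift i)
  | .lam h => .lam (h.lift i)
  | .app h h' => .app (h.lift i) (h'.lift i)

theorem SubTy.lift {Ψ : GCtx} {Γ Δ : LCtx} {δ : LSub} (i : Layer) :
    SubTy Ψ Γ .zero δ Δ → SubTy Ψ Γ i δ Δ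
  | .emp h h' h'' => .emp (h.lift i) h' h''
  | .empCtx h h' h'' h''' => .empCtx (h.lift i) h' h'' h'''
  | .wk h h' h'' h''' => .wk (h.lift i) h' h'' h'''
  | .snoc h h' => .snoc (h.lift i) (h'.lift i)

end

/-! ### Local substitution preserves typing -/

theorem SubTy.nil {Ψ : GCtx} {Γ : LCtx} {i : Layer} (h : LWf Ψ i Γ) :
    SubTy Ψ Γ i (.emp Γ.base Γ.len) .nil := by
  cases hg : Γ.base with
  | none => exact .emp h hg rfl
  | some g => exact .empCtx h (h.get_base hg) hg rfl

mutual

theorem HasTy.lsub {Ψ : GCtx} {Γ Γ' : LCtx} {i : Layer} {t : Tm} {T : Typ} {δ : LSub} :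
    HasTy Ψ Γ i t T → SubTy Ψ Γ' i δ Γ → HasTy Ψ Γ' i (t.lsub δ) T
  | .var _ h, hδ => hδ.get h
  | .gvar h hu, hδ => .gvar (h.comp hδ) hu
  | .zero h, hδ => .zero hδ.lwf
  | .succ h, hδ => .succ (h.lsub hδ)
  | .lam h, hδ => .lam (h.lsub (hδ.q h.twf_dom))
  | .app h h', hδ => .app (h.lsub hδ) (h'.lsub hδ)
  | .box _ h, hδ => .box hδ.lwf h
  | .letbox h hΔ hT hT' h', hδ =>
    .letbox (h.lsub hδ) hΔ hT hT' (h'.lsub (hδ.gwk (.p (.tm hΔ hT))))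
  | .mlam _ h, hδ => .mlam hδ.lwf (h.lsub (hδ.gwk (.p h.lwf.gwf)))
  | .mapp h hΔ, hδ => .mapp (h.lsub hδ) hΔ

theorem SubTy.comp {Ψ : GCtx} {Γ Γ' Δ : LCtx} {i : Layer} {δ' δ : LSub} :
    SubTy Ψ Γ i δ' Δ → SubTy Ψ Γ' i δ Γ → SubTy Ψ Γ' i (δ'.comp δ) Δ
  | .emp _ h h', hδ => by
    rw [LSub.comp, hδ.check, hδ.hat]
    exact .nil hδ.lwf
  | .empCtx _ hg h h', hδ => .empCtx hδ.lwf hg (hδ.base h) hδ.hat.symm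
  | .wk _ hg h h', hδ => .wk hδ.lwf hg (hδ.base h) hδ.hat.symm
  | .snoc h h', hδ => .snoc (h.comp hδ) (h'.lsub hδ)

end

/-! ### Global substitution preserves typing -/

/-- An entry that may replace a global variable `u : (Δ ⊢ T)`. -/
inductive GEntTy : GCtx → GEnt → LCtx → Typ → Prop
  | var {Ψ : GCtx} {k : ℕ} {Δ : LCtx} {T : Typ} :
      GCtx.get Ψ k = some (.tm Δ T) → GEntTy Ψ (.var k) Δ T
  | tm {Ψ : GCtx} {Δ : LCtx} {t : Tm} {T : Typ} : HasTy Ψ Δ .zero t T → GEntTy Ψ (.tm t) Δ T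

/-- `Ψ' ⊢ σ : Ψ` for a global substitution `σ`. -/
structure GSubTy (Ψ' : GCtx) (σ : GSub) (Ψ : GCtx) : Prop where
  wf : GWf Ψ'
  ctx : ∀ {g : ℕ}, GCtx.get Ψ g = some .ctx → LWf Ψ' .zero (σ.ctxAt g)
  tm : ∀ {u : ℕ} {Δ : LCtx} {T : Typ}, GCtx.get Ψ u = some (.tm Δ T) →
    GEntTy Ψ' (σ u) (Δ.gsub σ) (T.gsub σ)

theorem GEntTy.gwk {Ψ Ψ' : GCtx} {e : GEnt} {Δ : LCtx} {T : Typ} {γ : Wk}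
    (h : GEntTy Ψ e Δ T) (hγ : GWkTy Ψ' γ Ψ) : GEntTy Ψ' (e.gwk γ) (Δ.gwk γ) (T.gwk γ) := by
  cases h with
  | var h => exact .var (hγ.get h)
  | tm h => exact .tm (h.gwk hγ)

theorem GSubTy.gwk {Ψ Ψ' Ψ'' : GCtx} {σ : GSub} {γ : Wk} (h : GSubTy Ψ' σ Ψ)
    (hγ : GWkTy Ψ'' γ Ψ') : GSubTy Ψ'' (σ.gwk γ) Ψ :=
  ⟨hγ.wf, fun hg => by rw [GSub.ctxAt_gwk]; exact (h.ctx hg).gwk hγ,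
    fun hu => by rw [← LCtx.gsub_gwk, ← Typ.gsub_gwk]; exact (h.tm hu).gwk hγ⟩

theorem GSubTy.id {Ψ : GCtx} (h : GWf Ψ) : GSubTy Ψ .id Ψ :=
  ⟨h, fun hg => .cvar h hg, fun hu => by simpa using .var hu⟩

theorem GSubTy.ren {Ψ Ψ' : GCtx} {γ : Wk} (h : GWkTy Ψ' γ Ψ) : GSubTy Ψ' (.ren γ) Ψ :=
  ⟨h.wf, fun hg => .cvar h.wf (h.get hg), fun hu => by
    rw [LCtx.gsub_ren, Typ.gsub_ren]; exact .var (h.get hu)⟩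

theorem GSubTy.snocCtx {Ψ Ψ' : GCtx} {σ : GSub} {e : GEnt} (h : GSubTy Ψ' σ Ψ)
    (he : LWf Ψ' .zero ((σ.snoc e).ctxAt 0)) : GSubTy Ψ' (σ.snoc e) (.ctx :: Ψ) := by
  refine ⟨h.wf, fun {g} hg => ?_, fun {u Δ T} hu => ?_⟩
  · cases g with
    | zero => exact he
    | succ g =>
      simp only [GCtx.get, Option.map_eq_some_iff] at hg
      obtain ⟨D, hD, hu⟩ := hg
      cases D with
      | ctx => exact h.ctx hD
      | tm Δ' T' => simp at hu
  · cases u with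
    | zero => simp [GCtx.get] at hu
    | succ u =>
      simp only [GCtx.get, Option.map_eq_some_iff] at hu
      obtain ⟨D, hD, hu⟩ := hu
      cases D with
      | ctx => simp at hu
      | tm Δ' T' =>
        simp at hu
        obtain ⟨rfl, rfl⟩ := hu
        simpa using h.tm hD

theorem GSubTy.snocTm {Ψ Ψ' : GCtx} {σ : GSub} {e : GEnt} {Δ : LCtx} {T : Typ}
    (h : GSubTy Ψ' σ Ψ) (he : GEntTy Ψ' e (Δ.gsub σ) (T.gsub σ)) :
    GSubTy Ψ' (σ.snoc e) (.tm Δ T :: Ψ) := by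
  refine ⟨h.wf, fun {g} hg => ?_, fun {u Δ T} hu => ?_⟩
  · cases g with
    | zero => simp [GCtx.get] at hg
    | succ g =>
      simp only [GCtx.get, Option.map_eq_some_iff] at hg
      obtain ⟨D, hD, hu⟩ := hg
      cases D with
      | ctx => exact h.ctx hD
      | tm Δ' T' => simp at hu
  · cases u with
    | zero =>
      simp [GCtx.get] at hu
      obtain ⟨rfl, rfl⟩ := hu
      simpa using he
    | succ u =>
      simp only [GCtx.get, Option.map_eq_some_iff] at hu
      obtain ⟨D, hD, hu⟩ := hu
      cases D with
      | ctx => simp at hu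
      | tm Δ' T' =>
        simp at hu
        obtain ⟨rfl, rfl⟩ := hu
        simpa using h.tm hD

theorem GSubTy.qCtx {Ψ Ψ' : GCtx} {σ : GSub} (h : GSubTy Ψ' σ Ψ) :
    GSubTy (.ctx :: Ψ') σ.q (.ctx :: Ψ) :=
  have hw : GWf (.ctx :: Ψ') := .ctx h.wf
  GSubTy.snocCtx (h.gwk (.p hw)) (.cvar hw rfl)

theorem TWf.gsub {Ψ : GCtx} {i : Layer} {T : Typ} (h : TWf Ψ i T) {Ψ' : GCtx} {σ : GSub}
    (hσ : GSubTy Ψ' σ Ψ) : TWf Ψ' i (T.gsub σ) := by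
  refine TWf.rec (motive_1 := fun _ _ => True)
    (motive_2 := fun Ψ i Γ _ => ∀ {Ψ' σ}, GSubTy Ψ' σ Ψ → LWf Ψ' i (Γ.gsub σ))
    (motive_3 := fun Ψ i T _ => ∀ {Ψ' σ}, GSubTy Ψ' σ Ψ → TWf Ψ' i (T.gsub σ))
    ?_ ?_ ?_ ?_ ?_ ?_ ?_ ?_ ?_ ?_ h hσ
  · trivial
  · intros; trivial
  · intros; trivial
  · intro _ _ _ _ _ _ hσ; exact .nil hσ.wf
  · intro _ _ _ _ hg _ _ _ hσ; exact (hσ.ctx hg).lift _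
  · intro _ _ _ _ _ _ ih ih' _ _ hσ; exact .snoc (ih hσ) (ih' hσ)
  · intro _ _ _ _ _ _ hσ; exact .nat hσ.wf
  · intro _ _ _ _ _ _ ih ih' _ _ hσ; exact .arr (ih hσ) (ih' hσ)
  · intro _ _ _ _ _ ih ih' _ _ hσ; exact .box (ih hσ) (ih' hσ)
  · intro _ _ _ ih _ _ hσ; exact .mfun (ih hσ.qCtx)

theorem LWf.gsub {Ψ Ψ' : GCtx} {i : Layer} {Γ : LCtx} {σ : GSub} :
    LWf Ψ i Γ → GSubTy Ψ' σ Ψ → LWf Ψ' i (Γ.gsub σ)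
  | .nil h, hσ => .nil hσ.wf
  | .cvar h hg, hσ => (hσ.ctx hg).lift _
  | .snoc h h', hσ => .snoc (h.gsub hσ) (h'.gsub hσ)

theorem GSubTy.qTm {Ψ Ψ' : GCtx} {σ : GSub} {Δ : LCtx} {T : Typ} (h : GSubTy Ψ' σ Ψ)
    (hΔ : LWf Ψ .zero Δ) (hT : TWf Ψ .zero T) :
    GSubTy (.tm (Δ.gsub σ) (T.gsub σ) :: Ψ') σ.q (.tm Δ T :: Ψ) := by
  have hw : GWf (.tm (Δ.gsub σ) (T.gsub σ) :: Ψ') := .tm (hΔ.gsub h) (hT.gsub h)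
  refine GSubTy.snocTm (h.gwk (.p hw)) (.var ?_)
  change _ = some (GBind.tm (Δ.gsub (σ.gwk (.p .id))) (T.gsub (σ.gwk (.p .id))))
  rw [← LCtx.gsub_gwk, ← Typ.gsub_gwk]
  rfl

theorem GSubTy.instCtx {Ψ : GCtx} {Δ : LCtx} (h : LWf Ψ .zero Δ) :
    GSubTy Ψ (GSub.id.snoc (.ctx Δ)) (.ctx :: Ψ) :=
  (GSubTy.id h.gwf).snocCtx h

theorem GSubTy.instTm {Ψ : GCtx} {Δ : LCtx} {s : Tm} {T : Typ} (h : HasTy Ψ Δ .zero s T) :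
    GSubTy Ψ (GSub.id.snoc (.tm s)) (.tm Δ T :: Ψ) :=
  (GSubTy.id h.lwf.gwf).snocTm (by simpa using .tm h)

theorem LWkTy.gsub_base {Γ : LCtx} {g : ℕ} (h : Γ.base = some g) (σ : GSub) :
    LWkTy (Γ.gsub σ) (.pn Γ.len) (σ.ctxAt g) :=
  ⟨fun x => by simpa using LCtx.get_gsub_add σ x h,
    by simp [LCtx.len_gsub, h, GSub.baseLen]; omega, by simp [LCtx.base_gsub, h], by simp⟩

mutual

theorem HasTy.gsub {Ψ : GCtx} {Γ : LCtx} {i : Layer} {t : Tm} {T : Typ} :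
    HasTy Ψ Γ i t T → ∀ {Ψ' : GCtx} {σ : GSub}, GSubTy Ψ' σ Ψ →
      HasTy Ψ' (Γ.gsub σ) i (t.gsub σ) (T.gsub σ)
  | .var h h', _, _, hσ => .var (h.gsub hσ) (LCtx.get_gsub _ h')
  | .gvar (u := u) h hu, _, σ, hσ => by
    have h' := h.gsub hσ
    have hu' := hσ.tm hu
    rw [Tm.gsub, GSub.tmAt]
    generalize σ u = e at hu'
    cases hu' with
    | var hk => exact .gvar h' hk
    | tm ht => exact (ht.lift i).lsub h'
  | .zero h, _, _, hσ => .zero (h.gsub hσ)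
  | .succ h, _, _, hσ => .succ (h.gsub hσ)
  | .lam h, _, _, hσ => .lam (h.gsub hσ)
  | .app h h', _, _, hσ => .app (h.gsub hσ) (h'.gsub hσ)
  | .box h h', _, _, hσ => .box (h.gsub hσ) (h'.gsub hσ)
  | .letbox h hΔ hT hT' h', _, σ, hσ => by
    have := h'.gsub (hσ.qTm hΔ hT)
    rw [Typ.gsub_gwk_p, LCtx.gsub_gwk_p] at this
    exact .letbox (h.gsub hσ) (hΔ.gsub hσ) (hT.gsub hσ) (hT'.gsub hσ) this
  | .mlam h h', _, σ, hσ => by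
    have := h'.gsub hσ.qCtx
    rw [LCtx.gsub_gwk_p] at this
    exact .mlam (h.gsub hσ) this
  | .mapp h hΔ, _, _, hσ => by
    rw [Typ.inst_gsub]
    exact .mapp (h.gsub hσ) (hΔ.gsub hσ)

theorem SubTy.gsub {Ψ : GCtx} {Γ Δ : LCtx} {i : Layer} {δ : LSub} :
    SubTy Ψ Γ i δ Δ → ∀ {Ψ' : GCtx} {σ : GSub}, GSubTy Ψ' σ Ψ →
      SubTy Ψ' (Γ.gsub σ) i (δ.gsub σ) (Δ.gsub σ)
  | .emp h hb hm, _, σ, hσ => by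
    rw [LSub.gsub_emp_none]
    exact .emp (h.gsub hσ) (by simp [LCtx.base_gsub, hb])
      (by simp [LCtx.len_gsub, hb, hm, GSub.baseLen])
  | .empCtx h hg hb hm, _, σ, hσ => by
    have := SubTy.nil (h.gsub hσ)
    rw [LCtx.base_gsub, LCtx.len_gsub, hb, hm, Nat.add_comm] at this
    rw [LSub.gsub_emp_some]
    exact this
  | .wk h hg hb hm, _, σ, hσ => by
    rw [LSub.gsub, ← hm]
    exact (SubTy.idSub ((hσ.ctx hg).lift i)).lwk (LWkTy.gsub_base hb σ) (h.gsub hσ)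
  | .snoc h h', _, σ, hσ => by
    rw [LSub.gsub_snoc]
    exact .snoc (h.gsub hσ) (h'.gsub hσ)

end

theorem LCtx.wkSub_gsub : ∀ (Γ : LCtx) (m : ℕ) (σ : GSub),
    (Γ.wkSub m).gsub σ = (Γ.gsub σ).wkSub m
  | .nil, _, _ => by simp
  | .cvar g, _, _ => by simp
  | .snoc Γ T, m, σ => by simp [Γ.wkSub_gsub]

mutual

theorem HasTy.gsub_gsub {Ψ : GCtx} {Γ : LCtx} {i : Layer} {t : Tm} {T : Typ} :
    HasTy Ψ Γ i t T → ∀ {Ψ' : GCtx} {σ : GSub} (ρ : GSub), GSubTy Ψ' σ Ψ →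
      (t.gsub σ).gsub ρ = t.gsub (σ.comp ρ)
  | .var h h', _, _, _, hσ => rfl
  | .gvar (u := u) h hu, _, σ, ρ, hσ => by
    have hu' := hσ.tm hu
    have h' := h.gsub hσ
    rw [Tm.gsub, Tm.gsub, ← h.gsub_gsub ρ hσ]
    simp only [GSub.tmAt, GSub.comp]
    cases hk : σ u with
    | var k => simp [GSub.tmAt]
    | ctx Γ => simp
    | tm t =>
      rw [hk] at hu'
      cases hu' with
      | tm ht => exact Tm.lsub_gsub ρ ht.sc h'.dom h'.sc
  | .zero h, _, _, _, hσ => rfl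
  | .succ h, _, _, ρ, hσ => by simp [h.gsub_gsub ρ hσ]
  | .lam h, _, _, ρ, hσ => by simp [h.gsub_gsub ρ hσ]
  | .app h h', _, _, ρ, hσ => by simp [h.gsub_gsub ρ hσ, h'.gsub_gsub ρ hσ]
  | .box h h', _, _, ρ, hσ => by simp [h'.gsub_gsub ρ hσ]
  | .letbox h hΔ hT hT' h', _, σ, ρ, hσ => by
    simp [h.gsub_gsub ρ hσ, h'.gsub_gsub ρ.q (hσ.qTm hΔ hT), Typ.gsub_gsub, GSub.q_comp_q]
  | .mlam h h', _, σ, ρ, hσ => by simp [h'.gsub_gsub ρ.q hσ.qCtx, GSub.q_comp_q]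
  | .mapp h hΔ, _, _, ρ, hσ => by simp [h.gsub_gsub ρ hσ, LCtx.gsub_gsub]

theorem SubTy.gsub_gsub {Ψ : GCtx} {Γ Δ : LCtx} {i : Layer} {δ : LSub} :
    SubTy Ψ Γ i δ Δ → ∀ {Ψ' : GCtx} {σ : GSub} (ρ : GSub), GSubTy Ψ' σ Ψ →
      (δ.gsub σ).gsub ρ = δ.gsub (σ.comp ρ)
  | .emp h hb hm, _, σ, ρ, hσ => by simp
  | .empCtx (g := g) h hg hb hm, _, σ, ρ, hσ => by
    simp only [LSub.gsub_emp_some, GSub.ctxAt_comp, LCtx.base_gsub, LCtx.len_gsub]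
    cases (σ.ctxAt g).base <;> simp [GSub.baseLen]; omega
  | .wk h hg hb hm, _, σ, ρ, hσ => by simp [LCtx.wkSub_gsub, GSub.ctxAt_comp]
  | .snoc h h', _, σ, ρ, hσ => by simp [h.gsub_gsub ρ hσ, h'.gsub_gsub ρ hσ]

end

theorem TWf.inst {Ψ : GCtx} {i : Layer} {T : Typ} {Δ : LCtx} (h : TWf (.ctx :: Ψ) i T)
    (hΔ : LWf Ψ .zero Δ) : TWf Ψ i (T.inst Δ) :=
  h.gsub (GSubTy.instCtx hΔ)

theorem HasTy.twf {Ψ : GCtx} {Γ : LCtx} {i : Layer} {t : Tm} {T : Typ}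
    (h : HasTy Ψ Γ i t T) : TWf Ψ i T := by
  refine HasTy.rec (motive_1 := fun Ψ Γ i t T _ => TWf Ψ i T)
    (motive_2 := fun Ψ Γ i δ Δ _ => True) ?_ ?_ ?_ ?_ ?_ ?_ ?_ ?_ ?_ ?_ ?_ ?_ ?_ ?_ h
  · intro _ _ _ _ _ h h'; exact h.get h'
  · intro _ _ _ i _ _ _ h hu _; exact (h.lwf.gwf.get_tm hu).2.lift i
  · intro _ _ _ h; exact .nat h.gwf
  · intro _ _ _ _ _ ih; exact ih
  · intro _ _ _ _ _ _ h ih; exact .arr h.twf_dom ih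
  · intro _ _ _ _ _ _ _ _ _ ih _; cases ih; assumption
  · intro _ _ _ _ _ _ h ih; exact .box h.lwf ih
  · intros; assumption
  · intro _ _ _ _ _ _ ih; exact .mfun ih
  · intro _ _ _ _ _ _ hΔ ih; cases ih with | mfun h => exact h.inst hΔ
  all_goals intros; trivial

theorem HasTy.instVar {Ψ : GCtx} {Γ : LCtx} {i : Layer} {t s : Tm} {S T : Typ}
    (h : HasTy Ψ (Γ.snoc S) i t T) (hs : HasTy Ψ Γ i s S) : HasTy Ψ Γ i (t.instVar Γ s) T :=
  h.lsub (.snoc (.idSub hs.lwf) hs)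

theorem HasTy.instTm {Ψ : GCtx} {Γ Δ : LCtx} {i : Layer} {t s : Tm} {T T' : Typ}
    (h : HasTy (.tm Δ T :: Ψ) (Γ.gwk (.p .id)) i t (T'.gwk (.p .id)))
    (hs : HasTy Ψ Δ .zero s T) : HasTy Ψ Γ i (t.instTm s) T' := by
  simpa [Tm.instTm] using h.gsub (GSubTy.instTm hs)

theorem HasTy.instCtx {Ψ : GCtx} {Γ Δ : LCtx} {i : Layer} {t : Tm} {T : Typ}
    (h : HasTy (.ctx :: Ψ) (Γ.gwk (.p .id)) i t T) (hΔ : LWf Ψ .zero Δ) :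
    HasTy Ψ Γ i (t.instCtx Δ) (T.inst Δ) := by
  simpa [Tm.instCtx, Typ.inst] using h.gsub (GSubTy.instCtx hΔ)

/-! ### Presuppositions of equivalence -/

mutual

theorem HasTy.refl {Ψ : GCtx} {Γ : LCtx} {i : Layer} {t : Tm} {T : Typ} :
    HasTy Ψ Γ i t T → TmEq Ψ Γ i t t T
  | .var h h' => .var h h'
  | .gvar h h' => .gvar h.refl h'
  | .zero h => .zero h
  | .succ h => .succ h.refl
  | .lam h => .lam h.refl
  | .app h h' => .app h.refl h'.refl
  | .box h h' => .box h h'.refl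
  | .letbox h hΔ hT hT' h' => .letbox h.refl hΔ hT hT' h'.refl
  | .mlam h h' => .mlam h h'.refl
  | .mapp h h' => .mapp h.refl h'

theorem SubTy.refl {Ψ : GCtx} {Γ Δ : LCtx} {i : Layer} {δ : LSub} :
    SubTy Ψ Γ i δ Δ → SubEq Ψ Γ i δ δ Δ
  | .emp h h' h'' => .emp h h' h''
  | .empCtx h h' h'' h''' => .empCtx h h' h'' h'''
  | .wk h h' h'' h''' => .wk h h' h'' h'''
  | .snoc h h' => .snoc h.refl h'.refl

end

theorem HasTy.lamEta {Ψ : GCtx} {Γ : LCtx} {i : Layer} {t : Tm} {S T : Typ}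
    (h : HasTy Ψ Γ i t (.arr S T)) :
    HasTy Ψ Γ i (.lam (.app (t.lwk (.p .id)) (.var 0))) (.arr S T) := by
  have hS : TWf Ψ i S := by cases h.twf; assumption
  have hΓ : LWf Ψ i (Γ.snoc S) := .snoc h.lwf hS
  exact .lam (.app (h.lwk ((LWkTy.id _).p S) hΓ) (.var hΓ (by simp)))

theorem HasTy.mapp_gwk {Ψ : GCtx} {Γ : LCtx} {t : Tm} {T : Typ}
    (h : HasTy Ψ Γ .one t (.mfun T)) :
    HasTy (.ctx :: Ψ) (Γ.gwk (.p .id)) .one (.mapp (t.gwk (.p .id)) (.cvar 0)) T := by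
  have hw : GWf (.ctx :: Ψ) := .ctx h.lwf.gwf
  have := HasTy.mapp (h.gwk (.p hw)) (Δ := .cvar 0) (.cvar hw rfl)
  rwa [Typ.gwk_q_inst_var] at this

theorem HasTy.mlamEta {Ψ : GCtx} {Γ : LCtx} {t : Tm} {T : Typ}
    (h : HasTy Ψ Γ .one t (.mfun T)) :
    HasTy Ψ Γ .one (.mlam (.mapp (t.gwk (.p .id)) (.cvar 0))) (.mfun T) :=
  .mlam h.lwf h.mapp_gwk

mutual

theorem TmEq.hasTy {Ψ : GCtx} {Γ : LCtx} {i : Layer} {t t' : Tm} {T : Typ} :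
    TmEq Ψ Γ i t t' T → HasTy Ψ Γ i t T ∧ HasTy Ψ Γ i t' T
  | .symm h => h.hasTy.symm
  | .trans h h' => ⟨h.hasTy.1, h'.hasTy.2⟩
  | .var h h' => ⟨.var h h', .var h h'⟩
  | .gvar h h' => ⟨.gvar h.subTy.1 h', .gvar h.subTy.2 h'⟩
  | .zero h => ⟨.zero h, .zero h⟩
  | .succ h => ⟨.succ h.hasTy.1, .succ h.hasTy.2⟩
  | .lam h => ⟨.lam h.hasTy.1, .lam h.hasTy.2⟩
  | .app h h' => ⟨.app h.hasTy.1 h'.hasTy.1, .app h.hasTy.2 h'.hasTy.2⟩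
  | .box h h' => ⟨.box h h'.hasTy.1, .box h h'.hasTy.2⟩
  | .letbox h hΔ hT hT' h' =>
    ⟨.letbox h.hasTy.1 hΔ hT hT' h'.hasTy.1, .letbox h.hasTy.2 hΔ hT hT' h'.hasTy.2⟩
  | .mlam h h' => ⟨.mlam h h'.hasTy.1, .mlam h h'.hasTy.2⟩
  | .mapp h h' => ⟨.mapp h.hasTy.1 h', .mapp h.hasTy.2 h'⟩
  | .lamBeta h h' => ⟨.app (.lam h) h', h.instVar h'⟩
  | .lamEta h => ⟨h, h.lamEta⟩
  | .letboxBeta h hΓ hT h' =>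
    ⟨.letbox (.box hΓ h) h.lwf h.twf hT h', h'.instTm h⟩
  | .mlamBeta hΓ h hΔ => ⟨.mapp (.mlam hΓ h) hΔ, h.instCtx hΔ⟩
  | .mlamEta h => ⟨h, h.mlamEta⟩

theorem SubEq.subTy {Ψ : GCtx} {Γ Δ : LCtx} {i : Layer} {δ δ' : LSub} :
    SubEq Ψ Γ i δ δ' Δ → SubTy Ψ Γ i δ Δ ∧ SubTy Ψ Γ i δ' Δ
  | .emp h h' h'' => ⟨.emp h h' h'', .emp h h' h''⟩
  | .empCtx h h' h'' h''' => ⟨.empCtx h h' h'' h''', .empCtx h h' h'' h'''⟩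
  | .wk h h' h'' h''' => ⟨.wk h h' h'' h''', .wk h h' h'' h'''⟩
  | .snoc h h' => ⟨.snoc h.subTy.1 h'.hasTy.1, .snoc h.subTy.2 h'.hasTy.2⟩

end

mutual

theorem TmEq.eq_of_eq_zero {Ψ : GCtx} {Γ : LCtx} {i : Layer} {t t' : Tm} {T : Typ} :
    TmEq Ψ Γ i t t' T → i = .zero → t = t'
  | .symm h, hi => (h.eq_of_eq_zero hi).symm
  | .trans h h', hi => (h.eq_of_eq_zero hi).trans (h'.eq_of_eq_zero hi)
  | .var h h', _ => rfl
  | .gvar h h', hi => by rw [h.eq_of_eq_zero hi]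
  | .zero h, _ => rfl
  | .succ h, hi => by rw [h.eq_of_eq_zero hi]
  | .lam h, hi => by rw [h.eq_of_eq_zero hi]
  | .app h h', hi => by rw [h.eq_of_eq_zero hi, h'.eq_of_eq_zero hi]

theorem SubEq.eq_of_eq_zero {Ψ : GCtx} {Γ Δ : LCtx} {i : Layer} {δ δ' : LSub} :
    SubEq Ψ Γ i δ δ' Δ → i = .zero → δ = δ'
  | .emp h h' h'', _ => rfl
  | .empCtx h h' h'' h''', _ => rfl
  | .wk h h' h'' h''', _ => rfl
  | .snoc h h', hi => by rw [h.eq_of_eq_zero hi, h'.eq_of_eq_zero hi]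

end

/-! ### Strengthening -/

mutual

theorem Tm.strengthen : ∀ {t : Tm} {Ψ : GCtx} {Γ Γ' : LCtx} {i : Layer} {T : Typ} {τ : Wk},
    HasTy Ψ Γ' i (t.lwk τ) T → LWkTy Γ' τ Γ → LWf Ψ i Γ → HasTy Ψ Γ i t T
  | .var x, _, _, _, _, _, _, h, hτ, hΓ => by
    rw [Tm.lwk] at h
    cases h with | var _ h => exact .var hΓ (by rwa [← hτ.get])
  | .gvar u δ, _, _, _, _, _, _, h, hτ, hΓ => by
    rw [Tm.lwk] at h
    cases h with | gvar h h' => exact .gvar (LSub.strengthen h hτ hΓ) h'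
  | .zero, _, _, _, _, _, _, h, hτ, hΓ => by
    rw [Tm.lwk] at h
    cases h with | zero h => exact .zero hΓ
  | .succ t, _, _, _, _, _, _, h, hτ, hΓ => by
    rw [Tm.lwk] at h
    cases h with | succ h => exact .succ (Tm.strengthen h hτ hΓ)
  | .box t, _, _, _, _, _, _, h, hτ, hΓ => by
    rw [Tm.lwk] at h
    cases h with | box _ h => exact .box hΓ h
  | .letbox T s t, _, _, _, _, _, _, h, hτ, hΓ => by
    rw [Tm.lwk] at h
    cases h with
    | letbox h hΔ hT hT' h' =>
      exact .letbox (Tm.strengthen h hτ hΓ) hΔ hT hT'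
        (Tm.strengthen h' (hτ.gwk _) (hΓ.gwk (.p (.tm hΔ hT))))
  | .lam t, _, _, _, _, _, _, h, hτ, hΓ => by
    rw [Tm.lwk] at h
    cases h with
    | lam h => exact .lam (Tm.strengthen h (hτ.q _) (.snoc hΓ h.twf_dom))
  | .app t s, _, _, _, _, _, _, h, hτ, hΓ => by
    rw [Tm.lwk] at h
    cases h with
    | app h h' => exact .app (Tm.strengthen h hτ hΓ) (Tm.strengthen h' hτ hΓ)
  | .mlam t, _, _, _, _, _, _, h, hτ, hΓ => by
    rw [Tm.lwk] at h
    cases h with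
    | mlam _ h =>
      exact .mlam hΓ (Tm.strengthen h (hτ.gwk _) (hΓ.gwk (.p h.lwf.gwf)))
  | .mapp t Δ, _, _, _, _, _, _, h, hτ, hΓ => by
    rw [Tm.lwk] at h
    cases h with | mapp h hΔ => exact .mapp (Tm.strengthen h hτ hΓ) hΔ

theorem LSub.strengthen : ∀ {δ : LSub} {Ψ : GCtx} {Γ Γ' Δ : LCtx} {i : Layer} {τ : Wk},
    SubTy Ψ Γ' i (δ.lwk τ) Δ → LWkTy Γ' τ Γ → LWf Ψ i Γ → SubTy Ψ Γ i δ Δ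
  | .emp none m, _, _, _, _, _, _, h, hτ, hΓ => by
    rw [LSub.lwk] at h
    cases h with
    | emp _ hb hm => exact .emp hΓ (by rwa [← hτ.base]) (by have := hτ.len; omega)
  | .emp (some g) m, _, _, _, _, _, _, h, hτ, hΓ => by
    rw [LSub.lwk] at h
    cases h with
    | empCtx _ hg hb hm => exact .empCtx hΓ hg (by rwa [← hτ.base]) (by have := hτ.len; omega)
  | .wk g m, _, _, _, _, _, _, h, hτ, hΓ => by
    rw [LSub.lwk] at h
    cases h with
    | wk _ hg hb hm => exact .wk hΓ hg (by rwa [← hτ.base]) (by have := hτ.len; omega)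
  | .snoc δ t, _, _, _, _, _, _, h, hτ, hΓ => by
    rw [LSub.lwk] at h
    cases h with
    | snoc h h' => exact .snoc (LSub.strengthen h hτ hΓ) (Tm.strengthen h' hτ hΓ)

end

theorem HasTy.strengthen_app {Ψ : GCtx} {Γ : LCtx} {i : Layer} {t : Tm} {S T : Typ}
    (h : HasTy Ψ (Γ.snoc S) i (.app (t.lwk (.p .id)) (.var 0)) T) :
    HasTy Ψ Γ i t (.arr S T) := by
  have hΓ : LWf Ψ i Γ := by cases h.lwf; assumption
  cases h with
  | app h h' =>
    cases h' with
    | var _ h' =>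
      simp at h'
      subst h'
      exact Tm.strengthen h ((LWkTy.id _).p _) hΓ

theorem GCtx.get_cons_succ {Ψ : GCtx} {B C : GBind} {k : ℕ}
    (h : GCtx.get (B :: Ψ) (k + 1) = some C) : ∃ D, GCtx.get Ψ k = some D ∧ C = D.gwk (.p .id) := by
  simp only [GCtx.get, Option.map_eq_some_iff] at h
  obtain ⟨D, hD, h⟩ := h
  exact ⟨D, hD, h.symm⟩

/-- The type of a weakened neutral form is a weakened type. -/
theorem IsNe.type_gwk {Ψ : GCtx} {Γ : LCtx} {B : GBind} {i : Layer} {v : Tm} {T : Typ}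
    (hv : IsNe v) (h : HasTy (B :: Ψ) (Γ.gwk (.p .id)) i (v.gwk (.p .id)) T) :
    ∃ T₀ : Typ, T = T₀.gwk (.p .id) := by
  induction hv generalizing T with
  | @var x =>
    rw [Tm.gwk] at h
    cases h with
    | var _ h =>
      simp only [LCtx.get_gwk, Option.map_eq_some_iff] at h
      obtain ⟨S, _, h⟩ := h
      exact ⟨S, h.symm⟩
  | @gvar u δ =>
    rw [Tm.gwk] at h
    cases h with
    | gvar _ h =>
      obtain ⟨D, _, hD⟩ := GCtx.get_cons_succ h
      cases D with
      | ctx => simp at hD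
      | tm Δ S => simp at hD; exact ⟨S, hD.2⟩
  | app _ ih =>
    rw [Tm.gwk] at h
    cases h with
    | app h _ =>
      obtain ⟨T₀, h₀⟩ := ih h
      cases T₀ <;> simp at h₀
      exact ⟨_, h₀.2⟩
  | @letbox T' v t _ ih =>
    rw [Tm.gwk] at h
    cases h with
    | letbox h _ _ _ _ => exact ⟨T', rfl⟩
  | @mapp v Δ _ ih =>
    rw [Tm.gwk] at h
    cases h with
    | mapp h _ =>
      obtain ⟨T₀, h₀⟩ := ih h
      cases T₀ <;> simp at h₀
      subst h₀
      exact ⟨_, (Typ.inst_gwk _ _ _).symm⟩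

theorem HasTy.strengthen_mapp {Ψ : GCtx} {Γ : LCtx} {w : Tm} {T : Typ} (hw : IsNf w)
    (h : HasTy (.ctx :: Ψ) (Γ.gwk (.p .id)) .one (.mapp (w.gwk (.p .id)) (.cvar 0)) T) :
    HasTy Ψ Γ .one w (.mfun T) := by
  have hΨ : GWf (.ctx :: Ψ) := h.lwf.gwf
  have hnil : GSubTy Ψ (GSub.id.snoc (.ctx .nil)) (.ctx :: Ψ) := .instCtx (.nil hΨ.tail)
  have hΓ : LWf Ψ .one Γ := by simpa using h.lwf.gsub hnil
  generalize hr : w.gwk (.p .id) = r at h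
  cases h with
  | @mapp _ _ _ _ T₀ h _ =>
    subst hr
    cases hw with
    | ne hv =>
      obtain ⟨T₁, h₁⟩ := hv.type_gwk h
      rw [h₁] at h
      cases T₁ <;> simp at h₁
      subst h₁
      rw [Typ.gwk_q_inst_var]
      have := h.gsub hnil
      rwa [Tm.gwk_p_gsub_snoc, Typ.gwk_p_gsub_snoc, LCtx.gwk_p_gsub_snoc, Tm.gsub_id,
        Typ.gsub_id, LCtx.gsub_id] at this
    | mlam =>
      rw [Tm.gwk] at h
      cases h with
      | mlam _ h =>
        have hσ : GSubTy (.ctx :: Ψ) (GSub.id.snoc (.var 0)) (.ctx :: .ctx :: Ψ) :=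
          (GSubTy.id hΨ).snocCtx (.cvar hΨ rfl)
        have := h.gsub hσ
        rw [← Typ.inst_cvar, Tm.gwk_gsub, GSub.pre_q_p_snoc_var, Tm.gsub_id] at this
        exact .mlam hΓ (by simpa using this)
    | zero => cases h
    | succ => cases h
    | box => cases h
    | lam => cases h

/-! ### Weak head reduction -/

theorem Red.tmEq {Ψ : GCtx} {Γ : LCtx} {t t' : Tm} {T : Typ} (h : Red Ψ Γ t t' T) :
    TmEq Ψ Γ .one t t' T := by
  induction h with
  | app _ h ih => exact .app ih h.refl
  | letbox _ hT h ih =>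
    cases h.lwf.gwf with
    | tm hΔ hS => exact .letbox ih hΔ hS hT h.refl
  | mapp _ h ih => exact .mapp ih h
  | lamBeta h h' => exact .lamBeta h h'
  | mlamBeta h h' h'' => exact .mlamBeta h h' h''
  | letboxBeta h h' h'' h''' => exact .letboxBeta h h' h'' h'''

theorem Reds.tmEq {Ψ : GCtx} {Γ : LCtx} {t t' : Tm} {T : Typ} (h : Reds Ψ Γ t t' T) :
    TmEq Ψ Γ .one t t' T := by
  induction h with
  | refl h => exact h.refl
  | step h _ ih => exact .trans h.tmEq ih

theorem Reds.trans {Ψ : GCtx} {Γ : LCtx} {t t' t'' : Tm} {T : Typ} (h : Reds Ψ Γ t t' T)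
    (h' : Reds Ψ Γ t' t'' T) : Reds Ψ Γ t t'' T := by
  induction h with
  | refl _ => exact h'
  | step h _ ih => exact .step h (ih h')

theorem Red.reds {Ψ : GCtx} {Γ : LCtx} {t t' : Tm} {T : Typ} (h : Red Ψ Γ t t' T) :
    Reds Ψ Γ t t' T :=
  .step h (.refl h.tmEq.hasTy.2)

theorem Reds.app {Ψ : GCtx} {Γ : LCtx} {t t' s : Tm} {S T : Typ}
    (h : Reds Ψ Γ t t' (.arr S T)) (hs : HasTy Ψ Γ .one s S) :
    Reds Ψ Γ (.app t s) (.app t' s) T := by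
  generalize hA : Typ.arr S T = A at h
  induction h with
  | refl h => subst hA; exact .refl (.app h hs)
  | step h _ ih => subst hA; exact .step (.app h hs) (ih rfl)

theorem Reds.mapp {Ψ : GCtx} {Γ Δ : LCtx} {t t' : Tm} {T : Typ}
    (h : Reds Ψ Γ t t' (.mfun T)) (hΔ : LWf Ψ .zero Δ) :
    Reds Ψ Γ (.mapp t Δ) (.mapp t' Δ) (T.inst Δ) := by
  generalize hA : Typ.mfun T = A at h
  induction h with
  | refl h => subst hA; exact .refl (.mapp h hΔ)
  | step h _ ih => subst hA; exact .step (.mapp h hΔ) (ih rfl)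

theorem Reds.letbox {Ψ : GCtx} {Γ Δ : LCtx} {s s' t : Tm} {T T' : Typ}
    (h : Reds Ψ Γ s s' (.box Δ T)) (hT : TWf Ψ .one T')
    (ht : HasTy (.tm Δ T :: Ψ) (Γ.gwk (.p .id)) .one t (T'.gwk (.p .id))) :
    Reds Ψ Γ (.letbox T' s t) (.letbox T' s' t) T' := by
  generalize hA : Typ.box Δ T = A at h
  induction h with
  | refl h =>
    subst hA
    cases ht.lwf.gwf with
    | tm hΔ hS => exact .refl (.letbox h hΔ hS hT ht)
  | step h _ ih => subst hA; exact .step (.letbox h hT ht) (ih rfl)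

theorem IsNe.not_red {Ψ : GCtx} {Γ : LCtx} {v t : Tm} {T : Typ} (hv : IsNe v)
    (h : Red Ψ Γ v t T) : False := by
  induction h with
  | app _ _ ih => cases hv with | app hv => exact ih hv
  | letbox _ _ _ ih => cases hv with | letbox hv => exact ih hv
  | mapp _ _ ih => cases hv with | mapp hv => exact ih hv
  | lamBeta => cases hv with | app hv => cases hv
  | mlamBeta => cases hv with | mapp hv => cases hv
  | letboxBeta => cases hv with | letbox hv => cases hv

theorem IsNf.not_red {Ψ : GCtx} {Γ : LCtx} {w t : Tm} {T : Typ} (hw : IsNf w)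
    (h : Red Ψ Γ w t T) : False := by
  cases hw with
  | ne hv => exact hv.not_red h
  | _ => cases h

theorem Red.det {Ψ : GCtx} {Γ : LCtx} {t t₁ t₂ : Tm} {T₁ T₂ : Typ} (h₁ : Red Ψ Γ t t₁ T₁)
    (h₂ : Red Ψ Γ t t₂ T₂) : t₁ = t₂ := by
  induction h₁ generalizing t₂ T₂ with
  | app h _ ih =>
    cases h₂ with
    | app h' _ => rw [ih h']
    | lamBeta => exact (IsNf.lam.not_red h).elim
  | letbox h _ _ ih =>
    cases h₂ with
    | letbox h' _ _ => rw [ih h']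
    | letboxBeta => exact (IsNf.box.not_red h).elim
  | mapp h _ ih =>
    cases h₂ with
    | mapp h' _ => rw [ih h']
    | mlamBeta => exact (IsNf.mlam.not_red h).elim
  | lamBeta =>
    cases h₂ with
    | app h' _ => exact (IsNf.lam.not_red h').elim
    | lamBeta => rfl
  | mlamBeta =>
    cases h₂ with
    | mapp h' _ => exact (IsNf.mlam.not_red h').elim
    | mlamBeta => rfl
  | letboxBeta =>
    cases h₂ with
    | letbox h' _ _ => exact (IsNf.box.not_red h').elim
    | letboxBeta => rfl

theorem Reds.det {Ψ : GCtx} {Γ : LCtx} {t w₁ w₂ : Tm} {T₁ T₂ : Typ} (h₁ : Reds Ψ Γ t w₁ T₁)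
    (h₂ : Reds Ψ Γ t w₂ T₂) (hw₁ : IsNf w₁) (hw₂ : IsNf w₂) : w₁ = w₂ := by
  induction h₁ generalizing w₂ with
  | refl _ =>
    cases h₂ with
    | refl _ => rfl
    | step h _ => exact (hw₁.not_red h).elim
  | step h _ ih =>
    cases h₂ with
    | refl _ => exact (hw₂.not_red h).elim
    | step h' h'' =>
      cases h.det h'
      exact ih h'' hw₁ hw₂

theorem IsNe.weaken {v : Tm} (h : IsNe v) (γ τ : Wk) : IsNe ((v.gwk γ).lwk τ) := by
  induction h with
  | var => exact .var
  | gvar => exact .gvar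
  | app _ ih => exact .app ih
  | letbox _ ih => exact .letbox ih
  | mapp _ ih => exact .mapp ih

theorem IsNf.weaken {w : Tm} (h : IsNf w) (γ τ : Wk) : IsNf ((w.gwk γ).lwk τ) := by
  cases h with
  | ne h => exact .ne (h.weaken γ τ)
  | zero => exact .zero
  | succ => exact .succ
  | box => exact .box
  | lam => exact .lam
  | mlam => exact .mlam

theorem LWkTy.isPrecomp {Γ Γ' : LCtx} {τ : Wk} (h : LWkTy Γ' τ Γ) :
    LSub.IsPrecomp τ Γ'.idSub (Γ.idSub.lwk τ) := by
  refine ⟨fun x => ?_, by simp [LCtx.idSub, h.len], by simp [LCtx.idSub, h.base]⟩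
  rw [LSub.get_lwk, LCtx.idSub, LCtx.idSub]
  by_cases hx : x < Γ.len
  · have hx' : τ.app x < Γ'.len := by
      by_contra hx'
      have h₁ := h.get x
      rw [Γ'.get_eq_none (not_lt.1 hx')] at h₁
      obtain ⟨T, hT⟩ := Γ.exists_get hx
      simp [hT] at h₁
    simp [LCtx.wkSub_get_of_lt, hx, hx']
  · rw [LCtx.wkSub_get_of_le _ _ (not_lt.1 hx), LCtx.wkSub_get_of_le]
    · rfl
    · rw [h.tail _ (not_lt.1 hx), h.len]; omega

theorem Tm.instVar_weaken {Γ Γ' : LCtx} {γ τ : Wk} (hτ : LWkTy Γ' τ (Γ.gwk γ)) (t s : Tm) :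
    ((t.instVar Γ s).gwk γ).lwk τ =
      ((t.gwk γ).lwk (.q τ)).instVar Γ' ((s.gwk γ).lwk τ) := by
  rw [Tm.instVar, Tm.instVar, Tm.lsub_gwk, Tm.lsub_lwk]
  symm
  have h := hτ.isPrecomp
  refine Tm.lwk_lsub _ ⟨fun x => ?_, by simpa using h.hat, by simpa using h.check⟩
  cases x with
  | zero => simp
  | succ x => simpa using h.get x

theorem GSub.pre_q_snoc (γ : Wk) (e : GEnt) :
    GSub.pre (.q γ) (GSub.id.snoc (e.gwk γ)) = (GSub.id.snoc e).gwk γ := by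
  funext k
  cases k <;> rfl

theorem HasTy.inst_weaken {Ψ : GCtx} {Γ Γ' : LCtx} {i : Layer} {B : GBind} {t : Tm} {T : Typ}
    {γ τ : Wk} (h : HasTy (B :: Ψ) (Γ.gwk (.p .id)) i t T) (hτ : LWkTy Γ' τ (Γ.gwk γ))
    (e : GEnt) :
    ((t.gsub (GSub.id.snoc e)).gwk γ).lwk τ =
      ((t.gwk (.q γ)).lwk τ).gsub (GSub.id.snoc (e.gwk γ)) := by
  rw [Tm.lwk_gsub _ (h.sc.gwk (.q γ)) (by simpa using hτ.tail), Tm.gwk_gsub, Tm.gsub_gwk,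
    GSub.pre_q_snoc]

theorem HasTy.weaken_tm {Ψ Ψ' : GCtx} {Γ Γ' Δ : LCtx} {t : Tm} {T T' : Typ} {γ τ : Wk}
    (h : HasTy (.tm Δ T :: Ψ) (Γ.gwk (.p .id)) .one t (T'.gwk (.p .id)))
    (hγ : GWkTy Ψ' γ Ψ) (hτ : LWkTy Γ' τ (Γ.gwk γ)) (hΓ : LWf Ψ' .one Γ') :
    HasTy (.tm (Δ.gwk γ) (T.gwk γ) :: Ψ') (Γ'.gwk (.p .id)) .one ((t.gwk (.q γ)).lwk τ)
      ((T'.gwk γ).gwk (.p .id)) := by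
  cases h.lwf.gwf with
  | tm hΔ hT =>
    have hq := hγ.qTm hΔ hT
    have := h.weaken hq hτ.gwk_p (hΓ.gwk (.p hq.wf))
    rwa [Typ.gwk_p_gwk_q] at this

theorem HasTy.weaken_ctx {Ψ Ψ' : GCtx} {Γ Γ' : LCtx} {t : Tm} {T : Typ} {γ τ : Wk}
    (h : HasTy (.ctx :: Ψ) (Γ.gwk (.p .id)) .one t T)
    (hγ : GWkTy Ψ' γ Ψ) (hτ : LWkTy Γ' τ (Γ.gwk γ)) (hΓ : LWf Ψ' .one Γ') :
    HasTy (.ctx :: Ψ') (Γ'.gwk (.p .id)) .one ((t.gwk (.q γ)).lwk τ) (T.gwk (.q γ)) :=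
  h.weaken hγ.qCtx hτ.gwk_p (hΓ.gwk (.p hγ.qCtx.wf))

theorem Red.weaken {Ψ Ψ' : GCtx} {Γ Γ' : LCtx} {t t' : Tm} {T : Typ} {γ τ : Wk}
    (h : Red Ψ Γ t t' T) (hγ : GWkTy Ψ' γ Ψ) (hτ : LWkTy Γ' τ (Γ.gwk γ))
    (hΓ : LWf Ψ' .one Γ') :
    Red Ψ' Γ' ((t.gwk γ).lwk τ) ((t'.gwk γ).lwk τ) (T.gwk γ) := by
  induction h generalizing Ψ' Γ' γ τ with
  | app _ h ih => exact .app (ih hγ hτ hΓ) (h.weaken hγ hτ hΓ)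
  | letbox _ hT h ih =>
    exact .letbox (ih hγ hτ hΓ) (hT.gwk hγ) (h.weaken_tm hγ hτ hΓ)
  | mapp _ h ih =>
    rw [Typ.inst_gwk]
    exact .mapp (ih hγ hτ hΓ) (h.gwk hγ)
  | lamBeta h h' =>
    rw [Tm.instVar_weaken hτ]
    exact .lamBeta (h.weaken hγ (hτ.q _) (.snoc hΓ (h.twf_dom.gwk hγ))) (h'.weaken hγ hτ hΓ)
  | mlamBeta _ h h' =>
    rw [Tm.instCtx, h.inst_weaken hτ, Typ.inst_gwk]
    exact .mlamBeta hΓ (h.weaken_ctx hγ hτ hΓ) (h'.gwk hγ)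
  | letboxBeta h _ hT h' =>
    rw [Tm.instTm, h'.inst_weaken hτ]
    exact .letboxBeta (h.gwk hγ) hΓ (hT.gwk hγ) (h'.weaken_tm hγ hτ hΓ)

theorem Reds.weaken {Ψ Ψ' : GCtx} {Γ Γ' : LCtx} {t t' : Tm} {T : Typ} {γ τ : Wk}
    (h : Reds Ψ Γ t t' T) (hγ : GWkTy Ψ' γ Ψ) (hτ : LWkTy Γ' τ (Γ.gwk γ))
    (hΓ : LWf Ψ' .one Γ') :
    Reds Ψ' Γ' ((t.gwk γ).lwk τ) ((t'.gwk γ).lwk τ) (T.gwk γ) := by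
  induction h with
  | refl h => exact .refl (h.weaken hγ hτ hΓ)
  | step h _ ih => exact .step (h.weaken hγ hτ hΓ) ih

/-! ### Convertibility checking is sound -/

mutual

theorem Conv.sound {Ψ : GCtx} {Γ : LCtx} {t t' : Tm} {T : Typ} :
    Conv Ψ Γ t t' T → TmEq Ψ Γ .one t t' T
  | .red h h' h'' => .trans h.tmEq (.trans h''.sound (.symm h'.tmEq))

theorem ConvNf.sound {Ψ : GCtx} {Γ : LCtx} {w w' : Tm} {T : Typ} :
    ConvNf Ψ Γ w w' T → TmEq Ψ Γ .one w w' T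
  | .zero h => .zero h
  | .succ h => .succ h.sound
  | .natNe h => h.sound
  | .arr _ _ h =>
    have ih := h.sound
    .trans (.lamEta ih.hasTy.1.strengthen_app)
      (.trans (.lam ih) (.symm (.lamEta ih.hasTy.2.strengthen_app)))
  | .box h h' => .box h h'.refl
  | .boxNe h => h.sound
  | .mfun hw hw' h =>
    have ih := h.sound
    have h₁ := HasTy.strengthen_mapp hw ih.hasTy.1
    .trans (.mlamEta h₁)
      (.trans (.mlam h₁.lwf ih) (.symm (.mlamEta (HasTy.strengthen_mapp hw' ih.hasTy.2))))

theorem ConvNe.sound {Ψ : GCtx} {Γ : LCtx} {v v' : Tm} {T : Typ} :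
    ConvNe Ψ Γ v v' T → TmEq Ψ Γ .one v v' T
  | .var h h' => .var h h'
  | .gvar h h' => .gvar h.sound h'
  | .app h h' => .app h.sound h'.sound
  | .letbox h hT h' => by
    have ih := h'.sound
    cases ih.hasTy.1.lwf.gwf with
    | tm hΔ hS => exact .letbox h.sound hΔ hS hT ih
  | .mapp h hΔ => .mapp h.sound hΔ

theorem ConvSub.sound {Ψ : GCtx} {Γ Δ : LCtx} {δ δ' : LSub} :
    ConvSub Ψ Γ δ δ' Δ → SubEq Ψ Γ .one δ δ' Δ
  | .emp h h' h'' => .emp h h' h''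
  | .empCtx h h' h'' h''' => .empCtx h h' h'' h'''
  | .wk h h' h'' h''' => .wk h h' h'' h'''
  | .snoc h h' => .snoc h.sound h'.sound

end

/-! ### Structural properties of convertibility checking -/

theorem ConvNe.isNe {Ψ : GCtx} {Γ : LCtx} {v v' : Tm} {T : Typ} :
    ConvNe Ψ Γ v v' T → IsNe v ∧ IsNe v'
  | .var h h' => ⟨.var, .var⟩
  | .gvar h h' => ⟨.gvar, .gvar⟩
  | .app h h' => ⟨.app h.isNe.1, .app h.isNe.2⟩
  | .letbox h hT h' => ⟨.letbox h.isNe.1, .letbox h.isNe.2⟩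
  | .mapp h hΔ => ⟨.mapp h.isNe.1, .mapp h.isNe.2⟩

theorem ConvNf.isNf {Ψ : GCtx} {Γ : LCtx} {w w' : Tm} {T : Typ} (h : ConvNf Ψ Γ w w' T) :
    IsNf w ∧ IsNf w' := by
  cases h with
  | zero => exact ⟨.zero, .zero⟩
  | succ => exact ⟨.succ, .succ⟩
  | natNe h => exact ⟨.ne h.isNe.1, .ne h.isNe.2⟩
  | arr h h' _ => exact ⟨h, h'⟩
  | box => exact ⟨.box, .box⟩
  | boxNe h => exact ⟨.ne h.isNe.1, .ne h.isNe.2⟩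
  | mfun h h' _ => exact ⟨h, h'⟩

mutual

theorem Conv.symm {Ψ : GCtx} {Γ : LCtx} {t t' : Tm} {T : Typ} :
    Conv Ψ Γ t t' T → Conv Ψ Γ t' t T
  | .red h h' h'' => .red h' h h''.symm

theorem ConvNf.symm {Ψ : GCtx} {Γ : LCtx} {w w' : Tm} {T : Typ} :
    ConvNf Ψ Γ w w' T → ConvNf Ψ Γ w' w T
  | .zero h => .zero h
  | .succ h => .succ h.symm
  | .natNe h => .natNe h.symm
  | .arr hw hw' h => .arr hw' hw h.symm
  | .box h h' => .box h h'
  | .boxNe h => .boxNe h.symm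
  | .mfun hw hw' h => .mfun hw' hw h.symm

theorem ConvNe.symm {Ψ : GCtx} {Γ : LCtx} {v v' : Tm} {T : Typ} :
    ConvNe Ψ Γ v v' T → ConvNe Ψ Γ v' v T
  | .var h h' => .var h h'
  | .gvar h h' => .gvar h.symm h'
  | .app h h' => .app h.symm h'.symm
  | .letbox h hT h' => .letbox h.symm hT h'.symm
  | .mapp h hΔ => .mapp h.symm hΔ

theorem ConvSub.symm {Ψ : GCtx} {Γ Δ : LCtx} {δ δ' : LSub} :
    ConvSub Ψ Γ δ δ' Δ → ConvSub Ψ Γ δ' δ Δ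
  | .emp h h' h'' => .emp h h' h''
  | .empCtx h h' h'' h''' => .empCtx h h' h'' h'''
  | .wk h h' h'' h''' => .wk h h' h'' h'''
  | .snoc h h' => .snoc h.symm h'.symm

end

mutual

theorem Conv.trans {Ψ : GCtx} {Γ : LCtx} {t t' : Tm} {T : Typ} :
    Conv Ψ Γ t t' T → ∀ {t'' : Tm}, Conv Ψ Γ t' t'' T → Conv Ψ Γ t t'' T
  | .red h₁ h₂ h₃, _, .red h₁' h₂' h₃' => by
    cases h₂.det h₁' h₃.isNf.2 h₃'.isNf.1
    exact .red h₁ h₂' (h₃.trans h₃')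
termination_by structural h => h

theorem ConvNf.trans {Ψ : GCtx} {Γ : LCtx} {w w' : Tm} {T : Typ} :
    ConvNf Ψ Γ w w' T → ∀ {w'' : Tm}, ConvNf Ψ Γ w' w'' T → ConvNf Ψ Γ w w'' T
  | .zero h, _, h' => h'
  | .succ h, _, h' => by
    cases h' with
    | succ h' => exact .succ (h.trans h')
    | natNe h' => cases h'.isNe.1
  | .natNe h, _, h' => by
    cases h' with
    | zero => cases h.isNe.2
    | succ => cases h.isNe.2
    | natNe h' => exact .natNe (h.trans h').2
  | .arr hw hw' h, _, h' => by
    cases h' with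
    | arr _ hw'' h' => exact .arr hw hw'' (h.trans h')
  | .box h _, _, h' => h'
  | .boxNe h, _, h' => by
    cases h' with
    | box => cases h.isNe.2
    | boxNe h' => exact .boxNe (h.trans h').2
  | .mfun hw hw' h, _, h' => by
    cases h' with
    | mfun _ hw'' h' => exact .mfun hw hw'' (h.trans h')
termination_by structural h => h

theorem ConvNe.trans {Ψ : GCtx} {Γ : LCtx} {v v' : Tm} {T : Typ} :
    ConvNe Ψ Γ v v' T → ∀ {v'' : Tm} {T' : Typ}, ConvNe Ψ Γ v' v'' T' → T = T' ∧ ConvNe Ψ Γ v v'' T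
  | .var h hx, _, _, h' => by
    cases h' with
    | var _ hx' => exact ⟨by simpa [hx] using hx', .var h hx⟩
  | .gvar h hu, _, _, h' => by
    cases h' with
    | gvar h' hu' =>
      have := hu.symm.trans hu'
      simp at this
      obtain ⟨rfl, rfl⟩ := this
      exact ⟨rfl, .gvar (h.trans h') hu⟩
  | .app h₁ h₂, _, _, h' => by
    cases h' with
    | app h₁' h₂' =>
      have ⟨he, ih⟩ := h₁.trans h₁'
      simp at he
      obtain ⟨rfl, rfl⟩ := he
      exact ⟨rfl, .app ih (h₂.trans h₂')⟩
  | .letbox h₁ hT h₂, _, _, h' => by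
    cases h' with
    | letbox h₁' _ h₂' =>
      have ⟨he, ih⟩ := h₁.trans h₁'
      simp at he
      obtain ⟨rfl, rfl⟩ := he
      exact ⟨rfl, .letbox ih hT (h₂.trans h₂')⟩
  | .mapp h hΔ, _, _, h' => by
    cases h' with
    | mapp h' _ =>
      have ⟨he, ih⟩ := h.trans h'
      simp at he
      subst he
      exact ⟨rfl, .mapp ih hΔ⟩
termination_by structural h => h

theorem ConvSub.trans {Ψ : GCtx} {Γ Δ : LCtx} {δ δ' : LSub} :
    ConvSub Ψ Γ δ δ' Δ → ∀ {δ'' : LSub}, ConvSub Ψ Γ δ' δ'' Δ → ConvSub Ψ Γ δ δ'' Δ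
  | .emp _ _ _, _, h' => h'
  | .empCtx _ _ _ _, _, h' => h'
  | .wk _ _ _ _, _, h' => h'
  | .snoc h₁ h₂, _, h' => by
    cases h' with
    | snoc h₁' h₂' => exact .snoc (h₁.trans h₁') (h₂.trans h₂')
termination_by structural h => h

end

mutual

theorem Conv.weaken {Ψ : GCtx} {Γ : LCtx} {t t' : Tm} {T : Typ} :
    Conv Ψ Γ t t' T → ∀ {Ψ' : GCtx} {Γ' : LCtx} {γ τ : Wk}, GWkTy Ψ' γ Ψ →
      LWkTy Γ' τ (Γ.gwk γ) → LWf Ψ' .one Γ' →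
      Conv Ψ' Γ' ((t.gwk γ).lwk τ) ((t'.gwk γ).lwk τ) (T.gwk γ)
  | .red h h' h'', _, _, _, _, hγ, hτ, hΓ =>
    .red (h.weaken hγ hτ hΓ) (h'.weaken hγ hτ hΓ) (h''.weaken hγ hτ hΓ)

theorem ConvNf.weaken {Ψ : GCtx} {Γ : LCtx} {w w' : Tm} {T : Typ} :
    ConvNf Ψ Γ w w' T → ∀ {Ψ' : GCtx} {Γ' : LCtx} {γ τ : Wk}, GWkTy Ψ' γ Ψ →
      LWkTy Γ' τ (Γ.gwk γ) → LWf Ψ' .one Γ' →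
      ConvNf Ψ' Γ' ((w.gwk γ).lwk τ) ((w'.gwk γ).lwk τ) (T.gwk γ)
  | .zero h, _, _, _, _, hγ, hτ, hΓ => .zero hΓ
  | .succ h, _, _, _, _, hγ, hτ, hΓ => .succ (h.weaken hγ hτ hΓ)
  | .natNe h, _, _, _, _, hγ, hτ, hΓ => .natNe (h.weaken hγ hτ hΓ)
  | .arr hw hw' h, _, _, γ, τ, hγ, hτ, hΓ => by
    have hS := h.sound.hasTy.1.twf_dom
    have := h.weaken hγ (hτ.q _) (.snoc hΓ (hS.gwk hγ))
    refine .arr (hw.weaken _ _) (hw'.weaken _ _) ?_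
    simpa [Tm.lwk_gwk, Tm.lwk_lwk] using this
  | .box h h', _, _, _, _, hγ, hτ, hΓ => .box hΓ (h'.gwk hγ)
  | .boxNe h, _, _, _, _, hγ, hτ, hΓ => .boxNe (h.weaken hγ hτ hΓ)
  | .mfun hw hw' h, _, _, _, _, hγ, hτ, hΓ => by
    have := h.weaken hγ.qCtx hτ.gwk_p (hΓ.gwk (.p hγ.qCtx.wf))
    refine .mfun (hw.weaken _ _) (hw'.weaken _ _) ?_
    simpa [Tm.lwk_gwk, Tm.gwk_gwk] using this

theorem ConvNe.weaken {Ψ : GCtx} {Γ : LCtx} {v v' : Tm} {T : Typ} :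
    ConvNe Ψ Γ v v' T → ∀ {Ψ' : GCtx} {Γ' : LCtx} {γ τ : Wk}, GWkTy Ψ' γ Ψ →
      LWkTy Γ' τ (Γ.gwk γ) → LWf Ψ' .one Γ' →
      ConvNe Ψ' Γ' ((v.gwk γ).lwk τ) ((v'.gwk γ).lwk τ) (T.gwk γ)
  | .var _ h, _, _, _, _, hγ, hτ, hΓ => .var hΓ (by simp [hτ.get, h])
  | .gvar h hu, _, _, _, _, hγ, hτ, hΓ => .gvar (h.weaken hγ hτ hΓ) (hγ.get hu)
  | .app h h', _, _, _, _, hγ, hτ, hΓ => .app (h.weaken hγ hτ hΓ) (h'.weaken hγ hτ hΓ)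
  | .letbox h hT h', _, _, _, _, hγ, hτ, hΓ => by
    have hΨ := h'.sound.hasTy.1.lwf.gwf
    cases hΨ with
    | tm hΔ hS =>
      have hq := hγ.qTm hΔ hS
      have := h'.weaken hq hτ.gwk_p (hΓ.gwk (.p hq.wf))
      rw [Typ.gwk_p_gwk_q] at this
      exact .letbox (h.weaken hγ hτ hΓ) (hT.gwk hγ) this
  | .mapp h hΔ, _, _, _, _, hγ, hτ, hΓ => by
    rw [Typ.inst_gwk]
    exact .mapp (h.weaken hγ hτ hΓ) (hΔ.gwk hγ)

theorem ConvSub.weaken {Ψ : GCtx} {Γ Δ : LCtx} {δ δ' : LSub} :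
    ConvSub Ψ Γ δ δ' Δ → ∀ {Ψ' : GCtx} {Γ' : LCtx} {γ τ : Wk}, GWkTy Ψ' γ Ψ →
      LWkTy Γ' τ (Γ.gwk γ) → LWf Ψ' .one Γ' →
      ConvSub Ψ' Γ' ((δ.gwk γ).lwk τ) ((δ'.gwk γ).lwk τ) (Δ.gwk γ)
  | .emp _ h h', _, _, _, _, hγ, hτ, hΓ =>
    .emp hΓ (by simp [hτ.base, h]) (by simp [hτ.len, h'])
  | .empCtx _ hg h h', _, _, _, _, hγ, hτ, hΓ =>
    .empCtx hΓ (hγ.get hg) (by simp [hτ.base, h]) (by simp [hτ.len, h'])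
  | .wk _ hg h h', _, _, _, _, hγ, hτ, hΓ =>
    .wk hΓ (hγ.get hg) (by simp [hτ.base, h]) (by simp [hτ.len, h'])
  | .snoc h h', _, _, _, _, hγ, hτ, hΓ => .snoc (h.weaken hγ hτ hΓ) (h'.weaken hγ hτ hΓ)

end

/-! ### The logical relation -/

/-- The size of a type, not counting what occurs under `□`. -/
def Typ.size : Typ → ℕ
  | .nat => 0
  | .arr S T => S.size + T.size + 1
  | .box _ _ => 0
  | .mfun T => T.size + 1

attribute [simp] Typ.size

@[simp] theorem Typ.size_gwk : ∀ (T : Typ) (γ : Wk), (T.gwk γ).size = T.size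
  | .nat, _ => rfl
  | .arr S T, γ => by simp [S.size_gwk, T.size_gwk]
  | .box _ _, _ => rfl
  | .mfun T, γ => by simp [T.size_gwk]

@[simp] theorem Typ.size_gsub : ∀ (T : Typ) (σ : GSub), (T.gsub σ).size = T.size
  | .nat, _ => rfl
  | .arr S T, σ => by simp [S.size_gsub, T.size_gsub]
  | .box _ _, _ => rfl
  | .mfun T, σ => by simp [T.size_gsub]

@[simp] theorem Typ.size_inst (T : Typ) (Δ : LCtx) : (T.inst Δ).size = T.size := by
  simp [Typ.inst]

/-- The Kripke logical relation on layer `1` terms. At `Nat` and at contextual types it is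
convertibility; contextual types hold code, of which only syntactic equality is observed. -/
def LR (T : Typ) (Ψ : GCtx) (Γ : LCtx) (t t' : Tm) : Prop :=
  match T with
  | .nat => Conv Ψ Γ t t' .nat
  | .box Δ T => Conv Ψ Γ t t' (.box Δ T)
  | .arr S T => ∃ w w' : Tm, Reds Ψ Γ t w (.arr S T) ∧ Reds Ψ Γ t' w' (.arr S T) ∧
      IsNf w ∧ IsNf w' ∧
      ∀ (Ψ' : GCtx) (Γ' : LCtx) (γ τ : Wk) (s s' : Tm), GWkTy Ψ' γ Ψ →
        LWkTy Γ' τ (Γ.gwk γ) → LWf Ψ' .one Γ' → LR (S.gwk γ) Ψ' Γ' s s' →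
        LR (T.gwk γ) Ψ' Γ' (.app ((w.gwk γ).lwk τ) s) (.app ((w'.gwk γ).lwk τ) s')
  | .mfun T => ∃ w w' : Tm, Reds Ψ Γ t w (.mfun T) ∧ Reds Ψ Γ t' w' (.mfun T) ∧
      IsNf w ∧ IsNf w' ∧
      ∀ (Ψ' : GCtx) (Γ' : LCtx) (γ τ : Wk) (Δ : LCtx), GWkTy Ψ' γ Ψ →
        LWkTy Γ' τ (Γ.gwk γ) → LWf Ψ' .one Γ' → LWf Ψ' .zero Δ →
        LR ((T.gwk (.q γ)).inst Δ) Ψ' Γ' (.mapp ((w.gwk γ).lwk τ) Δ) (.mapp ((w'.gwk γ).lwk τ) Δ)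
termination_by T.size
decreasing_by all_goals simp; try omega

theorem LR.nat_iff {Ψ : GCtx} {Γ : LCtx} {t t' : Tm} :
    LR .nat Ψ Γ t t' ↔ Conv Ψ Γ t t' .nat := by
  rw [LR]

theorem LR.box_iff {Ψ : GCtx} {Γ Δ : LCtx} {T : Typ} {t t' : Tm} :
    LR (.box Δ T) Ψ Γ t t' ↔ Conv Ψ Γ t t' (.box Δ T) := by
  rw [LR]

theorem LR.arr_iff {Ψ : GCtx} {Γ : LCtx} {S T : Typ} {t t' : Tm} :
    LR (.arr S T) Ψ Γ t t' ↔
      ∃ w w' : Tm, Reds Ψ Γ t w (.arr S T) ∧ Reds Ψ Γ t' w' (.arr S T) ∧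
      IsNf w ∧ IsNf w' ∧
      ∀ (Ψ' : GCtx) (Γ' : LCtx) (γ τ : Wk) (s s' : Tm), GWkTy Ψ' γ Ψ →
        LWkTy Γ' τ (Γ.gwk γ) → LWf Ψ' .one Γ' → LR (S.gwk γ) Ψ' Γ' s s' →
        LR (T.gwk γ) Ψ' Γ' (.app ((w.gwk γ).lwk τ) s) (.app ((w'.gwk γ).lwk τ) s') := by
  rw [LR]

theorem LR.mfun_iff {Ψ : GCtx} {Γ : LCtx} {T : Typ} {t t' : Tm} :
    LR (.mfun T) Ψ Γ t t' ↔
      ∃ w w' : Tm, Reds Ψ Γ t w (.mfun T) ∧ Reds Ψ Γ t' w' (.mfun T) ∧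
      IsNf w ∧ IsNf w' ∧
      ∀ (Ψ' : GCtx) (Γ' : LCtx) (γ τ : Wk) (Δ : LCtx), GWkTy Ψ' γ Ψ →
        LWkTy Γ' τ (Γ.gwk γ) → LWf Ψ' .one Γ' → LWf Ψ' .zero Δ →
        LR ((T.gwk (.q γ)).inst Δ) Ψ' Γ' (.mapp ((w.gwk γ).lwk τ) Δ)
          (.mapp ((w'.gwk γ).lwk τ) Δ) := by
  rw [LR]

theorem Conv.hasTy {Ψ : GCtx} {Γ : LCtx} {t t' : Tm} {T : Typ} (h : Conv Ψ Γ t t' T) :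
    HasTy Ψ Γ .one t T ∧ HasTy Ψ Γ .one t' T :=
  h.sound.hasTy

theorem Conv.expand {Ψ : GCtx} {Γ : LCtx} {t t' s s' : Tm} {T : Typ} (h : Conv Ψ Γ t t' T)
    (hs : Reds Ψ Γ s t T) (hs' : Reds Ψ Γ s' t' T) : Conv Ψ Γ s s' T := by
  cases h with
  | red h₁ h₂ h₃ => exact .red (hs.trans h₁) (hs'.trans h₂) h₃

theorem LR.hasTy {T : Typ} {Ψ : GCtx} {Γ : LCtx} {t t' : Tm} (h : LR T Ψ Γ t t') :
    HasTy Ψ Γ .one t T ∧ HasTy Ψ Γ .one t' T := by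
  cases T with
  | nat => exact (LR.nat_iff.1 h).hasTy
  | box Δ T => exact (LR.box_iff.1 h).hasTy
  | arr S T =>
    obtain ⟨w, w', h₁, h₂, _⟩ := LR.arr_iff.1 h
    exact ⟨h₁.tmEq.hasTy.1, h₂.tmEq.hasTy.1⟩
  | mfun T =>
    obtain ⟨w, w', h₁, h₂, _⟩ := LR.mfun_iff.1 h
    exact ⟨h₁.tmEq.hasTy.1, h₂.tmEq.hasTy.1⟩

theorem LR.expand {T : Typ} {Ψ : GCtx} {Γ : LCtx} {t t' s s' : Tm} (h : LR T Ψ Γ t t')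
    (hs : Reds Ψ Γ s t T) (hs' : Reds Ψ Γ s' t' T) : LR T Ψ Γ s s' := by
  cases T with
  | nat => exact LR.nat_iff.2 ((LR.nat_iff.1 h).expand hs hs')
  | box Δ T => exact LR.box_iff.2 ((LR.box_iff.1 h).expand hs hs')
  | arr S T =>
    obtain ⟨w, w', h₁, h₂, h₃⟩ := LR.arr_iff.1 h
    exact LR.arr_iff.2 ⟨w, w', hs.trans h₁, hs'.trans h₂, h₃⟩
  | mfun T =>
    obtain ⟨w, w', h₁, h₂, h₃⟩ := LR.mfun_iff.1 h
    exact LR.mfun_iff.2 ⟨w, w', hs.trans h₁, hs'.trans h₂, h₃⟩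

theorem Tm.weaken_weaken (t : Tm) (γ τ γ' τ' : Wk) :
    ((((t.gwk γ).lwk τ).gwk γ').lwk τ') = (t.gwk (γ.comp γ')).lwk (τ.comp τ') := by
  rw [Tm.lwk_gwk, Tm.lwk_lwk, Tm.gwk_gwk]

theorem LR.weaken {T : Typ} {Ψ Ψ' : GCtx} {Γ Γ' : LCtx} {t t' : Tm} {γ τ : Wk}
    (h : LR T Ψ Γ t t') (hγ : GWkTy Ψ' γ Ψ) (hτ : LWkTy Γ' τ (Γ.gwk γ))
    (hΓ : LWf Ψ' .one Γ') :
    LR (T.gwk γ) Ψ' Γ' ((t.gwk γ).lwk τ) ((t'.gwk γ).lwk τ) := by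
  cases T with
  | nat => exact LR.nat_iff.2 ((LR.nat_iff.1 h).weaken hγ hτ hΓ)
  | box Δ T => exact LR.box_iff.2 ((LR.box_iff.1 h).weaken hγ hτ hΓ)
  | arr S T =>
    obtain ⟨w, w', h₁, h₂, hw, hw', h₃⟩ := LR.arr_iff.1 h
    refine LR.arr_iff.2 ⟨_, _, h₁.weaken hγ hτ hΓ, h₂.weaken hγ hτ hΓ, hw.weaken _ _,
      hw'.weaken _ _, ?_⟩
    intro Ψ'' Γ'' γ' τ' s s' hγ' hτ' hΓ' hs
    rw [Typ.gwk_gwk] at hs ⊢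
    rw [Tm.weaken_weaken, Tm.weaken_weaken]
    exact h₃ _ _ _ _ _ _ (hγ.comp hγ') ((hτ.gwk_comp γ').comp hτ') hΓ' hs
  | mfun T =>
    obtain ⟨w, w', h₁, h₂, hw, hw', h₃⟩ := LR.mfun_iff.1 h
    refine LR.mfun_iff.2 ⟨_, _, h₁.weaken hγ hτ hΓ, h₂.weaken hγ hτ hΓ, hw.weaken _ _,
      hw'.weaken _ _, ?_⟩
    intro Ψ'' Γ'' γ' τ' Δ hγ' hτ' hΓ' hΔ
    rw [Typ.gwk_gwk, Tm.weaken_weaken, Tm.weaken_weaken]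
    exact h₃ _ _ _ _ _ (hγ.comp hγ') ((hτ.gwk_comp γ').comp hτ') hΓ' hΔ

theorem LR.symm {T : Typ} {Ψ : GCtx} {Γ : LCtx} {t t' : Tm} (h : LR T Ψ Γ t t') :
    LR T Ψ Γ t' t := by
  match T with
  | .nat => exact LR.nat_iff.2 (LR.nat_iff.1 h).symm
  | .box Δ T => exact LR.box_iff.2 (LR.box_iff.1 h).symm
  | .arr S T =>
    obtain ⟨w, w', h₁, h₂, hw, hw', h₃⟩ := LR.arr_iff.1 h
    refine LR.arr_iff.2 ⟨_, _, h₂, h₁, hw', hw, ?_⟩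
    intro Ψ' Γ' γ τ s s' hγ hτ hΓ hs
    exact (h₃ _ _ _ _ _ _ hγ hτ hΓ hs.symm).symm
  | .mfun T =>
    obtain ⟨w, w', h₁, h₂, hw, hw', h₃⟩ := LR.mfun_iff.1 h
    refine LR.mfun_iff.2 ⟨_, _, h₂, h₁, hw', hw, ?_⟩
    intro Ψ' Γ' γ τ Δ hγ hτ hΓ hΔ
    exact (h₃ _ _ _ _ _ hγ hτ hΓ hΔ).symm
termination_by T.size
decreasing_by all_goals simp; try omega

theorem LR.trans {T : Typ} {Ψ : GCtx} {Γ : LCtx} {t t' t'' : Tm} (h : LR T Ψ Γ t t')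
    (h' : LR T Ψ Γ t' t'') : LR T Ψ Γ t t'' := by
  match T with
  | .nat => exact LR.nat_iff.2 ((LR.nat_iff.1 h).trans (LR.nat_iff.1 h'))
  | .box Δ T => exact LR.box_iff.2 ((LR.box_iff.1 h).trans (LR.box_iff.1 h'))
  | .arr S T =>
    obtain ⟨w, w₁, h₁, h₂, hw, hw₁, h₃⟩ := LR.arr_iff.1 h
    obtain ⟨w₁', w'', h₁', h₂', hw₁', hw'', h₃'⟩ := LR.arr_iff.1 h'
    cases h₂.det h₁' hw₁ hw₁'
    refine LR.arr_iff.2 ⟨_, _, h₁, h₂', hw, hw'', ?_⟩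
    intro Ψ' Γ' γ τ s s' hγ hτ hΓ hs
    exact (h₃ _ _ _ _ _ _ hγ hτ hΓ (hs.trans hs.symm)).trans (h₃' _ _ _ _ _ _ hγ hτ hΓ hs)
  | .mfun T =>
    obtain ⟨w, w₁, h₁, h₂, hw, hw₁, h₃⟩ := LR.mfun_iff.1 h
    obtain ⟨w₁', w'', h₁', h₂', hw₁', hw'', h₃'⟩ := LR.mfun_iff.1 h'
    cases h₂.det h₁' hw₁ hw₁'
    refine LR.mfun_iff.2 ⟨_, _, h₁, h₂', hw, hw'', ?_⟩
    intro Ψ' Γ' γ τ Δ hγ hτ hΓ hΔ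
    exact (h₃ _ _ _ _ _ hγ hτ hΓ hΔ).trans (h₃' _ _ _ _ _ hγ hτ hΓ hΔ)
termination_by T.size
decreasing_by all_goals simp; try omega

/-- Convertible neutral forms are related, and related terms are convertible. -/
theorem LR.reflect_reify (T : Typ) :
    (∀ {Ψ : GCtx} {Γ : LCtx} {v v' : Tm}, ConvNe Ψ Γ v v' T → LR T Ψ Γ v v') ∧
    (∀ {Ψ : GCtx} {Γ : LCtx} {t t' : Tm}, LR T Ψ Γ t t' → Conv Ψ Γ t t' T) := by
  match T with
  | .nat =>
    refine ⟨fun h => LR.nat_iff.2 ?_, fun h => LR.nat_iff.1 h⟩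
    exact .red (.refl h.sound.hasTy.1) (.refl h.sound.hasTy.2) (.natNe h)
  | .box Δ T =>
    refine ⟨fun h => LR.box_iff.2 ?_, fun h => LR.box_iff.1 h⟩
    exact .red (.refl h.sound.hasTy.1) (.refl h.sound.hasTy.2) (.boxNe h)
  | .arr S T =>
    refine ⟨fun {Ψ Γ v v'} h => LR.arr_iff.2 ⟨v, v', .refl h.sound.hasTy.1,
      .refl h.sound.hasTy.2, .ne h.isNe.1, .ne h.isNe.2, ?_⟩, fun {Ψ Γ t t'} h => ?_⟩
    · intro Ψ' Γ' γ τ s s' hγ hτ hΓ hs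
      exact (LR.reflect_reify (T.gwk γ)).1
        (.app (h.weaken hγ hτ hΓ) ((LR.reflect_reify (S.gwk γ)).2 hs))
    · obtain ⟨w, w', h₁, h₂, hw, hw', h₃⟩ := LR.arr_iff.1 h
      refine .red h₁ h₂ (.arr hw hw' ?_)
      have hA := h.hasTy.1
      have hS : TWf Ψ .one S := by cases hA.twf; assumption
      have hΓ : LWf Ψ .one (Γ.snoc S) := .snoc hA.lwf hS
      have hx : LR (S.gwk .id) Ψ (Γ.snoc S) (.var 0) (.var 0) :=
        (LR.reflect_reify (S.gwk .id)).1 (.var hΓ (by simp))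
      have := (LR.reflect_reify (T.gwk .id)).2
        (h₃ Ψ (Γ.snoc S) .id (.p .id) _ _ (.id hΓ.gwf) (by simpa using (LWkTy.id Γ).p S) hΓ hx)
      simpa using this
  | .mfun T =>
    refine ⟨fun {Ψ Γ v v'} h => LR.mfun_iff.2 ⟨v, v', .refl h.sound.hasTy.1,
      .refl h.sound.hasTy.2, .ne h.isNe.1, .ne h.isNe.2, ?_⟩, fun {Ψ Γ t t'} h => ?_⟩
    · intro Ψ' Γ' γ τ Δ hγ hτ hΓ hΔ
      exact (LR.reflect_reify ((T.gwk (.q γ)).inst Δ)).1 (.mapp (h.weaken hγ hτ hΓ) hΔ)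
    · obtain ⟨w, w', h₁, h₂, hw, hw', h₃⟩ := LR.mfun_iff.1 h
      refine .red h₁ h₂ (.mfun hw hw' ?_)
      have hΓ := h.hasTy.1.lwf
      have hp : GWf (.ctx :: Ψ) := .ctx hΓ.gwf
      have := (LR.reflect_reify ((T.gwk (.q (.p .id))).inst (.cvar 0))).2
        (h₃ (.ctx :: Ψ) (Γ.gwk (.p .id)) (.p .id) .id (.cvar 0) (.p hp) (LWkTy.id _)
          (hΓ.gwk (.p hp)) (.cvar hp rfl))
      simpa [Typ.gwk_q_inst_var] using this
termination_by T.size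
decreasing_by all_goals simp; try omega

theorem LR.reflect {T : Typ} {Ψ : GCtx} {Γ : LCtx} {v v' : Tm} (h : ConvNe Ψ Γ v v' T) :
    LR T Ψ Γ v v' :=
  (LR.reflect_reify T).1 h

theorem LR.reify {T : Typ} {Ψ : GCtx} {Γ : LCtx} {t t' : Tm} (h : LR T Ψ Γ t t') :
    Conv Ψ Γ t t' T :=
  (LR.reflect_reify T).2 h

theorem LR.app {S T : Typ} {Ψ : GCtx} {Γ : LCtx} {t t' s s' : Tm}
    (h : LR (.arr S T) Ψ Γ t t') (hs : LR S Ψ Γ s s') :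
    LR T Ψ Γ (.app t s) (.app t' s') := by
  obtain ⟨w, w', h₁, h₂, hw, hw', h₃⟩ := LR.arr_iff.1 h
  have hΓ := h.hasTy.1.lwf
  have := h₃ Ψ Γ .id .id s s' (.id hΓ.gwf) (by simpa using LWkTy.id Γ) hΓ (by simpa using hs)
  simp only [Typ.gwk_id, Tm.gwk_id, Tm.lwk_id] at this
  exact this.expand (h₁.app hs.hasTy.1) (h₂.app hs.hasTy.2)

theorem LR.mapp {T : Typ} {Ψ : GCtx} {Γ Δ : LCtx} {t t' : Tm}
    (h : LR (.mfun T) Ψ Γ t t') (hΔ : LWf Ψ .zero Δ) :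
    LR (T.inst Δ) Ψ Γ (.mapp t Δ) (.mapp t' Δ) := by
  obtain ⟨w, w', h₁, h₂, hw, hw', h₃⟩ := LR.mfun_iff.1 h
  have hΓ := h.hasTy.1.lwf
  have := h₃ Ψ Γ .id .id Δ (.id hΓ.gwf) (by simpa using LWkTy.id Γ) hΓ hΔ
  rw [T.gwk_of_app_eq (Wk.q_app_eq_self fun _ => rfl)] at this
  simp only [Tm.gwk_id, Tm.lwk_id] at this
  exact this.expand (h₁.mapp hΔ) (h₂.mapp hΔ)

theorem LR.lamEta {S T : Typ} {Ψ : GCtx} {Γ : LCtx} {t t' : Tm}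
    (h : LR (.arr S T) Ψ Γ t t') :
    LR (.arr S T) Ψ Γ t (.lam (.app (t'.lwk (.p .id)) (.var 0))) := by
  obtain ⟨w, w', h₁, h₂, hw, hw', h₃⟩ := LR.arr_iff.1 h
  have ht' := h.hasTy.2
  have hη := ht'.lamEta
  refine LR.arr_iff.2 ⟨w, _, h₁, .refl hη, hw, .lam, ?_⟩
  intro Ψ' Γ' γ τ s s' hγ hτ hΓ hs
  refine (h₃ _ _ _ _ _ _ hγ hτ hΓ hs).expand (.refl (h₃ _ _ _ _ _ _ hγ hτ hΓ hs).hasTy.1) ?_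
  have hs' := hs.hasTy.2
  have hη' := hη.weaken hγ hτ hΓ
  have hr := ht'.weaken hγ hτ hΓ
  simp only [Tm.gwk, Tm.lwk, Typ.gwk] at hη' ⊢
  cases hη' with
  | lam hb =>
    refine .step (.lamBeta hb hs') ?_
    have e : Tm.instVar (.app (((t'.lwk (.p .id)).gwk γ).lwk (.q τ)) (.var ((Wk.q τ).app 0))) Γ' s'
        = .app ((t'.gwk γ).lwk τ) s' := by
      have : (((t'.lwk (.p .id)).gwk γ).lwk (.q τ)) = ((t'.gwk γ).lwk τ).lwk (.p .id) := by
        simp [Tm.lwk_gwk, Tm.lwk_lwk]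
      rw [this]
      simp [Tm.instVar, Tm.lwk_lsub _ (LSub.isPrecomp_p _ _), Tm.lsub_idSub hr.sc]
    rw [e]
    exact (h₂.weaken hγ hτ hΓ).app hs'

theorem LR.mlamEta {T : Typ} {Ψ : GCtx} {Γ : LCtx} {t t' : Tm}
    (h : LR (.mfun T) Ψ Γ t t') :
    LR (.mfun T) Ψ Γ t (.mlam (.mapp (t'.gwk (.p .id)) (.cvar 0))) := by
  obtain ⟨w, w', h₁, h₂, hw, hw', h₃⟩ := LR.mfun_iff.1 h
  have ht' := h.hasTy.2
  have hη := ht'.mlamEta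
  refine LR.mfun_iff.2 ⟨w, _, h₁, .refl hη, hw, .mlam, ?_⟩
  intro Ψ' Γ' γ τ Δ hγ hτ hΓ hΔ
  refine (h₃ _ _ _ _ _ hγ hτ hΓ hΔ).expand (.refl (h₃ _ _ _ _ _ hγ hτ hΓ hΔ).hasTy.1) ?_
  have hη' := hη.weaken hγ hτ hΓ
  simp only [Tm.gwk, Tm.lwk, Typ.gwk, LCtx.gwk] at hη' ⊢
  cases hη' with
  | mlam _ hb =>
    refine .step (.mlamBeta hΓ hb hΔ) ?_
    have e : Tm.instCtx (.mapp (((t'.gwk (.p .id)).gwk (.q γ)).lwk τ) (.cvar ((Wk.q γ).app 0))) Δ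
        = .mapp ((t'.gwk γ).lwk τ) Δ := by
      have : (((t'.gwk (.p .id)).gwk (.q γ)).lwk τ) = ((t'.gwk γ).lwk τ).gwk (.p .id) := by
        simp [Tm.lwk_gwk, Tm.gwk_gwk]
      rw [this]
      simp [Tm.instCtx, GSub.ctxAt]
    rw [e]
    exact (h₂.weaken hγ hτ hΓ).mapp hΔ

/-! ### Related local substitutions -/

/-- The logical relation on local substitutions. -/
inductive LRS : GCtx → LCtx → LSub → LSub → LCtx → Prop
  | emp {Ψ : GCtx} {Γ : LCtx} {m : ℕ} :
      LWf Ψ .one Γ → Γ.base = none → Γ.len = m → LRS Ψ Γ (.emp none m) (.emp none m) .nil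
  | empCtx {Ψ : GCtx} {Γ : LCtx} {g m : ℕ} :
      LWf Ψ .one Γ → GCtx.get Ψ g = some .ctx → Γ.base = some g → Γ.len = m →
      LRS Ψ Γ (.emp (some g) m) (.emp (some g) m) .nil
  | wk {Ψ : GCtx} {Γ : LCtx} {g m : ℕ} :
      LWf Ψ .one Γ → GCtx.get Ψ g = some .ctx → Γ.base = some g → Γ.len = m →
      LRS Ψ Γ (.wk g m) (.wk g m) (.cvar g)
  | snoc {Ψ : GCtx} {Γ Δ : LCtx} {δ δ' : LSub} {t t' : Tm} {T : Typ} :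
      LRS Ψ Γ δ δ' Δ → LR T Ψ Γ t t' → LRS Ψ Γ (.snoc δ t) (.snoc δ' t') (.snoc Δ T)

theorem LRS.symm {Ψ : GCtx} {Γ Δ : LCtx} {δ δ' : LSub} (h : LRS Ψ Γ δ δ' Δ) :
    LRS Ψ Γ δ' δ Δ := by
  induction h with
  | emp h h' h'' => exact .emp h h' h''
  | empCtx h h' h'' h''' => exact .empCtx h h' h'' h'''
  | wk h h' h'' h''' => exact .wk h h' h'' h'''
  | snoc _ h ih => exact .snoc ih h.symm

theorem LRS.left {Ψ : GCtx} {Γ Δ : LCtx} {δ δ' : LSub} (h : LRS Ψ Γ δ δ' Δ) :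
    LRS Ψ Γ δ δ Δ := by
  induction h with
  | emp h h' h'' => exact .emp h h' h''
  | empCtx h h' h'' h''' => exact .empCtx h h' h'' h'''
  | wk h h' h'' h''' => exact .wk h h' h'' h'''
  | snoc _ h ih => exact .snoc ih (h.trans h.symm)

theorem LRS.subTy {Ψ : GCtx} {Γ Δ : LCtx} {δ δ' : LSub} (h : LRS Ψ Γ δ δ' Δ) :
    SubTy Ψ Γ .one δ Δ ∧ SubTy Ψ Γ .one δ' Δ := by
  induction h with
  | emp h h' h'' => exact ⟨.emp h h' h'', .emp h h' h''⟩
  | empCtx h h' h'' h''' => exact ⟨.empCtx h h' h'' h''', .empCtx h h' h'' h'''⟩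
  | wk h h' h'' h''' => exact ⟨.wk h h' h'' h''', .wk h h' h'' h'''⟩
  | snoc _ h ih => exact ⟨.snoc ih.1 h.hasTy.1, .snoc ih.2 h.hasTy.2⟩

theorem LRS.reify {Ψ : GCtx} {Γ Δ : LCtx} {δ δ' : LSub} (h : LRS Ψ Γ δ δ' Δ) :
    ConvSub Ψ Γ δ δ' Δ := by
  induction h with
  | emp h h' h'' => exact .emp h h' h''
  | empCtx h h' h'' h''' => exact .empCtx h h' h'' h'''
  | wk h h' h'' h''' => exact .wk h h' h'' h'''
  | snoc _ h ih => exact .snoc ih h.reify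

theorem LRS.get {Ψ : GCtx} {Γ Δ : LCtx} {δ δ' : LSub} {x : ℕ} {T : Typ}
    (h : LRS Ψ Γ δ δ' Δ) (hx : Δ.get x = some T) : LR T Ψ Γ (δ.get x) (δ'.get x) := by
  induction h generalizing x with
  | snoc _ h ih =>
    cases x with
    | zero => simp at hx; simpa [← hx] using h
    | succ x => simpa using ih (by simpa using hx)
  | _ => simp at hx

theorem LRS.weaken {Ψ Ψ' : GCtx} {Γ Γ' Δ : LCtx} {δ δ' : LSub} {γ τ : Wk}
    (h : LRS Ψ Γ δ δ' Δ) (hγ : GWkTy Ψ' γ Ψ) (hτ : LWkTy Γ' τ (Γ.gwk γ))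
    (hΓ : LWf Ψ' .one Γ') :
    LRS Ψ' Γ' ((δ.gwk γ).lwk τ) ((δ'.gwk γ).lwk τ) (Δ.gwk γ) := by
  induction h with
  | emp _ h h' => exact .emp hΓ (by simp [hτ.base, h]) (by simp [hτ.len, h'])
  | empCtx _ hg h h' =>
    exact .empCtx hΓ (hγ.get hg) (by simp [hτ.base, h]) (by simp [hτ.len, h'])
  | wk _ hg h h' => exact .wk hΓ (hγ.get hg) (by simp [hτ.base, h]) (by simp [hτ.len, h'])
  | snoc _ h ih => exact .snoc ih (h.weaken hγ hτ hΓ)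

theorem LRS.gwk {Ψ Ψ' : GCtx} {Γ Δ : LCtx} {δ δ' : LSub} {γ : Wk}
    (h : LRS Ψ Γ δ δ' Δ) (hγ : GWkTy Ψ' γ Ψ) :
    LRS Ψ' (Γ.gwk γ) (δ.gwk γ) (δ'.gwk γ) (Δ.gwk γ) := by
  simpa using h.weaken hγ (LWkTy.id _) (h.subTy.1.lwf.gwk hγ)

theorem LRS.idSub {Ψ : GCtx} {Γ : LCtx} : LWf Ψ .one Γ → LRS Ψ Γ Γ.idSub Γ.idSub Γ
  | .nil h => .emp (.nil h) rfl rfl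
  | .cvar h h' => .wk (.cvar h h') h' rfl rfl
  | .snoc (T := T) h h' => by
    have hΓ : LWf Ψ .one (LCtx.snoc _ T) := .snoc h h'
    rw [← LCtx.idSub_q]
    refine .snoc ?_ (LR.reflect (.var hΓ (by simp)))
    simpa using (LRS.idSub h).weaken (.id hΓ.gwf) (by simpa using (LWkTy.id _).p T) hΓ

theorem SubTy.idSub_comp {Ψ : GCtx} {Γ Δ : LCtx} {i : Layer} {δ : LSub} :
    SubTy Ψ Γ i δ Δ → Δ.idSub.comp δ = δ
  | .emp _ _ _ => rfl
  | .empCtx _ _ _ _ => rfl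
  | .wk _ _ _ _ => rfl
  | .snoc h _ => by rw [← LCtx.idSub_q, LSub.q_comp_snoc, h.idSub_comp]

/-! ### Semantic validity -/

/-- A class of well-typed global substitutions that is closed under weakening and whose
instances of global variables respect the logical relation. -/
structure Admissible (𝒮 : GCtx → GSub → GCtx → Prop) : Prop where
  ty : ∀ {Ψ Ψ' : GCtx} {σ : GSub}, 𝒮 Ψ' σ Ψ → GSubTy Ψ' σ Ψ
  gwk : ∀ {Ψ Ψ' Ψ'' : GCtx} {σ : GSub} {γ : Wk}, 𝒮 Ψ' σ Ψ → GWkTy Ψ'' γ Ψ' →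
    𝒮 Ψ'' (σ.gwk γ) Ψ
  tm : ∀ {Ψ Ψ' : GCtx} {Γ' Δ : LCtx} {T : Typ} {σ : GSub} {u : ℕ} {δ δ' : LSub}, 𝒮 Ψ' σ Ψ →
    GCtx.get Ψ u = some (.tm Δ T) → LRS Ψ' Γ' δ δ' (Δ.gsub σ) →
    LR (T.gsub σ) Ψ' Γ' (σ.tmAt u δ) (σ.tmAt u δ')

/-- Semantic equivalence of terms under all instances by global substitutions in `𝒮` and by
related local substitutions. -/
def Val (𝒮 : GCtx → GSub → GCtx → Prop) (Ψ : GCtx) (Γ : LCtx) (t t' : Tm) (T : Typ) : Prop :=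
  ∀ (Ψ' : GCtx) (Γ' : LCtx) (σ : GSub) (δ δ' : LSub), 𝒮 Ψ' σ Ψ →
    LRS Ψ' Γ' δ δ' (Γ.gsub σ) →
    LR (T.gsub σ) Ψ' Γ' ((t.gsub σ).lsub δ) ((t'.gsub σ).lsub δ')

/-- Semantic equivalence of local substitutions. -/
def ValS (𝒮 : GCtx → GSub → GCtx → Prop) (Ψ : GCtx) (Γ : LCtx) (η η' : LSub) (Δ : LCtx) :
    Prop :=
  ∀ (Ψ' : GCtx) (Γ' : LCtx) (σ : GSub) (δ δ' : LSub), 𝒮 Ψ' σ Ψ →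
    LRS Ψ' Γ' δ δ' (Γ.gsub σ) →
    LRS Ψ' Γ' ((η.gsub σ).comp δ) ((η'.gsub σ).comp δ') (Δ.gsub σ)

theorem HasTy.toOne {Ψ : GCtx} {Γ : LCtx} {i : Layer} {t : Tm} {T : Typ}
    (h : HasTy Ψ Γ i t T) : HasTy Ψ Γ .one t T := by
  cases i with
  | zero => exact h.lift _
  | one => exact h

theorem SubTy.toOne {Ψ : GCtx} {Γ Δ : LCtx} {i : Layer} {δ : LSub}
    (h : SubTy Ψ Γ i δ Δ) : SubTy Ψ Γ .one δ Δ := by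
  cases i with
  | zero => exact h.lift _
  | one => exact h

theorem SubTy.lamBody_weaken {Ψ : GCtx} {Γ Δ : LCtx} {i : Layer} {δ : LSub} {γ τ : Wk}
    (h : SubTy Ψ Γ i ((δ.gwk γ).lwk τ) Δ) (t s : Tm) :
    (((t.lsub δ.q).gwk γ).lwk (.q τ)).instVar Γ s =
      (t.gwk γ).lsub (.snoc ((δ.gwk γ).lwk τ) s) := by
  rw [Tm.lsub_gwk, Tm.lsub_lwk, LSub.q_gwk, LSub.q_lwk, Tm.instVar, Tm.lsub_lsub,
    LSub.q_comp_snoc, LSub.comp_idSub h.sc]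

theorem SubTy.lamBody {Ψ : GCtx} {Γ Δ : LCtx} {i : Layer} {δ : LSub}
    (h : SubTy Ψ Γ i δ Δ) (t s : Tm) :
    (t.lsub δ.q).instVar Γ s = t.lsub (.snoc δ s) := by
  rw [Tm.instVar, Tm.lsub_lsub, LSub.q_comp_snoc, LSub.comp_idSub h.sc]

/-- Instantiating the most recent global variable after substituting under its binder. -/
theorem HasTy.inst_lsub {Ψ Ψ' : GCtx} {Γ Γ' : LCtx} {B B' : GBind} {i : Layer} {t : Tm}
    {T : Typ} {σ : GSub} {δ : LSub} (h : HasTy (B :: Ψ) (Γ.gwk (.p .id)) i t T)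
    (hσ : GSubTy (B' :: Ψ') σ.q (B :: Ψ)) (hδ : SubTy Ψ' Γ' .one δ (Γ.gsub σ)) (e : GEnt) :
    ((t.gsub σ.q).lsub (δ.gwk (.p .id))).gsub (GSub.id.snoc e) =
      (t.gsub (σ.snoc e)).lsub δ := by
  have ht := (h.gsub hσ).sc
  rw [LCtx.gsub_gwk_p] at ht
  have hδ' := hδ.gwk (GWkTy.p hσ.wf)
  rw [Tm.lsub_gsub _ ht hδ'.dom hδ'.sc, h.gsub_gsub _ hσ, GSub.q_comp_snoc]
  simp

section

variable {𝒮 : GCtx → GSub → GCtx → Prop} {Ψ : GCtx} {Γ Δ : LCtx}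

theorem Val.symm {t t' : Tm} {T : Typ} (h : Val 𝒮 Ψ Γ t t' T) : Val 𝒮 Ψ Γ t' t T :=
  fun _ _ _ _ _ hσ hδ => (h _ _ _ _ _ hσ hδ.symm).symm

theorem Val.trans {t t' t'' : Tm} {T : Typ} (h : Val 𝒮 Ψ Γ t t' T) (h' : Val 𝒮 Ψ Γ t' t'' T) :
    Val 𝒮 Ψ Γ t t'' T :=
  fun _ _ _ _ _ hσ hδ => (h _ _ _ _ _ hσ hδ.left).trans (h' _ _ _ _ _ hσ hδ)

theorem Val.var {x : ℕ} {T : Typ} (hx : Γ.get x = some T) : Val 𝒮 Ψ Γ (.var x) (.var x) T :=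
  fun _ _ σ _ _ _ hδ => hδ.get (LCtx.get_gsub σ hx)

theorem Val.gvar (h𝒮 : Admissible 𝒮) {u : ℕ} {η η' : LSub} {T : Typ}
    (h : ValS 𝒮 Ψ Γ η η' Δ) (hu : GCtx.get Ψ u = some (.tm Δ T)) :
    Val 𝒮 Ψ Γ (.gvar u η) (.gvar u η') T := by
  intro Ψ' Γ' σ δ δ' hσ hδ
  simp only [Tm.gsub, ← GSub.tmAt_comp]
  exact h𝒮.tm hσ hu (h _ _ _ _ _ hσ hδ)

theorem Val.zero : Val 𝒮 Ψ Γ .zero .zero .nat := by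
  intro Ψ' Γ' σ δ δ' hσ hδ
  have hΓ := hδ.subTy.1.lwf
  exact LR.nat_iff.2 (.red (.refl (.zero hΓ)) (.refl (.zero hΓ)) (.zero hΓ))

theorem Val.succ {t t' : Tm} (h : Val 𝒮 Ψ Γ t t' .nat) :
    Val 𝒮 Ψ Γ (.succ t) (.succ t') .nat := by
  intro Ψ' Γ' σ δ δ' hσ hδ
  have h' := LR.nat_iff.1 (h _ _ _ _ _ hσ hδ)
  exact LR.nat_iff.2
    (.red (.refl (.succ h'.hasTy.1)) (.refl (.succ h'.hasTy.2)) (.succ h'))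

theorem Val.app {t t' s s' : Tm} {S T : Typ} (h : Val 𝒮 Ψ Γ t t' (.arr S T))
    (h' : Val 𝒮 Ψ Γ s s' S) : Val 𝒮 Ψ Γ (.app t s) (.app t' s') T :=
  fun _ _ _ _ _ hσ hδ => LR.app (h _ _ _ _ _ hσ hδ) (h' _ _ _ _ _ hσ hδ)

theorem Val.lam (h𝒮 : Admissible 𝒮) {t t' : Tm} {S T : Typ}
    (ht : HasTy Ψ (Γ.snoc S) .one t T) (ht' : HasTy Ψ (Γ.snoc S) .one t' T)
    (h : Val 𝒮 Ψ (Γ.snoc S) t t' T) : Val 𝒮 Ψ Γ (.lam t) (.lam t') (.arr S T) := by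
  intro Ψ' Γ' σ δ δ' hσ hδ
  have hq := h𝒮.ty hσ
  have hl := (HasTy.lam ht).gsub hq |>.lsub hδ.subTy.1
  have hl' := (HasTy.lam ht').gsub hq |>.lsub hδ.subTy.2
  refine LR.arr_iff.2 ⟨_, _, .refl hl, .refl hl', .lam, .lam, ?_⟩
  intro Ψ'' Γ'' γ τ s s' hγ hτ hΓ hs
  have hlw := hl.weaken hγ hτ hΓ
  have hlw' := hl'.weaken hγ hτ hΓ
  have hδw := hδ.weaken hγ hτ hΓ
  rw [LCtx.gsub_gwk] at hδw
  have key := h Ψ'' Γ'' (σ.gwk γ) _ _ (h𝒮.gwk hσ hγ) (.snoc hδw (by rwa [← Typ.gsub_gwk]))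
  simp only [← Tm.gsub_gwk, ← Typ.gsub_gwk] at key
  rw [← hδw.subTy.1.lamBody_weaken, ← hδw.subTy.2.lamBody_weaken] at key
  simp only [Tm.gsub, Tm.lsub, Tm.gwk, Tm.lwk] at hlw hlw' ⊢
  cases hlw with
  | lam hb =>
    cases hlw' with
    | lam hb' =>
      exact key.expand (Red.lamBeta hb hs.hasTy.1).reds (Red.lamBeta hb' hs.hasTy.2).reds

theorem Val.lamBeta (h𝒮 : Admissible 𝒮) {t s : Tm} {S T : Typ}
    (ht : HasTy Ψ (Γ.snoc S) .one t T) (hs : HasTy Ψ Γ .one s S)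
    (h : Val 𝒮 Ψ (Γ.snoc S) t t T) (h' : Val 𝒮 Ψ Γ s s S) :
    Val 𝒮 Ψ Γ (.app (.lam t) s) (t.instVar Γ s) T := by
  intro Ψ' Γ' σ δ δ' hσ hδ
  have hq := h𝒮.ty hσ
  have hs' := h' _ _ _ _ _ hσ hδ
  have hl := (HasTy.lam ht).gsub hq |>.lsub hδ.subTy.1
  have key := h Ψ' Γ' σ _ _ hσ (.snoc hδ hs')
  have e : ((t.instVar Γ s).gsub σ).lsub δ' =
      (t.gsub σ).lsub (.snoc δ' ((s.gsub σ).lsub δ')) := by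
    have hi : SubTy Ψ Γ .one (.snoc Γ.idSub s) (Γ.snoc S) := .snoc (.idSub hs.lwf) hs
    rw [Tm.instVar, Tm.lsub_gsub σ ht.sc hi.dom hi.sc, Tm.lsub_lsub, LSub.gsub_snoc, LCtx.idSub,
      LCtx.wkSub_gsub, LSub.comp, ← LCtx.idSub, hδ.subTy.2.idSub_comp]
  rw [e]
  rw [← hδ.subTy.1.lamBody] at key
  simp only [Tm.gsub, Tm.lsub] at hl ⊢
  cases hl with
  | lam hb => exact key.expand (Red.lamBeta hb hs'.hasTy.1).reds (.refl key.hasTy.2)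

theorem Val.lamEta {t : Tm} {S T : Typ} (ht : HasTy Ψ Γ .one t (.arr S T))
    (h : Val 𝒮 Ψ Γ t t (.arr S T)) :
    Val 𝒮 Ψ Γ t (.lam (.app (t.lwk (.p .id)) (.var 0))) (.arr S T) := by
  intro Ψ' Γ' σ δ δ' hσ hδ
  have e : (((Tm.lam (.app (t.lwk (.p .id)) (.var 0))).gsub σ).lsub δ') =
      .lam (.app (((t.gsub σ).lsub δ').lwk (.p .id)) (.var 0)) := by
    simp only [Tm.gsub, Tm.lsub]
    rw [Tm.lwk_gsub σ ht.sc (by simp), Tm.lsub_lwk, LSub.q,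
      Tm.lwk_lsub _ (LSub.isPrecomp_p _ _)]
    simp
  rw [e]
  exact LR.lamEta (h _ _ _ _ _ hσ hδ)

theorem ValS.nil {i : Layer} {η : LSub} (h𝒮 : Admissible 𝒮) (h : SubTy Ψ Γ i η .nil) :
    ValS 𝒮 Ψ Γ η η .nil := by
  intro Ψ' Γ' σ δ δ' hσ hδ
  have h₁ := (h.toOne.gsub (h𝒮.ty hσ)).comp hδ.subTy.1
  have h₂ := (h.toOne.gsub (h𝒮.ty hσ)).comp hδ.subTy.2
  generalize (η.gsub σ).comp δ = ε at h₁
  generalize (η.gsub σ).comp δ' = ε' at h₂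
  simp only [LCtx.gsub] at *
  cases h₁ with
  | emp hΓ hb hm =>
    cases h₂ with
    | emp _ _ hm' => subst hm hm'; exact .emp hΓ hb rfl
    | empCtx _ _ hb' => simp [hb] at hb'
  | empCtx hΓ hg hb hm =>
    cases h₂ with
    | emp _ hb' => simp [hb] at hb'
    | empCtx _ _ hb' hm' =>
      rw [hb] at hb'
      cases hb'
      subst hm hm'
      exact .empCtx hΓ hg hb rfl

theorem ValS.snoc {η η' : LSub} {t t' : Tm} {T : Typ} (h : ValS 𝒮 Ψ Γ η η' Δ)
    (h' : Val 𝒮 Ψ Γ t t' T) : ValS 𝒮 Ψ Γ (.snoc η t) (.snoc η' t') (Δ.snoc T) := by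
  intro Ψ' Γ' σ δ δ' hσ hδ
  simp only [LSub.gsub_snoc, LSub.comp]
  exact .snoc (h _ _ _ _ _ hσ hδ) (h' _ _ _ _ _ hσ hδ)

end

theorem LRS.drop {Ψ : GCtx} {Γ' : LCtx} {σ : GSub} {g : ℕ} : ∀ {Γ : LCtx} {δ δ' : LSub},
    LRS Ψ Γ' δ δ' (Γ.gsub σ) → Γ.base = some g →
    LRS Ψ Γ' (((σ.ctxAt g).wkSub Γ.len).comp δ) (((σ.ctxAt g).wkSub Γ.len).comp δ') (σ.ctxAt g)
  | .nil, _, _, _, hg => by simp at hg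
  | .cvar g', _, _, h, hg => by
    simp at hg
    subst hg
    simp only [LCtx.gsub, LCtx.len] at h ⊢
    rwa [← LCtx.idSub, h.subTy.1.idSub_comp, h.subTy.2.idSub_comp]
  | .snoc Γ T, _, _, h, hg => by
    simp only [LCtx.gsub] at h
    cases h with
    | snoc h _ =>
      have e : ∀ (δ : LSub) (t : Tm),
          ((σ.ctxAt g).wkSub (Γ.len + 1)).comp (.snoc δ t) = ((σ.ctxAt g).wkSub Γ.len).comp δ := by
        intro δ t
        have := (σ.ctxAt g).wkSub_lwk_pn Γ.len 1
        rw [← this]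
        exact LSub.lwk_comp _ (LSub.isPrecomp_p δ t)
      simp only [LCtx.len, e]
      exact LRS.drop (Γ := Γ) h (by simpa using hg)

theorem ValS.wk {𝒮 : GCtx → GSub → GCtx → Prop} {Ψ : GCtx} {Γ : LCtx} {g m : ℕ}
    (hb : Γ.base = some g) (hm : Γ.len = m) : ValS 𝒮 Ψ Γ (.wk g m) (.wk g m) (.cvar g) := by
  intro Ψ' Γ' σ δ δ' hσ hδ
  subst hm
  simp only [LSub.gsub_wk, LCtx.gsub]
  exact hδ.drop hb

/-! ### The fundamental theorem at layer `0` -/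

/-- Renamings along weakenings. -/
def GRen (Ψ' : GCtx) (σ : GSub) (Ψ : GCtx) : Prop := ∃ γ, GWkTy Ψ' γ Ψ ∧ σ = .ren γ

theorem GRen.admissible : Admissible GRen where
  ty := by
    rintro Ψ Ψ' σ ⟨γ, hγ, rfl⟩
    exact .ren hγ
  gwk := by
    rintro Ψ Ψ' Ψ'' σ γ' ⟨γ, hγ, rfl⟩ hγ'
    refine ⟨γ.comp γ', hγ.comp hγ', ?_⟩
    funext k
    simp [GSub.ren, GSub.pre, GSub.gwk, GSub.id]
  tm := by
    rintro Ψ Ψ' Γ' Δ T σ u δ δ' ⟨γ, hγ, rfl⟩ hu hδ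
    rw [LCtx.gsub_ren] at hδ
    rw [Typ.gsub_ren]
    exact LR.reflect (.gvar hδ.reify (hγ.get hu))

mutual

theorem HasTy.val_ren {Ψ : GCtx} {Γ : LCtx} {i : Layer} {t : Tm} {T : Typ} :
    HasTy Ψ Γ i t T → i = .zero → Val GRen Ψ Γ t t T
  | .var _ hx, _ => .var hx
  | .gvar h hu, hi => .gvar GRen.admissible (h.val_ren hi) hu
  | .zero _, _ => .zero
  | .succ h, hi => .succ (h.val_ren hi)
  | .lam h, hi => .lam GRen.admissible h.toOne h.toOne (h.val_ren hi)
  | .app h h', hi => .app (h.val_ren hi) (h'.val_ren hi)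

theorem SubTy.val_ren {Ψ : GCtx} {Γ Δ : LCtx} {i : Layer} {δ : LSub} :
    SubTy Ψ Γ i δ Δ → i = .zero → ValS GRen Ψ Γ δ δ Δ
  | .emp h hb hm, hi => .nil GRen.admissible (i := i) (.emp h hb hm)
  | .empCtx h hg hb hm, hi => .nil GRen.admissible (i := i) (.empCtx h hg hb hm)
  | .wk _ _ hb hm, _ => .wk hb hm
  | .snoc h h', hi => .snoc (h.val_ren hi) (h'.val_ren hi)

end

/-! ### The fundamental theorem at layer `1` -/

theorem GSubTy.admissible : Admissible GSubTy where
  ty h := h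
  gwk h hγ := h.gwk hγ
  tm := by
    intro Ψ Ψ' Γ' Δ T σ u δ δ' hσ hu hδ
    have he := hσ.tm hu
    rw [GSub.tmAt, GSub.tmAt]
    generalize σ u = e at he
    cases he with
    | var hk => exact LR.reflect (.gvar hδ.reify hk)
    | tm ht =>
      have hid : GRen Ψ' .id Ψ' := ⟨.id, .id hσ.wf, rfl⟩
      simpa using ht.val_ren rfl Ψ' Γ' .id δ δ' hid (by simpa using hδ)

section

variable {Ψ : GCtx} {Γ Δ : LCtx}

theorem Val.box {t : Tm} {T : Typ} (h : HasTy Ψ Δ .zero t T) :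
    Val GSubTy Ψ Γ (.box t) (.box t) (.box Δ T) := by
  intro Ψ' Γ' σ δ δ' hσ hδ
  have hΓ := hδ.subTy.1.lwf
  have h' := h.gsub hσ
  exact LR.box_iff.2 (.red (.refl (.box hΓ h')) (.refl (.box hΓ h')) (.box hΓ h'))

theorem HasTy.letbox_body {Ψ' : GCtx} {Γ' : LCtx} {t : Tm} {T T' : Typ} {σ : GSub} {δ : LSub}
    (ht : HasTy (.tm Δ T :: Ψ) (Γ.gwk (.p .id)) .one t (T'.gwk (.p .id)))
    (hσ : GSubTy Ψ' σ Ψ) (hδ : SubTy Ψ' Γ' .one δ (Γ.gsub σ)) :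
    HasTy (.tm (Δ.gsub σ) (T.gsub σ) :: Ψ') (Γ'.gwk (.p .id)) .one
      ((t.gsub σ.q).lsub (δ.gwk (.p .id))) ((T'.gsub σ).gwk (.p .id)) := by
  cases ht.lwf.gwf with
  | tm hΔ hT =>
    have hq := hσ.qTm hΔ hT
    have := ht.gsub hq
    rw [LCtx.gsub_gwk_p, Typ.gsub_gwk_p] at this
    exact this.lsub (hδ.gwk (.p hq.wf))

theorem HasTy.instTm_lsub {Ψ' : GCtx} {Γ' : LCtx} {t : Tm} {T T' : Typ} {σ : GSub} {δ : LSub}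
    (ht : HasTy (.tm Δ T :: Ψ) (Γ.gwk (.p .id)) .one t (T'.gwk (.p .id)))
    (hσ : GSubTy Ψ' σ Ψ) (hδ : SubTy Ψ' Γ' .one δ (Γ.gsub σ)) (c : Tm) :
    ((t.gsub σ.q).lsub (δ.gwk (.p .id))).instTm c = (t.gsub (σ.snoc (.tm c))).lsub δ := by
  cases ht.lwf.gwf with
  | tm hΔ hT => exact ht.inst_lsub (hσ.qTm hΔ hT) hδ _

theorem Val.letbox {s s' t t' : Tm} {T T' : Typ} (hT' : TWf Ψ .one T')
    (ht : HasTy (.tm Δ T :: Ψ) (Γ.gwk (.p .id)) .one t (T'.gwk (.p .id)))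
    (ht' : HasTy (.tm Δ T :: Ψ) (Γ.gwk (.p .id)) .one t' (T'.gwk (.p .id)))
    (hs : Val GSubTy Ψ Γ s s' (.box Δ T))
    (h : Val GSubTy (.tm Δ T :: Ψ) (Γ.gwk (.p .id)) t t' (T'.gwk (.p .id))) :
    Val GSubTy Ψ Γ (.letbox T' s t) (.letbox T' s' t') T' := by
  intro Ψ' Γ' σ δ δ' hσ hδ
  have hb := ht.letbox_body hσ hδ.subTy.1
  have hb' := ht'.letbox_body hσ hδ.subTy.2
  have hT'' := hT'.gsub hσ
  have hΓ := hδ.subTy.1.lwf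
  simp only [Tm.gsub, Tm.lsub]
  cases LR.box_iff.1 (hs _ _ _ _ _ hσ hδ) with
  | red h₁ h₂ h₃ =>
    refine LR.expand ?_ (h₁.letbox hT'' hb) (h₂.letbox hT'' hb')
    cases h₃ with
    | @box _ _ _ c _ _ hc =>
      have key := h Ψ' Γ' (σ.snoc (.tm c)) δ δ' (hσ.snocTm (.tm hc)) (by simpa using hδ)
      rw [Typ.gwk_p_gsub_snoc, ← ht.instTm_lsub hσ hδ.subTy.1,
        ← ht'.instTm_lsub hσ hδ.subTy.2] at key
      exact key.expand (Red.letboxBeta hc hΓ hT'' hb).reds (Red.letboxBeta hc hΓ hT'' hb').reds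
    | boxNe hne =>
      cases ht.lwf.gwf with
      | tm hΔ hT =>
        have hq := hσ.qTm hΔ hT
        have key := h _ _ σ.q _ _ hq (by rw [LCtx.gsub_gwk_p]; exact hδ.gwk (.p hq.wf))
        rw [Typ.gsub_gwk_p] at key
        exact LR.reflect (.letbox hne hT'' key.reify)

theorem Val.letboxBeta {s t : Tm} {T T' : Typ} (hs : HasTy Ψ Δ .zero s T)
    (hT' : TWf Ψ .one T')
    (ht : HasTy (.tm Δ T :: Ψ) (Γ.gwk (.p .id)) .one t (T'.gwk (.p .id)))
    (h : Val GSubTy (.tm Δ T :: Ψ) (Γ.gwk (.p .id)) t t (T'.gwk (.p .id))) :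
    Val GSubTy Ψ Γ (.letbox T' (.box s) t) (t.instTm s) T' := by
  intro Ψ' Γ' σ δ δ' hσ hδ
  have hb := ht.letbox_body hσ hδ.subTy.1
  have hc := hs.gsub hσ
  have key := h Ψ' Γ' (σ.snoc (.tm (s.gsub σ))) δ δ' (hσ.snocTm (.tm hc)) (by simpa using hδ)
  have e : (t.instTm s).gsub σ = t.gsub (σ.snoc (.tm (s.gsub σ))) := by
    rw [Tm.instTm, ht.gsub_gsub σ (.instTm hs), GSub.snoc_comp]
    simp
  rw [Typ.gwk_p_gsub_snoc, ← ht.instTm_lsub hσ hδ.subTy.1, ← e] at key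
  simp only [Tm.gsub, Tm.lsub]
  exact key.expand (Red.letboxBeta hc hδ.subTy.1.lwf (hT'.gsub hσ) hb).reds (.refl key.hasTy.2)

theorem HasTy.mlam_body {Ψ' : GCtx} {Γ' : LCtx} {t : Tm} {T : Typ} {σ : GSub} {δ : LSub}
    (ht : HasTy (.ctx :: Ψ) (Γ.gwk (.p .id)) .one t T)
    (hσ : GSubTy Ψ' σ Ψ) (hδ : SubTy Ψ' Γ' .one δ (Γ.gsub σ)) :
    HasTy (.ctx :: Ψ') (Γ'.gwk (.p .id)) .one
      ((t.gsub σ.q).lsub (δ.gwk (.p .id))) (T.gsub σ.q) := by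
  have hq := hσ.qCtx
  have := ht.gsub hq
  rw [LCtx.gsub_gwk_p] at this
  exact this.lsub (hδ.gwk (.p hq.wf))

theorem Typ.inst_gsub_q (T : Typ) (σ : GSub) (Δ : LCtx) :
    (T.gsub σ.q).inst Δ = T.gsub (σ.snoc (.ctx Δ)) := by
  simp [Typ.inst, Typ.gsub_gsub, GSub.q_comp_snoc]

theorem Val.mlam {t t' : Tm} {T : Typ} (ht : HasTy (.ctx :: Ψ) (Γ.gwk (.p .id)) .one t T)
    (ht' : HasTy (.ctx :: Ψ) (Γ.gwk (.p .id)) .one t' T)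
    (h : Val GSubTy (.ctx :: Ψ) (Γ.gwk (.p .id)) t t' T) :
    Val GSubTy Ψ Γ (.mlam t) (.mlam t') (.mfun T) := by
  intro Ψ' Γ' σ δ δ' hσ hδ
  have hΓ' := hδ.subTy.1.lwf
  have hl := HasTy.mlam hΓ' (ht.mlam_body hσ hδ.subTy.1)
  have hl' := HasTy.mlam hΓ' (ht'.mlam_body hσ hδ.subTy.2)
  refine LR.mfun_iff.2 ⟨_, _, .refl hl, .refl hl', .mlam, .mlam, ?_⟩
  intro Ψ'' Γ'' γ τ Δ hγ hτ hΓ hΔ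
  have hσw := hσ.gwk hγ
  have hδw := hδ.weaken hγ hτ hΓ
  rw [LCtx.gsub_gwk] at hδw
  have e : ∀ (t : Tm) (δ : LSub),
      (((t.gsub σ.q).lsub (δ.gwk (.p .id))).gwk (.q γ)).lwk τ =
        (t.gsub (σ.gwk γ).q).lsub (((δ.gwk γ).lwk τ).gwk (.p .id)) := by
    intro t δ
    rw [Tm.lsub_gwk, Tm.lsub_lwk, Tm.gsub_gwk, GSub.q_gwk, LSub.gwk_gwk, LSub.lwk_gwk,
      LSub.gwk_gwk]
    simp
  have key := h Ψ'' Γ'' ((σ.gwk γ).snoc (.ctx Δ)) _ _ (hσw.snocCtx hΔ) (by simpa using hδw)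
  rw [← Typ.inst_gsub_q, ← ht.inst_lsub hσw.qCtx hδw.subTy.1,
    ← ht'.inst_lsub hσw.qCtx hδw.subTy.2] at key
  simp only [Tm.gsub, Tm.lsub, Tm.gwk, Tm.lwk, e, Typ.gsub_gwk, GSub.q_gwk]
  exact key.expand (Red.mlamBeta hΓ (ht.mlam_body hσw hδw.subTy.1) hΔ).reds
    (Red.mlamBeta hΓ (ht'.mlam_body hσw hδw.subTy.2) hΔ).reds

theorem Val.mapp {t t' : Tm} {T : Typ} (h : Val GSubTy Ψ Γ t t' (.mfun T))
    (hΔ : LWf Ψ .zero Δ) : Val GSubTy Ψ Γ (.mapp t Δ) (.mapp t' Δ) (T.inst Δ) := by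
  intro Ψ' Γ' σ δ δ' hσ hδ
  rw [Typ.inst_gsub]
  exact LR.mapp (h _ _ _ _ _ hσ hδ) (hΔ.gsub hσ)

theorem Val.mlamBeta {t : Tm} {T : Typ} (ht : HasTy (.ctx :: Ψ) (Γ.gwk (.p .id)) .one t T)
    (hΔ : LWf Ψ .zero Δ) (h : Val GSubTy (.ctx :: Ψ) (Γ.gwk (.p .id)) t t T) :
    Val GSubTy Ψ Γ (.mapp (.mlam t) Δ) (t.instCtx Δ) (T.inst Δ) := by
  intro Ψ' Γ' σ δ δ' hσ hδ
  have hΔ' := hΔ.gsub hσ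
  have key := h Ψ' Γ' (σ.snoc (.ctx (Δ.gsub σ))) δ δ' (hσ.snocCtx hΔ') (by simpa using hδ)
  have e : (t.instCtx Δ).gsub σ = t.gsub (σ.snoc (.ctx (Δ.gsub σ))) := by
    rw [Tm.instCtx, ht.gsub_gsub σ (.instCtx hΔ), GSub.snoc_comp]
    simp
  rw [← Typ.inst_gsub_q, ← ht.inst_lsub hσ.qCtx hδ.subTy.1, ← e] at key
  rw [Typ.inst_gsub]
  simp only [Tm.gsub, Tm.lsub]
  exact key.expand (Red.mlamBeta hδ.subTy.1.lwf (ht.mlam_body hσ hδ.subTy.1) hΔ').reds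
    (.refl key.hasTy.2)

theorem Val.mlamEta {t : Tm} {T : Typ} (h : Val GSubTy Ψ Γ t t (.mfun T)) :
    Val GSubTy Ψ Γ t (.mlam (.mapp (t.gwk (.p .id)) (.cvar 0))) (.mfun T) := by
  intro Ψ' Γ' σ δ δ' hσ hδ
  have e : (((Tm.mlam (.mapp (t.gwk (.p .id)) (.cvar 0))).gsub σ).lsub δ') =
      .mlam (.mapp (((t.gsub σ).lsub δ').gwk (.p .id)) (.cvar 0)) := by
    simp [Tm.lsub_gwk, Tm.gwk_gsub, Tm.gsub_gwk, GSub.ctxAt]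
  rw [e]
  exact LR.mlamEta (h _ _ _ _ _ hσ hδ)

end

mutual

theorem HasTy.val {Ψ : GCtx} {Γ : LCtx} {i : Layer} {t : Tm} {T : Typ} :
    HasTy Ψ Γ i t T → Val GSubTy Ψ Γ t t T
  | .var _ hx => .var hx
  | .gvar h hu => .gvar GSubTy.admissible h.val hu
  | .zero _ => .zero
  | .succ h => .succ h.val
  | .lam h => .lam GSubTy.admissible h.toOne h.toOne h.val
  | .app h h' => .app h.val h'.val
  | .box _ h => .box h
  | .letbox h _ _ hT' h' => .letbox hT' h' h' h.val h'.val
  | .mlam _ h => .mlam h h h.val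
  | .mapp h hΔ => .mapp h.val hΔ

theorem SubTy.val {Ψ : GCtx} {Γ Δ : LCtx} {i : Layer} {δ : LSub} :
    SubTy Ψ Γ i δ Δ → ValS GSubTy Ψ Γ δ δ Δ
  | .emp h hb hm => .nil GSubTy.admissible (i := i) (.emp h hb hm)
  | .empCtx h hg hb hm => .nil GSubTy.admissible (i := i) (.empCtx h hg hb hm)
  | .wk _ _ hb hm => .wk hb hm
  | .snoc h h' => .snoc h.val h'.val

end

mutual

theorem TmEq.val {Ψ : GCtx} {Γ : LCtx} {i : Layer} {t t' : Tm} {T : Typ} :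
    TmEq Ψ Γ i t t' T → Val GSubTy Ψ Γ t t' T
  | .symm h => h.val.symm
  | .trans h h' => h.val.trans h'.val
  | .var _ hx => .var hx
  | .gvar h hu => .gvar GSubTy.admissible h.val hu
  | .zero _ => .zero
  | .succ h => .succ h.val
  | .lam h => .lam GSubTy.admissible h.hasTy.1.toOne h.hasTy.2.toOne h.val
  | .app h h' => .app h.val h'.val
  | .box _ h => by
    cases h.eq_of_eq_zero rfl
    exact .box h.hasTy.1
  | .letbox h _ _ hT' h' => .letbox hT' h'.hasTy.1 h'.hasTy.2 h.val h'.val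
  | .mlam _ h => .mlam h.hasTy.1 h.hasTy.2 h.val
  | .mapp h hΔ => .mapp h.val hΔ
  | .lamBeta h h' => .lamBeta GSubTy.admissible h h' h.val h'.val
  | .lamEta h => .lamEta h h.val
  | .letboxBeta h _ hT' h' => .letboxBeta h hT' h' h'.val
  | .mlamBeta _ h hΔ => .mlamBeta h hΔ h.val
  | .mlamEta h => .mlamEta h.val

theorem SubEq.val {Ψ : GCtx} {Γ Δ : LCtx} {i : Layer} {δ δ' : LSub} :
    SubEq Ψ Γ i δ δ' Δ → ValS GSubTy Ψ Γ δ δ' Δ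
  | .emp h hb hm => .nil GSubTy.admissible (i := i) (.emp h hb hm)
  | .empCtx h hg hb hm => .nil GSubTy.admissible (i := i) (.empCtx h hg hb hm)
  | .wk _ _ hb hm => .wk hb hm
  | .snoc h h' => .snoc h.val h'.val

end

/-! ### Convertibility checking is complete -/

theorem TmEq.conv {Ψ : GCtx} {Γ : LCtx} {t t' : Tm} {T : Typ} (h : TmEq Ψ Γ .one t t' T) :
    Conv Ψ Γ t t' T := by
  have hΓ := h.hasTy.1.lwf
  have := h.val Ψ Γ .id Γ.idSub Γ.idSub (.id hΓ.gwf) (by simpa using LRS.idSub hΓ)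
  simp only [Typ.gsub_id, Tm.gsub_id, Tm.lsub_idSub h.hasTy.1.sc,
    Tm.lsub_idSub h.hasTy.2.sc] at this
  exact this.reify

theorem SubEq.conv {Ψ : GCtx} {Γ Δ : LCtx} {δ δ' : LSub} (h : SubEq Ψ Γ .one δ δ' Δ) :
    ConvSub Ψ Γ δ δ' Δ := by
  have hΓ := h.subTy.1.lwf
  have := h.val Ψ Γ .id Γ.idSub Γ.idSub (.id hΓ.gwf) (by simpa using LRS.idSub hΓ)
  simp only [LCtx.gsub_id, LSub.gsub_id, LSub.comp_idSub h.subTy.1.sc,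
    LSub.comp_idSub h.subTy.2.sc] at this
  exact this.reify

end CtxVar

theorem mainTheorem6 (Ψ : CtxVar.GCtx) (Γ : CtxVar.LCtx) :
    -- completeness
    (∀ (t t' : CtxVar.Tm) (T : CtxVar.Typ),
      CtxVar.TmEq Ψ Γ .one t t' T → CtxVar.Conv Ψ Γ t t' T) ∧
    (∀ (δ δ' : CtxVar.LSub) (Δ : CtxVar.LCtx),
      CtxVar.SubEq Ψ Γ .one δ δ' Δ → CtxVar.ConvSub Ψ Γ δ δ' Δ) ∧
    -- soundness
    (∀ (t t' : CtxVar.Tm) (T : CtxVar.Typ),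
      CtxVar.Conv Ψ Γ t t' T → CtxVar.TmEq Ψ Γ .one t t' T) ∧
    (∀ (w w' : CtxVar.Tm) (T : CtxVar.Typ),
      CtxVar.ConvNf Ψ Γ w w' T → CtxVar.TmEq Ψ Γ .one w w' T) ∧
    (∀ (v v' : CtxVar.Tm) (T : CtxVar.Typ),
      CtxVar.ConvNe Ψ Γ v v' T → CtxVar.TmEq Ψ Γ .one v v' T) ∧
    (∀ (δ δ' : CtxVar.LSub) (Δ : CtxVar.LCtx),
      CtxVar.ConvSub Ψ Γ δ δ' Δ → CtxVar.SubEq Ψ Γ .one δ δ' Δ) :=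
  ⟨fun _ _ _ h => h.conv, fun _ _ _ h => h.conv, fun _ _ _ h => h.sound,
    fun _ _ _ h => h.sound, fun _ _ _ h => h.sound, fun _ _ _ h => h.sound⟩
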